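/- **Notation.** For $\Im(\omega_2/\omega_1)>0$ let $\mathfrak P(z)$, $\zeta(z)=\zeta(z;\omega_1,\omega_2)$, $\sigma(z)$ be the Weierstrass functions with periods (not half-periods) $\omega_1,\omega_2$. For $m>0$ take $\omega_1=1$, $\omega_2=2mi$, and put $\eta_1=2\zeta(1/2)$; $\partial\zeta(u)/\partial\omega_2$ is the derivative of $\zeta(u;1,\omega_2)$ in the second period at fixed $u$. A dot is $d/dt$. **The family.** Let $I\subset\mathbb R$ be an open interval, $\beta\in\mathbb R$ a constant, and let $x_1,\dots,x_4,m,y_0:I\to\mathbb R$ and $c,c_1:I\to\mathbb C$ be $C^1$ functions with $c\neq0$, $0<y_0<m$, $x_1<x_2<x_1+1$, $x_3<x_4<x_3+1$ and $\sum_{k=1}^4x_k=\beta/\pi$. Put $$z_1=x_1,\quad z_2=x_2,\quad z_3=x_3+im,\quad z_4=x_4-im,\quad z_0=iy_0,\quad \gamma=\frac{\beta}{\pi}\,\eta_1 .$$ Suppose that for every $t\in I$ $$f(z,t)=c(t)\int_0^z e^{\gamma\xi}\,\frac{\prod_{k=1}^4\sigma(\xi-z_k)}{\sigma^2(\xi-z_0)\,\sigma^2(\xi-\overline{z}_0)}\,d\xi+c_1(t)$$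 is a single-valued meromorphic function in $\mathbb C$ which, on the strip $-m(t)<\Im z<0$, has period $1$ and, modulo this period, maps the strip conformally (one-to-one) onto the exterior, in the Riemann sphere, of two disjoint rectilinear slits: the segment with endpoints $f(z_1,t),f(z_2,t)$ and the segment with endpoints $f(x_3-im,t),f(z_4,t)$, where $x_3-im=z_3-\omega_2$. Suppose also that the straight lines containing the slits do not depend on $t$, the first being obtained from the direction of the second by rotation through the angle $\beta$. Put $A_k(t)=f(z_k(t),t)$, $1\le k\le4$ (for $k=3$ this is the value at $z_3$ of $f$ extended to the whole plane, which is obtained from the slit endpoint $f(x_3-im,t)$ by reflection in the line of the first slit), and $$D_k=f''(z_k,t)=c\,e^{\gamma z_k}\frac{\prod_{j\ne k}\sigma(z_k-z_j)}{\sigma^2(z_k-z_0)\sigma^2(z_k-\overline z_0)},\qquad \gamma_k=\frac{\dot A_k}{D_k},\qquad d_{-1}=-c\,e^{\gamma z_0}\frac{\prod_{k=1}^4\sigma(z_0-z_k)}{\sigma^2(z_0-\overline z_0)};$$ $d_{-1}$ is the residue of $f(\cdot,t)$ at $z_0$. **Theorem 3.** The functions $A_k$ are differentiable, $D_k\neq0$,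 and there is a continuous branch of $\log d_{-1}$ on $I$. The accessory parameters satisfy on $I$ the following system of ODEs. 1. For $1\le l\le 4$, $$\dot z_l=\dot z_0-\sum_{j\neq l}\gamma_j\bigl[\zeta(z_l-z_j)-\zeta(z_0-z_j)-\eta_1(z_l-z_0)\bigr]-\gamma_l\Bigl(\sum_{s\ne l}\zeta(z_l-z_s)+\gamma-\eta_1(z_l-z_0)-\zeta(z_l-z_0)-2\zeta(z_l-\overline z_0)\Bigr).$$ 2. For every continuous branch $a=\log d_{-1}$ on $I$, $$\dot a=\sum_{j=1}^4\gamma_j\bigl[\mathfrak P(z_0-z_j)+\eta_1\bigr].$$ 3. At every $t\in I$ where $W:=4\mathfrak P(z_0-\overline z_0)-\sum_{k=1}^4\mathfrak P(z_0-z_k)\neq0$, $$\dot y_0=-\sum_{k=1}^4\Im\frac{\mathfrak P(z_0-z_k)}{W}\,\dot x_k+\Re\left[\frac{4\,\frac{\partial\zeta(z_0-\overline z_0)}{\partial\omega_2}}{W}+\frac{-\frac{4\beta}{\pi}\frac{\partial\zeta(1/2)}{\partial\omega_2}-2\sum_{k=1}^4\frac{\partial\zeta(z_0-z_k)}{\partial\omega_2}-\mathfrak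 P(z_0-z_3)+\mathfrak P(z_0-z_4)}{W}\right]\dot m .$$ -/

import Mathlib

noncomputable section

namespace SlitMap

open scoped ComplexConjugate

/-! ### Weierstrass functions with periods `ω₁`, `ω₂` -/

/-- The lattice point `p₁ ω₁ + p₂ ω₂`. -/
def latticePoint (ω₁ ω₂ : ℂ) (p : ℤ × ℤ) : ℂ := p.1 * ω₁ + p.2 * ω₂

/-- The Weierstrass function `𝔓(z; ω₁, ω₂)`. It agrees with Mathlib's `PeriodPair.weierstrassP`,
see `weierstrassP_eq_wp`. -/
def wp (ω₁ ω₂ z : ℂ) : ℂ :=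
  1 / z ^ 2 + ∑' p : {p : ℤ × ℤ // p ≠ 0},
    (1 / (z - latticePoint ω₁ ω₂ p) ^ 2 - 1 / latticePoint ω₁ ω₂ p ^ 2)

/-- The Weierstrass function `ζ(z; ω₁, ω₂)`. -/
def zeta (ω₁ ω₂ z : ℂ) : ℂ :=
  1 / z + ∑' p : {p : ℤ × ℤ // p ≠ 0},
    (1 / (z - latticePoint ω₁ ω₂ p) + 1 / latticePoint ω₁ ω₂ p + z / latticePoint ω₁ ω₂ p ^ 2)

/-- The Weierstrass function `σ(z; ω₁, ω₂)`. -/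
def sigma (ω₁ ω₂ z : ℂ) : ℂ :=
  z * ∏' p : {p : ℤ × ℤ // p ≠ 0},
    ((1 - z / latticePoint ω₁ ω₂ p) *
      Complex.exp (z / latticePoint ω₁ ω₂ p + z ^ 2 / (2 * latticePoint ω₁ ω₂ p ^ 2)))

/-- The partial derivative `∂ζ(z; ω₁, ω₂) / ∂ω₂` with respect to the second period, the first
period and the point `z` being fixed. -/
def zetaDerivPeriod (ω₁ ω₂ z : ℂ) : ℂ := deriv (fun w : ℂ => zeta ω₁ w z) ω₂

theorem weierstrassP_eq_wp (L : PeriodPair) (z : ℂ) : L.weierstrassP z = wp L.ω₁ L.ω₂ z := by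
  have key : ∀ p : ℤ × ℤ, ((L.latticeEquivProd.symm p : L.lattice) : ℂ)
      = latticePoint L.ω₁ L.ω₂ p := fun p => L.latticeEquiv_symm_apply p
  have hs := (L.latticeEquivProd.symm.toEquiv.hasSum_iff).mpr (L.hasSum_weierstrassP z)
  have h := hs.summable.tsum_eq_add_tsum_ite (0 : ℤ × ℤ)
  rw [hs.tsum_eq] at h
  rw [h, wp]
  congr 1
  · simp
  · rw [← tsum_subtype_eq_of_support_subset (s := {p : ℤ × ℤ | p ≠ 0})]
    · refine tsum_congr fun p => ?_
      have hp : (p : ℤ × ℤ) ≠ 0 := p.2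
      simp [hp, key]
    · intro p hp hp0
      simp [hp0] at hp

/-! ### The accessory parameters of a one-parametric family -/

/-- A constant `β` and the accessory parameters as functions of the real parameter `t`. The index
`k : Fin 4` stands for the subscript `k + 1`. -/
structure AccessoryParameters where
  /-- angle between the straight lines that contain the slits -/
  β : ℝ
  /-- real parts of the points `z_k` -/
  x : Fin 4 → ℝ → ℝ
  /-- conformal module -/
  m : ℝ → ℝ
  /-- imaginary part of `z₀` -/
  y₀ : ℝ → ℝ
  /-- multiplicative constant -/
  c : ℝ → ℂ
  /-- additive constant -/
  c₁ : ℝ → ℂ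

namespace AccessoryParameters

variable (F : AccessoryParameters)

/-- The second period `ω₂ = 2 m i`; the first period is `ω₁ = 1`. -/
def ω₂ (t : ℝ) : ℂ := 2 * F.m t * Complex.I

/-- `z₁ = x₁`, `z₂ = x₂`, `z₃ = x₃ + i m`, `z₄ = x₄ - i m`. -/
def z (k : Fin 4) (t : ℝ) : ℂ :=
  F.x k t + (![0, 0, 1, -1] : Fin 4 → ℂ) k * F.m t * Complex.I

/-- `z₀ = i y₀`. -/
def z₀ (t : ℝ) : ℂ := F.y₀ t * Complex.I

/-- `𝔓(u)` for the periods `1`, `ω₂(t)`. -/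
def P (t : ℝ) (u : ℂ) : ℂ := wp 1 (F.ω₂ t) u

/-- `ζ(u)` for the periods `1`, `ω₂(t)`. -/
def ζ (t : ℝ) (u : ℂ) : ℂ := zeta 1 (F.ω₂ t) u

/-- `σ(u)` for the periods `1`, `ω₂(t)`. -/
def σ (t : ℝ) (u : ℂ) : ℂ := sigma 1 (F.ω₂ t) u

/-- `∂ζ(u)/∂ω₂` at the periods `1`, `ω₂(t)`. -/
def dζ (t : ℝ) (u : ℂ) : ℂ := zetaDerivPeriod 1 (F.ω₂ t) u

/-- `η₁ = 2 ζ(1/2)`. -/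
def η₁ (t : ℝ) : ℂ := 2 * F.ζ t (1 / 2)

/-- `γ = (β/π) η₁`. -/
def γ (t : ℝ) : ℂ := (F.β / Real.pi : ℝ) * F.η₁ t

/-- The integrand
`c e^{γ ξ} ∏ σ(ξ - z_k) / (σ²(ξ - z₀) σ²(ξ - conj z₀))` of the integral representation. -/
def integrand (t : ℝ) (ξ : ℂ) : ℂ :=
  F.c t * Complex.exp (F.γ t * ξ) * (∏ k, F.σ t (ξ - F.z k t)) /
    (F.σ t (ξ - F.z₀ t) ^ 2 * F.σ t (ξ - conj (F.z₀ t)) ^ 2)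

/-- The poles of the integrand: the points congruent to `z₀` or `conj z₀` modulo the lattice. -/
def IsPole (t : ℝ) (u : ℂ) : Prop :=
  ∃ p : ℤ × ℤ, u = F.z₀ t + latticePoint 1 (F.ω₂ t) p ∨
    u = conj (F.z₀ t) + latticePoint 1 (F.ω₂ t) p

/-- The strip `-m < Im z < 0` without the poles. -/
def strip (t : ℝ) : Set ℂ := {u | -F.m t < u.im ∧ u.im < 0 ∧ ¬ F.IsPole t u}

/-- `A_k(t) = f(z_k(t), t)`. -/
def A (f : ℝ → ℂ → ℂ) (k : Fin 4) (t : ℝ) : ℂ := f t (F.z k t)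

/-- The endpoint of the second slit that corresponds to the point `x₃ - i m = z₃ - ω₂` of the lower
side of the strip (`z₃` itself lies outside of the closed strip). -/
def endpoint₃ (f : ℝ → ℂ → ℂ) (t : ℝ) : ℂ := f t (F.z 2 t - F.ω₂ t)

/-- `D_k`, the value of `f''` at `z_k`. -/
def D (k : Fin 4) (t : ℝ) : ℂ :=
  F.c t * Complex.exp (F.γ t * F.z k t) * (∏ j ∈ Finset.univ.erase k, F.σ t (F.z k t - F.z j t)) /
    (F.σ t (F.z k t - F.z₀ t) ^ 2 * F.σ t (F.z k t - conj (F.z₀ t)) ^ 2)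

/-- `γ_k = A_k' / D_k`. -/
def γk (f : ℝ → ℂ → ℂ) (k : Fin 4) (t : ℝ) : ℂ := deriv (F.A f k) t / F.D k t

/-- The residue `d_{-1}` of `f` at `z₀`. -/
def residue (t : ℝ) : ℂ :=
  -F.c t * Complex.exp (F.γ t * F.z₀ t) * (∏ k, F.σ t (F.z₀ t - F.z k t)) /
    F.σ t (F.z₀ t - conj (F.z₀ t)) ^ 2

/-- The denominator `4 𝔓(z₀ - conj z₀) - ∑ 𝔓(z₀ - z_k)`. -/
def W (t : ℝ) : ℂ := 4 * F.P t (F.z₀ t - conj (F.z₀ t)) - ∑ k, F.P t (F.z₀ t - F.z k t)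

end AccessoryParameters

/-- `f(z, t)`, `t ∈ I`, is a smooth one-parametric family of conformal mappings of the annuli
`{-m(t) < Im z < 0} / (z ∼ z + 1)` onto the exteriors, in the Riemann sphere, of two disjoint
rectilinear slits that lie on fixed straight lines, given by the integral representation with the
accessory parameters `F`. (The values of `f t` at its poles are irrelevant.) -/
structure IsSlitFamily (F : AccessoryParameters) (f : ℝ → ℂ → ℂ) (I : Set ℝ) : Prop where
  smooth_x : ∀ k, ContDiffOn ℝ 1 (F.x k) I
  smooth_m : ContDiffOn ℝ 1 F.m I
  smooth_y₀ : ContDiffOn ℝ 1 F.y₀ I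
  smooth_c : ContDiffOn ℝ 1 F.c I
  smooth_c₁ : ContDiffOn ℝ 1 F.c₁ I
  y₀_pos : ∀ t ∈ I, 0 < F.y₀ t
  y₀_lt : ∀ t ∈ I, F.y₀ t < F.m t
  x_lt : ∀ t ∈ I, F.x 0 t < F.x 1 t ∧ F.x 1 t < F.x 0 t + 1 ∧
    F.x 2 t < F.x 3 t ∧ F.x 3 t < F.x 2 t + 1
  sum_x : ∀ t ∈ I, ∑ k, F.x k t = F.β / Real.pi
  c_ne_zero : ∀ t ∈ I, F.c t ≠ 0
  /-- `f(z, t)` is the primitive `c₁ + ∫₀^z` of the integrand. -/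
  map_zero : ∀ t ∈ I, f t 0 = F.c₁ t
  hasDerivAt : ∀ t ∈ I, ∀ u, ¬ F.IsPole t u → HasDerivAt (f t) (F.integrand t u) u
  /-- `f(·, t)` maps the strip, modulo the period `1`, bijectively onto the exterior of the slits;
  the pole `conj z₀` corresponds to the point at infinity. -/
  periodic : ∀ t ∈ I, ∀ u ∈ F.strip t, f t (u + 1) = f t u
  injective : ∀ t ∈ I, ∀ u ∈ F.strip t, ∀ v ∈ F.strip t, f t u = f t v → ∃ n : ℤ, v = u + n
  image : ∀ t ∈ I, f t '' F.strip t =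
    (segment ℝ (F.A f 0 t) (F.A f 1 t) ∪ segment ℝ (F.endpoint₃ f t) (F.A f 3 t))ᶜ
  disjoint : ∀ t ∈ I,
    Disjoint (segment ℝ (F.A f 0 t) (F.A f 1 t)) (segment ℝ (F.endpoint₃ f t) (F.A f 3 t))
  /-- The slits lie on two fixed straight lines; the first one is obtained from the direction of
  the second one by the rotation through the angle `β`. -/
  lines : ∃ (p q : ℂ) (θ : ℝ), ∀ t ∈ I,
    (∃ r : ℝ, F.A f 0 t = p + r * Complex.exp ((θ + F.β) * Complex.I)) ∧
    (∃ r : ℝ, F.A f 1 t = p + r * Complex.exp ((θ + F.β) * Complex.I)) ∧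
    (∃ r : ℝ, F.endpoint₃ f t = q + r * Complex.exp (θ * Complex.I)) ∧
    (∃ r : ℝ, F.A f 3 t = q + r * Complex.exp (θ * Complex.I))

end SlitMap

end

noncomputable section

namespace SlitMap

open scoped ComplexConjugate Topology ContDiff
open Filter Metric Set

/-! ### Locally uniform limits of smooth functions of several complex variables -/

section LocallyUniformLimit

variable {ι : Type} {p : Filter ι} {E : Type} [NormedAddCommGroup E] [NormedSpace ℂ E]
  {U : Set E}

/-! Everything follows from an explicit formula for the quotient of the time derivative of `f` by
its `z`-derivative. Complex conjugation and `u ↦ conj u - ω₂` are the reflections in the two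
boundary lines of the strip, and `f` turns them into the reflections in the lines carrying the
slits. Composing the two gives `f(u + ω₂) = E f(u) + B`; since the slit lines are fixed, `E` and `B`
do not depend on `t` (`exists_map_add_fixed`). Differentiating in `u` and in `t` shows that the
quotient has period `1` and that under `ω₂` it changes only by the constant `-dω₂/dt`
(`exists_functional_equation`).

The singularities of the quotient are known. At `z_k` the derivative `f'` has a simple zero and the
time derivative equals that of `A_k`, so there is a pole of order at most one with residue `γ_k`
(`tendsto_defect_z`). At the moving double poles of `f'` the quotient stays bounded, with limit
`-dz₀/dt` at `z₀` (`tendsto_quotient_pole`). The combination `velocity` of `ζ`-functions has the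
same residues, period `1` and the same value at `z₀`. The difference is therefore entire after
removal of singularities and changes by a constant under `ω₂`; by a Liouville argument
(`const_of_quasiperiodic`) it is constant, hence zero. This is `mapDot_eq`.

The equations are Taylor coefficients of that identity. Comparing first derivatives at `z_l` gives
the motion of the prevertices (`deriv_z`); the expansion at `z₀` gives the logarithmic derivative of
the residue (`timeDeriv_Φa`). The equation for `y₀` does not need the identity: `f'` has a
single-valued primitive, so it has no residue at `z₀`, and differentiating this condition in time
yields it (`pole_equation`).

The analytic preparation provides joint holomorphy of `σ` and `ζ` in the point and the second
period, differentiability in `t` of a primitive known only through its `z`-derivative and its value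
at `0`, and quasi-periodicity of `ζ` and `σ`. -/

theorem uniformCauchySeqOn_fderiv {G : Type} [NormedAddCommGroup G] [NormedSpace ℂ G]
    {F : ι → E → G} {x : E} {r : ℝ} (hr : 0 < r)
    (hF : ∀ n, DifferentiableOn ℂ (F n) (ball x (2 * r)))
    (h : UniformCauchySeqOn F p (ball x (2 * r))) :
    UniformCauchySeqOn (fun n => fderiv ℂ (F n)) p (ball x r) := by
  intro u hu
  obtain ⟨ε, hε, hεu⟩ := Metric.mem_uniformity_dist.1 hu
  have hδ : 0 < ε * r / 4 := by positivity
  filter_upwards [h _ (Metric.dist_mem_uniformity hδ)] with n hn y hy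
  apply hεu
  have hsub : ball y r ⊆ ball x (2 * r) := by
    intro w hw
    rw [mem_ball] at *
    linarith [dist_triangle w y x]
  have hd : ∀ m, DifferentiableOn ℂ (F m) (ball y r) := fun m => (hF m).mono hsub
  have hat : ∀ m, DifferentiableAt ℂ (F m) y :=
    fun m => (hd m).differentiableAt (ball_mem_nhds y hr)
  have hdiff : DifferentiableOn ℂ (fun w => F n.1 w - F n.2 w) (ball y r) := (hd _).sub (hd _)
  have hmaps : MapsTo (fun w => F n.1 w - F n.2 w) (ball y r)
      (closedBall ((fun w => F n.1 w - F n.2 w) y) (ε * r / 2)) := by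
    intro w hw
    have h1 : dist (F n.1 w) (F n.2 w) < ε * r / 4 := hn w (hsub hw)
    have h2 : dist (F n.1 y) (F n.2 y) < ε * r / 4 := hn y (hsub (mem_ball_self hr))
    rw [dist_eq_norm] at h1 h2
    rw [mem_closedBall, dist_eq_norm]
    refine (norm_sub_le _ _).trans ?_
    linarith
  -- Cauchy's estimate on the disk of radius `r` about `y`: oscillation at most `ε r / 2` bounds the
  -- derivative by `ε / 2`.
  have key := Complex.norm_fderiv_le_div_of_mapsTo_ball hdiff hmaps hr
  rw [fderiv_fun_sub (hat _) (hat _)] at key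
  rw [dist_eq_norm]
  refine key.trans_lt ?_
  rw [div_lt_iff₀ hr]
  nlinarith

variable [ProperSpace E]

/-- Cauchy estimates make the derivatives locally uniformly Cauchy, and completeness supplies a
limit, which must be the derivative of `f`. Properness of `E` makes closed balls compact, so that
locally uniform convergence is uniform on them. -/
theorem tendstoLocallyUniformlyOn_fderiv [NeBot p] {G : Type} [NormedAddCommGroup G]
    [NormedSpace ℂ G] [CompleteSpace G] {F : ι → E → G} {f : E → G} (hU : IsOpen U)
    (hF : ∀ n, DifferentiableOn ℂ (F n) U) (h : TendstoLocallyUniformlyOn F f p U) :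
    DifferentiableOn ℂ f U ∧
      TendstoLocallyUniformlyOn (fun n => fderiv ℂ (F n)) (fderiv ℂ f) p U := by
  have hloc : ∀ x ∈ U, ∃ r > 0, ball x r ⊆ U ∧
      UniformCauchySeqOn (fun n => fderiv ℂ (F n)) p (ball x r) := by
    intro x hx
    obtain ⟨R, hR, hRU⟩ := nhds_basis_closedBall.mem_iff.1 (hU.mem_nhds hx)
    have h1 : TendstoUniformlyOn F f p (closedBall x R) :=
      (tendstoLocallyUniformlyOn_iff_forall_isCompact hU).1 h _ hRU (isCompact_closedBall x R)
    have hsub : ball x (2 * (R / 2)) ⊆ closedBall x R := by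
      rw [mul_div_cancel₀ R two_ne_zero]; exact ball_subset_closedBall
    exact ⟨R / 2, by positivity, (ball_subset_ball (by linarith)).trans
      (ball_subset_closedBall.trans hRU), uniformCauchySeqOn_fderiv (by positivity)
      (fun n => (hF n).mono (hsub.trans hRU)) (h1.mono hsub).uniformCauchySeqOn⟩
  have hlim : ∀ x ∈ U, ∃ L, Tendsto (fun n => fderiv ℂ (F n) x) p (𝓝 L) := by
    intro x hx
    obtain ⟨r, hr, -, hc⟩ := hloc x hx
    exact CompleteSpace.complete (hc.cauchy_map (mem_ball_self hr))
  choose! g hg using hlim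
  have htend : TendstoLocallyUniformlyOn (fun n => fderiv ℂ (F n)) g p U := by
    refine tendstoLocallyUniformlyOn_of_forall_exists_nhds fun x hx => ?_
    obtain ⟨r, hr, hrU, hc⟩ := hloc x hx
    exact ⟨ball x r, mem_nhdsWithin_of_mem_nhds (ball_mem_nhds x hr),
      hc.tendstoUniformlyOn_of_tendsto fun y hy => hg y (hrU hy)⟩
  have hder : ∀ x ∈ U, HasFDerivAt f (g x) x := fun x hx =>
    hasFDerivAt_of_tendsto_locally_uniformly_on' hU htend hF (fun y hy => h.tendsto_at hy) hx
  exact ⟨fun x hx => (hder x hx).differentiableAt.differentiableWithinAt,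
    htend.congr_right fun x hx => (hder x hx).fderiv.symm⟩

/-- The target space is quantified inside the induction because each step passes to derivatives,
whose values lie in `E →L[ℂ] G`. -/
theorem contDiffOn_nat_of_tendstoLocallyUniformlyOn [NeBot p] (hU : IsOpen U) (n : ℕ) :
    ∀ {G : Type} [NormedAddCommGroup G] [NormedSpace ℂ G] [CompleteSpace G] {F : ι → E → G}
      {f : E → G}, (∀ i, ContDiffOn ℂ ∞ (F i) U) → TendstoLocallyUniformlyOn F f p U →
      ContDiffOn ℂ n f U := by
  induction n with
  | zero =>
    intro G _ _ _ F f hF h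
    exact contDiffOn_zero.2 (h.continuousOn (Frequently.of_forall fun i => (hF i).continuousOn))
  | succ n ih =>
    intro G _ _ _ F f hF h
    obtain ⟨hd, ht⟩ := tendstoLocallyUniformlyOn_fderiv hU
      (fun i => (hF i).differentiableOn (by simp)) h
    refine (contDiffOn_succ_iff_fderiv_of_isOpen hU).2 ⟨hd, by simp, ih (fun i => ?_) ht⟩
    exact ((contDiffOn_infty_iff_fderiv_of_isOpen hU).1 (hF i)).2

/-- A locally uniform limit of smooth functions of several complex variables is smooth. -/
theorem contDiffOn_of_tendstoLocallyUniformlyOn [NeBot p] (hU : IsOpen U) {G : Type}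
    [NormedAddCommGroup G] [NormedSpace ℂ G] [CompleteSpace G] {F : ι → E → G} {f : E → G}
    (hF : ∀ i, ContDiffOn ℂ ∞ (F i) U) (h : TendstoLocallyUniformlyOn F f p U) :
    ContDiffOn ℂ ∞ f U :=
  contDiffOn_infty.2 fun n => contDiffOn_nat_of_tendstoLocallyUniformlyOn hU n hF h

end LocallyUniformLimit

/-! ### Quasi-periodic functions with removable singularities -/

theorem exists_lattice_translate {τ : ℂ} (hτ : 0 < τ.im) (z : ℂ) :
    ∃ (m n : ℤ) (x y : ℝ), x ∈ Icc (0 : ℝ) 1 ∧ y ∈ Icc (0 : ℝ) 1 ∧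
      z = (x + y * τ) + (m + n * τ) := by
  set y := z.im / τ.im with hy
  set x := z.re - y * τ.re with hx
  refine ⟨⌊x⌋, ⌊y⌋, Int.fract x, Int.fract y, ⟨Int.fract_nonneg _, (Int.fract_lt_one _).le⟩,
    ⟨Int.fract_nonneg _, (Int.fract_lt_one _).le⟩, ?_⟩
  have e : ((Int.fract x : ℝ) + (Int.fract y : ℝ) * τ) + (((⌊x⌋ : ℤ) : ℂ) + ((⌊y⌋ : ℤ) : ℂ) * τ)
      = (x : ℂ) + y * τ := by
    have h1 : (x : ℂ) = ((⌊x⌋ : ℤ) : ℂ) + (Int.fract x : ℝ) := by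
      exact_mod_cast (Int.floor_add_fract x).symm
    have h2 : (y : ℂ) = ((⌊y⌋ : ℤ) : ℂ) + (Int.fract y : ℝ) := by
      exact_mod_cast (Int.floor_add_fract y).symm
    rw [h1, h2]; ring
  rw [e]
  apply Complex.ext
  · simp [hx]
  · simp [hy, hτ.ne']

theorem bounded_of_doubly_periodic {f : ℂ → ℂ} {τ : ℂ} (hτ : 0 < τ.im) (hf : Continuous f)
    (h1 : ∀ z, f (z + 1) = f z) (h2 : ∀ z, f (z + τ) = f z) : Bornology.IsBounded (range f) := by
  have hc : IsCompact ((fun q : ℝ × ℝ => f (q.1 + q.2 * τ)) ''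
      (Icc (0 : ℝ) 1 ×ˢ Icc (0 : ℝ) 1)) :=
    (isCompact_Icc.prod isCompact_Icc).image (by fun_prop)
  refine hc.isBounded.subset ?_
  rintro _ ⟨z, rfl⟩
  obtain ⟨m, n, x, y, hx, hy, rfl⟩ := exists_lattice_translate hτ z
  have p1 : Function.Periodic f 1 := h1
  have p2 : Function.Periodic f τ := h2
  refine ⟨(x, y), ⟨hx, hy⟩, ?_⟩
  have := p2.int_mul n (x + y * τ + m)
  have h3 := p1.int_mul m (x + y * τ)
  simp only [mul_one] at h3
  rw [← add_assoc, this, h3]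

/-- An entire function with period `1` that changes by a constant under the second period is
constant. -/
theorem const_of_entire_quasiperiodic {f : ℂ → ℂ} {τ C : ℂ} (hτ : 0 < τ.im)
    (hf : Differentiable ℂ f) (h1 : ∀ z, f (z + 1) = f z) (h2 : ∀ z, f (z + τ) = f z + C)
    (z : ℂ) : f z = f 0 := by
  have hd : Differentiable ℂ (deriv f) := (hf.contDiff (n := 2)).differentiable_deriv_two
  -- The additive constant disappears on differentiation, so `deriv f` is elliptic and entire, hence
  -- constant by Liouville. Thus `f` is affine, and the period `1` forces slope zero.
  have hb := bounded_of_doubly_periodic hτ hd.continuous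
    (fun z => by rw [← deriv_comp_add_const, funext h1])
    (fun z => by rw [← deriv_comp_add_const, funext h2, deriv_add_const])
  have hconst : ∀ z, HasDerivAt (fun z => f z - deriv f 0 * z) 0 z := by
    intro z
    refine ((hf z).hasDerivAt.fun_sub ((hasDerivAt_id z).const_mul (deriv f 0))).congr_deriv ?_
    rw [hd.apply_eq_apply_of_bounded hb z 0]; simp
  have hlin : ∀ z, f z - deriv f 0 * z = f 0 := by
    intro z
    have := is_const_of_deriv_eq_zero (𝕜 := ℂ) (fun z => (hconst z).differentiableAt)
      (fun z => (hconst z).deriv) z 0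
    simpa using this
  have h0 : deriv f 0 = 0 := by
    have e1 := hlin 1
    have e2 := h1 0
    rw [zero_add] at e2
    rw [e2] at e1
    linear_combination -e1
  simpa [h0] using hlin z

/-- The condition `(z - s) K z → 0` excludes genuine poles, so Riemann's theorem extends `K` to an
entire function. The two shift relations survive by continuity because `S` has no accumulation
points, and the entire case applies. -/
theorem const_of_quasiperiodic {K : ℂ → ℂ} {S : Set ℂ} {τ C : ℂ} (hτ : 0 < τ.im)
    (hd : ∀ z ∉ S, DifferentiableAt ℂ K z) (hS : ∀ s, ∀ᶠ z in 𝓝[≠] s, z ∉ S)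
    (hlim : ∀ s ∈ S, Tendsto (fun z => (z - s) * K z) (𝓝[≠] s) (𝓝 0))
    (h1 : ∀ z ∉ S, K (z + 1) = K z) (h2 : ∀ z ∉ S, K (z + τ) = K z + C) :
    ∃ c, ∀ z ∉ S, K z = c := by
  -- This is the extension of `K` over the removable singularities: it agrees with `K` off `S` by
  -- continuity.
  set L : ℂ → ℂ := fun z => limUnder (𝓝[≠] z) K with hL
  have hLK : ∀ z ∉ S, L z = K z := fun z hz =>
    ((hd z hz).continuousAt.tendsto.mono_left nhdsWithin_le_nhds).limUnder_eq
  have hlim' : ∀ s, Tendsto (fun z => (z - s) * K z) (𝓝[≠] s) (𝓝 0) := by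
    intro s
    by_cases hs : s ∈ S
    · exact hlim s hs
    · have h3 : ContinuousAt (fun z => (z - s) * K z) s :=
        (by fun_prop : ContinuousAt (fun z => z - s) s).mul (hd s hs).continuousAt
      have := h3.tendsto.mono_left (nhdsWithin_le_nhds (s := {s}ᶜ))
      simpa using this
  have hLd : Differentiable ℂ L := by
    intro s
    have hev := hS s
    rw [eventually_nhdsWithin_iff] at hev
    have hdiff : DifferentiableOn ℂ K ({z | z ∈ ({s} : Set ℂ)ᶜ → z ∉ S} \ {s}) := fun z hz =>
      (hd z (hz.1 hz.2)).differentiableWithinAt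
    have ho : (fun z => K z - K s) =o[𝓝[≠] s] fun z => (z - s)⁻¹ := by
      rw [Asymptotics.isLittleO_iff_tendsto']
      · have h3 : Tendsto (fun z => (z - s) * K z - (z - s) * K s) (𝓝[≠] s) (𝓝 0) := by
          have h4 : ContinuousAt (fun z => (z - s) * K s) s := by fun_prop
          have h5 := h4.tendsto.mono_left (nhdsWithin_le_nhds (s := {s}ᶜ))
          simpa using (hlim' s).sub h5
        refine h3.congr fun z => ?_
        rw [div_inv_eq_mul]; ring
      · filter_upwards [self_mem_nhdsWithin] with z hz h0
        exact absurd (inv_eq_zero.1 h0) (sub_ne_zero.2 hz)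
    have := Complex.differentiableOn_update_limUnder_of_isLittleO hev hdiff ho
    refine (this.differentiableAt hev).congr_of_eventuallyEq ?_
    filter_upwards [hev] with z hz
    by_cases hzs : z = s
    · subst hzs; simp [hL]
    · rw [Function.update_of_ne hzs, hLK z (hz hzs)]
  have ext : ∀ {f g : ℂ → ℂ}, Continuous f → Continuous g →
      (∀ s, ∀ᶠ z in 𝓝[≠] s, f z = g z) → ∀ s, f s = g s := by
    intro f g hf hg h s
    exact tendsto_nhds_unique_of_eventuallyEq (hf.continuousAt.tendsto.mono_left nhdsWithin_le_nhds)
      (hg.continuousAt.tendsto.mono_left nhdsWithin_le_nhds) (h s)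
  have hShift : ∀ s w, ∀ᶠ z in 𝓝[≠] s, z + w ∉ S := by
    intro s w
    have ht : Tendsto (fun z => z + w) (𝓝[≠] s) (𝓝[≠] (s + w)) := by
      refine tendsto_nhdsWithin_of_tendsto_nhds_of_eventually_within _ ?_ ?_
      · exact (by fun_prop : Continuous fun z : ℂ => z + w).continuousAt.tendsto.mono_left
          nhdsWithin_le_nhds
      · filter_upwards [self_mem_nhdsWithin] with z hz h
        exact hz (add_right_cancel h)
    exact ht.eventually (hS (s + w))
  have hLc := hLd.continuous
  have p1 : ∀ z, L (z + 1) = L z := by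
    refine ext (by fun_prop) hLc fun s => ?_
    filter_upwards [hS s, hShift s 1] with z hz hz'
    rw [hLK z hz, hLK _ hz', h1 z hz]
  have p2 : ∀ z, L (z + τ) = L z + C := by
    refine ext (by fun_prop) (by fun_prop) fun s => ?_
    filter_upwards [hS s, hShift s τ] with z hz hz'
    rw [hLK z hz, hLK _ hz', h2 z hz]
  exact ⟨L 0, fun z hz => by rw [← hLK z hz, const_of_entire_quasiperiodic hτ hLd p1 p2]⟩

/-! ### Primitives in a punctured disk -/

/-- The exponential maps the half-plane `Re w < log r`, which is convex, onto the punctured disk of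
radius `r` about `0`. -/
theorem isPreconnected_punctured_ball (a : ℂ) {r : ℝ} (hr : 0 < r) :
    IsPreconnected (ball a r \ {a}) := by
  have : ball a r \ {a} = (fun w => a + Complex.exp w) '' {w | w.re < Real.log r} := by
    ext z
    simp only [Set.mem_sdiff, mem_ball, mem_singleton_iff, mem_image, mem_ofPred_eq, dist_eq_norm]
    constructor
    · rintro ⟨h1, h2⟩
      have h0 := sub_ne_zero.2 h2
      refine ⟨Complex.log (z - a), ?_, by rw [Complex.exp_log h0]; ring⟩
      rw [Complex.log_re]
      exact Real.log_lt_log (norm_pos_iff.2 h0) h1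
    · rintro ⟨w, hw, rfl⟩
      refine ⟨?_, by simp [Complex.exp_ne_zero]⟩
      rw [add_sub_cancel_left, Complex.norm_exp]
      exact (Real.lt_log_iff_exp_lt hr).1 hw
  rw [this]
  exact (convex_halfSpace_re_lt _).isPreconnected.image _ (by fun_prop)

/-- After subtracting a primitive of `R`, the integral over a circle is zero because a primitive
exists, and equals `2πi k` by direct computation. With `k = 0`, the difference is constant on the
connected punctured disk. -/
theorem residue_eq_zero_of_primitive {ψ R : ℂ → ℂ} {a k : ℂ} {r : ℝ} (hr : 0 < r)
    (hR : DifferentiableOn ℂ R (ball a r))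
    (h : ∀ z ∈ ball a r \ {a}, HasDerivAt ψ (k / (z - a) + R z) z) :
    k = 0 ∧ ∃ Q : ℂ → ℂ, DifferentiableOn ℂ Q (ball a r) ∧ ∀ z ∈ ball a r \ {a}, ψ z = Q z := by
  obtain ⟨Q, hQ⟩ := hR.isExactOn_ball
  have hχ : ∀ z ∈ ball a r \ {a}, HasDerivAt (fun z => ψ z - Q z) (k / (z - a)) z := by
    intro z hz
    exact ((h z hz).fun_sub (hQ z hz.1)).congr_deriv (by ring)
  have hk : k = 0 := by
    have h0 : (∮ z in C(a, r / 2), k / (z - a)) = 0 := by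
      refine circleIntegral.integral_eq_zero_of_hasDerivWithinAt (f := fun z => ψ z - Q z)
        (by positivity) fun z hz => (hχ z ⟨?_, ?_⟩).hasDerivWithinAt
      · rw [mem_sphere] at hz; rw [mem_ball]; linarith
      · rintro rfl; rw [mem_sphere, dist_self] at hz; linarith
    have h1 : (∮ z in C(a, r / 2), k / (z - a)) = k * (2 * Real.pi * Complex.I) := by
      rw [← circleIntegral.integral_sub_inv_of_mem_ball
        (mem_ball_self (by positivity : 0 < r / 2)) (c := a), ← circleIntegral.integral_const_mul]
      simp [div_eq_mul_inv]
    rw [h1] at h0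
    exact (mul_eq_zero.1 h0).resolve_right Complex.two_pi_I_ne_zero
  refine ⟨hk, ?_⟩
  have hopen : IsOpen (ball a r \ {a}) := isOpen_ball.sdiff isClosed_singleton
  obtain ⟨c, hc⟩ := hopen.exists_is_const_of_deriv_eq_zero (isPreconnected_punctured_ball a hr)
    (f := fun z => ψ z - Q z)
    (fun z hz => (hχ z hz).differentiableAt.differentiableWithinAt)
    (fun z hz => by rw [(hχ z hz).deriv, hk]; simp)
  refine ⟨fun z => Q z + c, fun z hz => ((hQ z hz).differentiableAt.add_const c).differentiableWithinAt,
    fun z hz => ?_⟩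
  rw [← hc z hz]; ring

theorem exists_punctured_ball {a : ℂ} {p : ℂ → Prop} {N : ℂ → ℂ} (hN : AnalyticAt ℂ N a)
    (h : ∀ᶠ z in 𝓝[≠] a, p z) :
    ∃ r > 0, DifferentiableOn ℂ N (ball a r) ∧ ∀ z ∈ ball a r \ {a}, p z := by
  rw [eventually_nhdsWithin_iff] at h
  obtain ⟨r, hr, hr'⟩ := Metric.eventually_nhds_iff_ball.1
    (h.and (hN.eventually_analyticAt))
  exact ⟨r, hr, fun z hz => (hr' z hz).2.differentiableAt.differentiableWithinAt,
    fun z hz => (hr' z hz.1).1 hz.2⟩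

theorem eq_add_sub_mul_dslope (N : ℂ → ℂ) (a z : ℂ) : N z = N a + (z - a) * dslope N a z := by
  have := sub_smul_dslope N a z
  rw [smul_eq_mul] at this
  rw [this]; ring

/-- The number `e'(a)` is the residue of `e(z) / (z - a)²`, and a function with a single-valued
primitive has no residue. -/
theorem deriv_eq_zero_of_primitive_div_sq {f e : ℂ → ℂ} {a : ℂ} (he : AnalyticAt ℂ e a)
    (h : ∀ᶠ z in 𝓝[≠] a, HasDerivAt f (e z / (z - a) ^ 2) z) : deriv e a = 0 := by
  obtain ⟨r, hr, hd, hr'⟩ := exists_punctured_ball he h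
  have hd1 := (Complex.differentiableOn_dslope (ball_mem_nhds a hr)).2 hd
  have hd2 := (Complex.differentiableOn_dslope (ball_mem_nhds a hr)).2 hd1
  refine (residue_eq_zero_of_primitive (ψ := fun z => f z + e a / (z - a))
    (R := dslope (dslope e a) a) hr hd2 fun z hz => ?_).1
  have hz0 : z - a ≠ 0 := sub_ne_zero.2 hz.2
  have h1 : HasDerivAt (fun z => e a / (z - a)) (-e a / (z - a) ^ 2) z := by
    have := (((hasDerivAt_id z).sub_const a).inv hz0).const_mul (e a)
    simpa [div_eq_mul_inv, neg_mul, mul_neg] using this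
  refine ((hr' z hz).fun_add h1).congr_deriv ?_
  have e1 := eq_add_sub_mul_dslope e a z
  have e2 := eq_add_sub_mul_dslope (dslope e a) a z
  rw [dslope_same] at e2
  rw [e1, e2]
  field_simp
  ring

/-- Termwise integration of the Laurent expansion. The `1/(z - a)` term of the derivative is absent
because `ψ` is single-valued, so no logarithm appears. -/
theorem exists_eq_of_deriv_eq_div_cube {ψ N : ℂ → ℂ} {a : ℂ} (hN : AnalyticAt ℂ N a)
    (h : ∀ᶠ z in 𝓝[≠] a, HasDerivAt ψ (N z / (z - a) ^ 3) z) :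
    ∃ Q : ℂ → ℂ, AnalyticAt ℂ Q a ∧ ∀ᶠ z in 𝓝[≠] a,
      (z - a) ^ 2 * ψ z = -N a / 2 - deriv N a * (z - a) + (z - a) ^ 2 * Q z := by
  obtain ⟨r, hr, hd, hr'⟩ := exists_punctured_ball hN h
  have hd1 := (Complex.differentiableOn_dslope (ball_mem_nhds a hr)).2 hd
  have hd2 := (Complex.differentiableOn_dslope (ball_mem_nhds a hr)).2 hd1
  have hd3 := (Complex.differentiableOn_dslope (ball_mem_nhds a hr)).2 hd2
  obtain ⟨-, Q, hQ, hQ'⟩ := residue_eq_zero_of_primitive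
    (ψ := fun z => ψ z + (N a / 2 * ((z - a) ^ 2)⁻¹ + deriv N a * (z - a)⁻¹))
    (k := deriv (dslope N a) a) (R := dslope (dslope (dslope N a) a) a) hr hd3 fun z hz => by
      have hz0 : z - a ≠ 0 := sub_ne_zero.2 hz.2
      have h1 : HasDerivAt (fun z => z - a) 1 z := (hasDerivAt_id z).sub_const a
      have h2 := (((h1.fun_pow 2).fun_inv (pow_ne_zero 2 hz0)).const_mul (N a / 2)).fun_add
        ((h1.fun_inv hz0).const_mul (deriv N a))
      refine ((hr' z hz).fun_add h2).congr_deriv ?_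
      have e1 := eq_add_sub_mul_dslope N a z
      have e2 := eq_add_sub_mul_dslope (dslope N a) a z
      have e3 := eq_add_sub_mul_dslope (dslope (dslope N a) a) a z
      rw [dslope_same] at e2 e3
      rw [e1, e2, e3]
      field_simp
      push_cast
      ring
  refine ⟨Q, hQ.analyticAt (ball_mem_nhds a hr), ?_⟩
  have hmem : ball a r \ {a} ∈ 𝓝[≠] a := by
    rw [Set.sdiff_eq, inter_comm]
    exact inter_mem_nhdsWithin _ (ball_mem_nhds a hr)
  filter_upwards [hmem] with z hz
  have hz0 : z - a ≠ 0 := sub_ne_zero.2 hz.2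
  rw [← hQ' z hz]
  field_simp
  ring

/-! ### Dependence of primitives on a real parameter -/

section Parameter

variable {f : ℝ → ℂ → ℂ} {φ φ' : ℂ → ℝ → ℂ} {t₀ : ℝ}

/-- Uniform continuity of `φ'` on the compact product gives one neighbourhood of `t₀` for all `z`;
there the mean value inequality is applied to `φ z x - x φ' z t₀`. -/
theorem taylor_parameter_uniform {s : Set ℂ} (hs : IsCompact s) {δ : ℝ} (hδ : 0 < δ)
    (h2 : ∀ z ∈ s, ∀ t ∈ closedBall t₀ δ, HasDerivAt (φ z) (φ' z t) t)
    (h3 : ContinuousOn (fun q : ℂ × ℝ => φ' q.1 q.2) (s ×ˢ closedBall t₀ δ)) {ε : ℝ}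
    (hε : 0 < ε) :
    ∀ᶠ t in 𝓝 t₀, ∀ z ∈ s, ‖φ z t - φ z t₀ - (t - t₀) * φ' z t₀‖ ≤ ε * |t - t₀| := by
  have huc := (hs.prod (isCompact_closedBall t₀ δ)).uniformContinuousOn_of_continuous h3
  obtain ⟨η, hη, hη'⟩ := Metric.uniformContinuousOn_iff.1 huc ε hε
  have hm : 0 < min η δ := lt_min hη hδ
  filter_upwards [ball_mem_nhds t₀ hm] with t ht z hz
  have hball : ∀ x ∈ ball t₀ (min η δ), x ∈ closedBall t₀ δ := fun x hx =>
    ball_subset_closedBall (ball_subset_ball (min_le_right _ _) hx)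
  have hder : ∀ x ∈ ball t₀ (min η δ),
      HasDerivWithinAt (fun x : ℝ => φ z x - x * φ' z t₀) (φ' z x - φ' z t₀)
        (ball t₀ (min η δ)) x := by
    intro x hx
    have h4 : HasDerivAt (fun x : ℝ => (x : ℂ) * φ' z t₀) (1 * φ' z t₀) x :=
      (Complex.ofRealCLM.hasDerivAt (x := x)).mul_const _
    exact (((h2 z hz x (hball x hx)).fun_sub h4).congr_deriv (by ring)).hasDerivWithinAt
  have := (convex_ball t₀ (min η δ)).norm_image_sub_le_of_norm_hasDerivWithin_le (C := ε) hder
    (fun x hx => ?_) (mem_ball_self hm) ht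
  · rw [Real.norm_eq_abs] at this
    refine le_trans (le_of_eq ?_) this
    congr 1; ring
  · have := hη' (z, x) ⟨hz, hball x hx⟩ (z, t₀) ⟨hz, mem_closedBall_self hδ.le⟩ ?_
    · rw [dist_eq_norm] at this; exact this.le
    · rw [Prod.dist_eq]
      simp only [dist_self]
      exact max_lt hη (lt_of_lt_of_le hx (min_le_left _ _))

/-- A substitute for differentiation under the integral sign: the mean value inequality in `z` is
applied to `f t - f t₀ - (t - t₀) Q`, whose `z`-derivative is uniformly `o(t - t₀)`. -/
theorem hasDerivAt_parameter_sub {a : ℂ} {r δ : ℝ} (hδ : 0 < δ)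
    (h1 : ∀ t ∈ closedBall t₀ δ, ∀ z ∈ closedBall a r, HasDerivAt (f t) (φ z t) z)
    (h2 : ∀ z ∈ closedBall a r, ∀ t ∈ closedBall t₀ δ, HasDerivAt (φ z) (φ' z t) t)
    (h3 : ContinuousOn (fun q : ℂ × ℝ => φ' q.1 q.2) (closedBall a r ×ˢ closedBall t₀ δ))
    {Q : ℂ → ℂ} (hQ : ∀ z ∈ closedBall a r, HasDerivAt Q (φ' z t₀) z) {z w : ℂ}
    (hz : z ∈ closedBall a r) (hw : w ∈ closedBall a r) :
    HasDerivAt (fun t => f t z - f t w) (Q z - Q w) t₀ := by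
  rw [hasDerivAt_iff_isLittleO, Asymptotics.isLittleO_iff]
  intro ε hε
  -- The mean value inequality costs a factor `‖z - w‖`; the `+ 1` avoids division by zero.
  have hε' : 0 < ε / (‖z - w‖ + 1) := by positivity
  filter_upwards [taylor_parameter_uniform (isCompact_closedBall a r) hδ h2 h3 hε',
    closedBall_mem_nhds t₀ hδ] with t ht htδ
  have hder : ∀ ζ ∈ closedBall a r,
      HasDerivWithinAt (fun ζ => f t ζ - f t₀ ζ - (t - t₀) * Q ζ)
        (φ ζ t - φ ζ t₀ - (t - t₀) * φ' ζ t₀) (closedBall a r) ζ := fun ζ hζ =>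
    (((h1 t htδ ζ hζ).fun_sub (h1 t₀ (mem_closedBall_self hδ.le) ζ hζ)).fun_sub
      ((hQ ζ hζ).const_mul _)).hasDerivWithinAt
  have key := (convex_closedBall a r).norm_image_sub_le_of_norm_hasDerivWithin_le hder ht hw hz
  rw [Real.norm_eq_abs]
  calc _ = ‖f t z - f t₀ z - (t - t₀) * Q z - (f t w - f t₀ w - (t - t₀) * Q w)‖ := by
        rw [Complex.real_smul]; push_cast; congr 1; ring
    _ ≤ _ := key
    _ ≤ ε * |t - t₀| := by
        rw [mul_right_comm]
        refine mul_le_mul_of_nonneg_right ?_ (abs_nonneg _)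
        rw [div_mul_eq_mul_div, div_le_iff₀ (by positivity)]
        nlinarith [norm_nonneg (z - w)]

/-- Differentiability in the parameter of a primitive propagates along a connected open set. -/
theorem hasDerivAt_parameter_deriv {W : Set ℂ} (hW : IsPreconnected W)
    (h1 : ∀ a ∈ W, ∀ᶠ q : ℂ × ℝ in 𝓝 (a, t₀), HasDerivAt (f q.2) (φ q.1 q.2) q.1 ∧
      HasDerivAt (φ q.1) (φ' q.1 q.2) q.2 ∧ ContinuousAt (fun q : ℂ × ℝ => φ' q.1 q.2) q)
    (h2 : ∀ a ∈ W, ∀ᶠ z in 𝓝 a, DifferentiableAt ℂ (fun z => φ' z t₀) z) {o : ℂ} (ho : o ∈ W)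
    (hfo : DifferentiableAt ℝ (fun t => f t o) t₀) {z : ℂ} (hz : z ∈ W) :
    DifferentiableAt ℝ (fun t => f t z) t₀ ∧
      HasDerivAt (fun z => deriv (fun t => f t z) t₀) (φ' z t₀) z := by
  have hloc : ∀ a ∈ W, ∃ r > 0, ∃ Q : ℂ → ℂ, (∀ z ∈ closedBall a r, HasDerivAt Q (φ' z t₀) z) ∧
      ∀ z ∈ closedBall a r, ∀ w ∈ closedBall a r,
        HasDerivAt (fun t => f t z - f t w) (Q z - Q w) t₀ := by
    intro a ha
    obtain ⟨ρ, hρ, hρ'⟩ := Metric.eventually_nhds_iff_ball.1 (h1 a ha)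
    obtain ⟨ρ₂, hρ₂, hρ₂'⟩ := Metric.eventually_nhds_iff_ball.1 (h2 a ha)
    obtain ⟨Q, hQ⟩ := (show DifferentiableOn ℂ (fun z => φ' z t₀) (ball a ρ₂) from
      fun z hz => (hρ₂' z hz).differentiableWithinAt).isExactOn_ball
    set r := min ρ ρ₂ / 2 with hr
    have hr0 : 0 < r := by have := lt_min hρ hρ₂; positivity
    have hrρ : r < ρ := by have := min_le_left ρ ρ₂; have := lt_min hρ hρ₂; linarith
    have hrρ₂ : r < ρ₂ := by have := min_le_right ρ ρ₂; have := lt_min hρ hρ₂; linarith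
    have hmem : ∀ z ∈ closedBall a r, ∀ t ∈ closedBall t₀ r, (z, t) ∈ ball (a, t₀) ρ := by
      intro z hz t ht
      rw [← ball_prod_same]
      exact ⟨closedBall_subset_ball hrρ hz, closedBall_subset_ball hrρ ht⟩
    have hQ' : ∀ z ∈ closedBall a r, HasDerivAt Q (φ' z t₀) z := fun z hz =>
      hQ z (closedBall_subset_ball hrρ₂ hz)
    refine ⟨r, hr0, Q, hQ', fun z hz w hw => ?_⟩
    exact hasDerivAt_parameter_sub hr0
      (fun t ht z hz => (hρ' _ (hmem z hz t ht)).1)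
      (fun z hz t ht => (hρ' _ (hmem z hz t ht)).2.1)
      (fun q hq => (hρ' _ (hmem q.1 hq.1 q.2 hq.2)).2.2.continuousWithinAt) hQ' hz hw
  have hdiff : ∀ z ∈ W, DifferentiableAt ℝ (fun t => f t z) t₀ := by
    intro z hz
    -- Being differentiable at `x` exactly when differentiable at `y` is an equivalence relation
    -- with open classes, so a connected set lies in one class.
    refine (hW.induction₂ (fun x y => DifferentiableAt ℝ (fun t => f t x) t₀ ↔
      DifferentiableAt ℝ (fun t => f t y) t₀) ?_ (fun _ _ _ _ _ _ h h' => h.trans h')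
      (fun _ _ _ _ h => h.symm) ho hz).1 hfo
    intro a ha
    obtain ⟨r, hr, Q, -, hQ⟩ := hloc a ha
    filter_upwards [mem_nhdsWithin_of_mem_nhds (closedBall_mem_nhds a hr)] with y hy
    have ha' : a ∈ closedBall a r := mem_closedBall_self hr.le
    constructor
    · intro h
      simpa using (hQ y hy a ha').differentiableAt.fun_add h
    · intro h
      simpa using (hQ a ha' y hy).differentiableAt.fun_add h
  refine ⟨hdiff z hz, ?_⟩
  obtain ⟨r, hr, Q, hQ', hQ⟩ := hloc z hz
  have hz' : z ∈ closedBall z r := mem_closedBall_self hr.le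
  have : (fun y => deriv (fun t => f t y) t₀) =ᶠ[𝓝 z]
      fun y => Q y - Q z + deriv (fun t => f t z) t₀ := by
    filter_upwards [closedBall_mem_nhds z hr] with y hy
    have := (hQ y hy z hz').fun_add (hdiff z hz).hasDerivAt
    simp only [sub_add_cancel] at this
    exact this.deriv
  refine HasDerivAt.congr_of_eventuallyEq ?_ this
  exact ((hQ' z hz').sub_const _).add_const _

/-- A chain rule that avoids joint differentiability of `f`: a jointly continuous `z`-derivative and
the time derivative at the frozen point `w t₀` suffice. -/
theorem hasDerivAt_parameter_comp {w : ℝ → ℂ} {w' ψ : ℂ} (hw : HasDerivAt w w' t₀)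
    (h1 : ∀ᶠ q : ℂ × ℝ in 𝓝 (w t₀, t₀), HasDerivAt (f q.2) (φ q.1 q.2) q.1)
    (h2 : ContinuousAt (fun q : ℂ × ℝ => φ q.1 q.2) (w t₀, t₀))
    (h3 : HasDerivAt (fun t => f t (w t₀)) ψ t₀) :
    HasDerivAt (fun t => f t (w t)) (φ (w t₀) t₀ * w' + ψ) t₀ := by
  have key : (fun t => f t (w t) - f t (w t₀) - φ (w t₀) t₀ * (w t - w t₀)) =o[𝓝 t₀]
      fun t => w t - w t₀ := by
    rw [Asymptotics.isLittleO_iff]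
    intro ε hε
    have h4 := h1.and (Metric.continuousAt_iff'.1 h2 ε hε)
    obtain ⟨ρ, hρ, hρ'⟩ := Metric.eventually_nhds_iff_ball.1 h4
    filter_upwards [ball_mem_nhds t₀ hρ, hw.continuousAt (ball_mem_nhds _ hρ)] with t ht hwt
    have hmem : ∀ z ∈ ball (w t₀) ρ, (z, t) ∈ ball (w t₀, t₀) ρ := by
      intro z hz
      rw [← ball_prod_same]
      exact ⟨hz, ht⟩
    have hder : ∀ z ∈ ball (w t₀) ρ, HasDerivWithinAt (fun z => f t z - φ (w t₀) t₀ * z)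
        (φ z t - φ (w t₀) t₀) (ball (w t₀) ρ) z := fun z hz =>
      (((hρ' _ (hmem z hz)).1.fun_sub ((hasDerivAt_id z).const_mul _)).congr_deriv
        (by ring)).hasDerivWithinAt
    have := (convex_ball (w t₀) ρ).norm_image_sub_le_of_norm_hasDerivWithin_le hder
      (C := ε) (fun z hz => ?_) (mem_ball_self hρ) hwt
    · refine le_trans (le_of_eq ?_) this
      congr 1; ring
    · have := (hρ' _ (hmem z hz)).2
      rw [dist_eq_norm] at this
      exact this.le
  have hsum : HasDerivAt (fun t => f t (w t) - f t (w t₀) - φ (w t₀) t₀ * (w t - w t₀)) 0 t₀ := by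
    rw [hasDerivAt_iff_isLittleO]
    have hO : (fun t => w t - w t₀) =O[𝓝 t₀] fun t => t - t₀ := hw.differentiableAt.isBigO_sub
    simpa using key.trans_isBigO hO
  have := (hsum.fun_add ((hw.sub_const (w t₀)).const_mul (φ (w t₀) t₀))).fun_add h3
  simp only [sub_add_cancel, zero_add] at this
  exact this

end Parameter

/-! ### Reflections -/

/-- Subtracting the two fixed-point equations determines `M` from the direction of the line, and
either equation then gives `N`. So an antilinear affine map fixing two points of a line is the
reflection in it. -/
theorem reflection_of_fixed_points {M N w₁ w₂ p : ℂ} {r₁ r₂ α : ℝ}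
    (h1 : w₁ = M * conj w₁ + N) (h2 : w₂ = M * conj w₂ + N) (hne : w₁ ≠ w₂)
    (e1 : w₁ = p + r₁ * Complex.exp (α * Complex.I))
    (e2 : w₂ = p + r₂ * Complex.exp (α * Complex.I)) :
    M = Complex.exp (2 * α * Complex.I) ∧ N = p - Complex.exp (2 * α * Complex.I) * conj p := by
  set E := Complex.exp (α * Complex.I) with hE
  have hE0 : E ≠ 0 := Complex.exp_ne_zero _
  have hEc : conj E = E⁻¹ := by
    rw [hE, ← Complex.exp_conj, ← Complex.exp_neg]; simp
  have hE2 : Complex.exp (2 * α * Complex.I) = E ^ 2 := by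
    rw [hE, ← Complex.exp_nat_mul]; congr 1; push_cast; ring
  have c1 : conj w₁ = conj p + r₁ * E⁻¹ := by rw [e1, map_add, map_mul, Complex.conj_ofReal, hEc]
  have c2 : conj w₂ = conj p + r₂ * E⁻¹ := by rw [e2, map_add, map_mul, Complex.conj_ofReal, hEc]
  have hr : (r₁ : ℂ) - r₂ ≠ 0 := by
    intro h
    apply hne
    rw [e1, e2, sub_eq_zero.1 h]
  rw [c1, e1] at h1
  rw [c2, e2] at h2
  have hM : M = E ^ 2 := by
    have h3 : ((r₁ : ℂ) - r₂) * (E - M * E⁻¹) = 0 := by linear_combination h1 - h2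
    have h4 := (mul_eq_zero.1 h3).resolve_left hr
    field_simp at h4
    linear_combination -h4
  refine ⟨by rw [hE2, hM], ?_⟩
  rw [hE2]
  rw [hM] at h1
  have : E ^ 2 * E⁻¹ = E := by field_simp
  linear_combination -h1 - (r₁ : ℂ) * this

/-- The relation `g' = M conj g'` keeps `g'` on one real line through `0`. Rotated to the real axis,
`g` is accessible to Rolle's theorem for real functions. -/
theorem ne_of_reflected_deriv {g g' : ℝ → ℂ} {M : ℂ} {a b : ℝ} (hab : a < b)
    (hg : ∀ x ∈ Icc a b, HasDerivAt g (g' x) x) (hM : ∀ x ∈ Ioo a b, g' x = M * conj (g' x))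
    (h0 : ∀ x ∈ Ioo a b, g' x ≠ 0) : g a ≠ g b := by
  intro hgab
  obtain ⟨y, hy⟩ := nonempty_Ioo.2 hab
  set ν := conj (g' y) with hν
  have hν0 : ν ≠ 0 := by rw [hν]; exact (map_ne_zero _).2 (h0 y hy)
  have hder : ∀ x ∈ Icc a b, HasDerivAt (fun x => (ν * g x).re) ((ν * g' x).re) x := by
    intro x hx
    exact Complex.reCLM.hasFDerivAt.comp_hasDerivAt x ((hg x hx).const_mul ν)
  obtain ⟨c, hc, hc0⟩ := exists_hasDerivAt_eq_zero hab
    (fun x hx => (hder x hx).continuousAt.continuousWithinAt) (by simp only [hgab])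
    (fun x hx => hder x (Ioo_subset_Icc_self hx))
  have hreal : conj (ν * g' c) = ν * g' c := by
    have e1 := hM c hc
    have e2 := hM y hy
    rw [← hν] at e2
    have e3 : conj ν = g' y := by rw [hν, Complex.conj_conj]
    rw [map_mul, e3]
    calc g' y * conj (g' c) = M * ν * conj (g' c) := by rw [← e2]
      _ = ν * (M * conj (g' c)) := by ring
      _ = ν * g' c := by rw [← e1]
  have him : (ν * g' c).im = 0 := Complex.conj_eq_iff_im.1 hreal
  exact mul_ne_zero hν0 (h0 c hc) (Complex.ext hc0 him)

/-! ### The Weierstrass functions for the periods `1` and `τ` -/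

/-- Nonzero lattice indices. -/
abbrev Idx : Type := {p : ℤ × ℤ // p ≠ 0}

/-- The domain of the variables `(z, τ)`. -/
def wDomain : Set (ℂ × ℂ) := {q | 0 < q.2.im}

theorem isOpen_wDomain : IsOpen wDomain :=
  isOpen_lt continuous_const (Complex.continuous_im.comp continuous_snd)

/-- The factors of the product for `σ`. -/
def sigmaFactor (p : Idx) (q : ℂ × ℂ) : ℂ :=
  (1 - q.1 / latticePoint 1 q.2 p) *
    Complex.exp (q.1 / latticePoint 1 q.2 p + q.1 ^ 2 / (2 * latticePoint 1 q.2 p ^ 2))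

/-- The function `σ(z) / z` of `z` and of the second period. -/
def sigmaReg (τ z : ℂ) : ℂ := ∏' p : Idx, sigmaFactor p (z, τ)

/-- The function `ζ(z) - 1 / z`. -/
def zetaReg (τ z : ℂ) : ℂ := ∑' p : Idx,
    (1 / (z - latticePoint 1 τ p) + 1 / latticePoint 1 τ p + z / latticePoint 1 τ p ^ 2)

theorem sigma_eq (τ z : ℂ) : sigma 1 τ z = z * sigmaReg τ z := rfl

theorem zeta_eq (τ z : ℂ) : zeta 1 τ z = 1 / z + zetaReg τ z := rfl

theorem zetaReg_zero (τ : ℂ) : zetaReg τ 0 = 0 := by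
  simp [zetaReg]

theorem latticePoint_im (τ : ℂ) (p : ℤ × ℤ) : (latticePoint 1 τ p).im = p.2 * τ.im := by
  simp [latticePoint]

theorem latticePoint_add (τ : ℂ) (p q : ℤ × ℤ) :
    latticePoint 1 τ (p + q) = latticePoint 1 τ p + latticePoint 1 τ q := by
  simp [latticePoint]; ring

theorem latticePoint_neg (τ : ℂ) (p : ℤ × ℤ) :
    latticePoint 1 τ (-p) = -latticePoint 1 τ p := by
  simp [latticePoint]; ring

theorem latticePoint_ne_zero {τ : ℂ} (hτ : 0 < τ.im) {p : ℤ × ℤ} (hp : p ≠ 0) :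
    latticePoint 1 τ p ≠ 0 := by
  intro h
  have h2 : p.2 = 0 := by
    have := latticePoint_im τ p
    rw [h] at this
    simpa [hτ.ne'] using this.symm
  have h1 : p.1 = 0 := by
    simpa [latticePoint, h2] using h
  exact hp (Prod.ext h1 h2)

/-- The imaginary part controls `p.2`, and then the triangle inequality controls `p.1`. The constant
depends on `τ` only through `B` and `R`, as uniformity in the period requires. -/
theorem norm_le_mul_norm_latticePoint {τ : ℂ} {R B : ℝ} (hB : 0 < B) (hτB : B ≤ τ.im)
    (hR : ‖τ‖ ≤ R) (p : ℤ × ℤ) : ‖p‖ ≤ (1 + (R + 1) / B) * ‖latticePoint 1 τ p‖ := by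
  have hR0 : 0 ≤ R := (norm_nonneg τ).trans hR
  set w := latticePoint 1 τ p with hw
  have h2 : |(p.2 : ℝ)| ≤ ‖w‖ / B := by
    rw [le_div_iff₀ hB]
    have := Complex.abs_im_le_norm w
    rw [hw, latticePoint_im, abs_mul, abs_of_pos (hB.trans_le hτB), ← hw] at this
    exact (mul_le_mul_of_nonneg_left hτB (abs_nonneg _)).trans this
  have h1 : |(p.1 : ℝ)| ≤ ‖w‖ + ‖w‖ / B * R := by
    have e : (p.1 : ℂ) = w - p.2 * τ := by rw [hw]; simp [latticePoint]
    have : ‖(p.1 : ℂ)‖ ≤ ‖w‖ + ‖(p.2 : ℂ) * τ‖ := by rw [e]; exact norm_sub_le _ _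
    rw [norm_mul, Complex.norm_intCast, Complex.norm_intCast] at this
    exact this.trans (add_le_add le_rfl (mul_le_mul h2 hR (norm_nonneg _) (by positivity)))
  have e : (1 + (R + 1) / B) * ‖w‖ = ‖w‖ + ‖w‖ / B * R + ‖w‖ / B := by ring
  rw [e, Prod.norm_def, Int.norm_eq_abs, Int.norm_eq_abs]
  have h3 : 0 ≤ ‖w‖ / B := by positivity
  refine max_le (h1.trans (by linarith)) (h2.trans ?_)
  have : 0 ≤ ‖w‖ / B * R := by positivity
  linarith [norm_nonneg w]

theorem summable_norm_idx : Summable fun p : Idx => (‖(p : ℤ × ℤ)‖ ^ 3)⁻¹ := by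
  have h := EisensteinSeries.summable_one_div_norm_rpow (k := 3) (by norm_num)
  have h2 := ((finTwoArrowEquiv ℤ).symm.summable_iff.2 h).subtype {p : ℤ × ℤ | p ≠ 0}
  refine h2.congr fun p => ?_
  simp only [Function.comp_apply, EisensteinSeries.norm_eq_max_natAbs,
    finTwoArrowEquiv_symm_apply, Matrix.cons_val_zero, Matrix.cons_val_one]
  rw [Real.rpow_neg (by positivity), Prod.norm_def, Int.norm_eq_abs, Int.norm_eq_abs]
  norm_cast
  simp

theorem eventually_le_norm_idx (T : ℝ) : ∀ᶠ p : Idx in cofinite, T ≤ ‖(p : ℤ × ℤ)‖ := by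
  have h : Tendsto (fun p : ℤ × ℤ => ‖p‖) cofinite atTop := by
    rw [← cocompact_eq_cofinite]; exact tendsto_norm_cocompact_atTop
  exact (h.comp Subtype.val_injective.tendsto_cofinite).eventually_ge_atTop T

/-- The exponential factor cancels the logarithm of `1 - s` through second order. The Taylor
remainder is at most `‖s‖³`, and `‖exp w - 1‖ ≤ 2 ‖w‖` for `‖w‖ ≤ 1`. -/
theorem norm_primary_factor_sub_one_le {s : ℂ} (hs : ‖s‖ ≤ 1 / 2) :
    ‖(1 - s) * Complex.exp (s + s ^ 2 / 2) - 1‖ ≤ 2 * ‖s‖ ^ 3 := by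
  have hs1 : ‖-s‖ < 1 := by rw [norm_neg]; linarith
  have h1 := Complex.norm_log_sub_logTaylor_le 2 hs1
  have e1 : Complex.logTaylor (2 + 1) (-s) = -(s + s ^ 2 / 2) := by
    simp [Complex.logTaylor_succ, Complex.logTaylor_zero]; ring
  have hne : (1 - s) ≠ 0 := by
    intro h
    have : s = 1 := by linear_combination -h
    rw [this] at hs; norm_num at hs
  rw [e1, norm_neg, sub_neg_eq_add, ← sub_eq_add_neg] at h1
  have h2 : (1 - ‖s‖)⁻¹ ≤ 2 := by
    rw [inv_le_comm₀ (by linarith) (by norm_num)]; linarith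
  have h3 : ‖Complex.log (1 - s) + (s + s ^ 2 / 2)‖ ≤ ‖s‖ ^ 3 := by
    refine h1.trans ?_
    have : 0 ≤ ‖s‖ ^ 3 := by positivity
    norm_num
    nlinarith
  have h4 : ‖s‖ ^ 3 ≤ 1 := pow_le_one₀ (norm_nonneg _) (by linarith)
  have h5 := Complex.norm_exp_sub_one_le (h3.trans h4)
  rw [Complex.exp_add, Complex.exp_log hne] at h5
  linarith

/-- On a compact set of pairs `(z, τ)` all but finitely many nonzero lattice points `w` satisfy
`2 |z| ≤ |w|` and a uniform lower bound. -/
theorem eventually_latticePoint_bound {K : Set (ℂ × ℂ)} (hK : IsCompact K) (hKU : K ⊆ wDomain) :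
    ∃ R > 0, ∃ C > 0, (∀ q ∈ K, ‖q.1‖ ≤ R) ∧ ∀ᶠ p : Idx in cofinite, ∀ q ∈ K,
      0 < ‖(p : ℤ × ℤ)‖ ∧ ‖(p : ℤ × ℤ)‖ ≤ C * ‖latticePoint 1 q.2 p‖ ∧
      2 * ‖q.1‖ ≤ ‖latticePoint 1 q.2 p‖ := by
  rcases K.eq_empty_or_nonempty with rfl | hne
  · exact ⟨1, one_pos, 1, one_pos, by simp, by simp⟩
  obtain ⟨R, hR⟩ := hK.isBounded.exists_norm_le
  obtain ⟨q₀, hq₀, hmin⟩ := hK.exists_isMinOn hne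
    (f := fun q : ℂ × ℂ => q.2.im) (by fun_prop)
  set B := q₀.2.im with hB
  have hB0 : 0 < B := hKU hq₀
  have hR0 : 0 ≤ R := (norm_nonneg q₀).trans (hR q₀ hq₀)
  set C := 1 + (R + 1) / B with hC
  have hC0 : 0 < C := by positivity
  refine ⟨R + 1, by positivity, C, hC0, fun q hq => (norm_fst_le q).trans ((hR q hq).trans
    (by linarith)), ?_⟩
  -- The summand `C * (2 * R)` yields `2 |z| ≤ |w|`, and the `+ 1` makes the norm of the index
  -- positive.
  filter_upwards [eventually_le_norm_idx (C * (2 * R) + 1)] with p hp q hq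
  have h1 : ‖(p : ℤ × ℤ)‖ ≤ C * ‖latticePoint 1 q.2 p‖ :=
    norm_le_mul_norm_latticePoint hB0 (hmin hq) ((norm_snd_le q).trans (hR q hq)) p
  have h2 : ‖q.1‖ ≤ R := (norm_fst_le q).trans (hR q hq)
  have h4 : 0 ≤ C * (2 * R) := by positivity
  refine ⟨by linarith, h1, ?_⟩
  have h3 : C * (2 * R) ≤ C * ‖latticePoint 1 q.2 p‖ := by linarith
  linarith [le_of_mul_le_mul_left h3 hC0]

theorem inv_norm_latticePoint_pow_le {x C w : ℝ} (hx : 0 < x) (h : x ≤ C * w) (hC : 0 < C) :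
    (w ^ 3)⁻¹ ≤ C ^ 3 * (x ^ 3)⁻¹ := by
  have hw : 0 < w := by
    by_contra hw
    nlinarith [not_lt.1 hw]
  rw [← div_eq_mul_inv, le_div_iff₀ (by positivity), inv_mul_le_iff₀ (by positivity), ← mul_pow,
    mul_comm w C]
  exact pow_le_pow_left₀ hx.le h 3

theorem sigmaFactor_bound {K : Set (ℂ × ℂ)} (hK : IsCompact K) (hKU : K ⊆ wDomain) :
    ∃ u : Idx → ℝ, Summable u ∧ ∀ᶠ p : Idx in cofinite, ∀ q ∈ K, ‖sigmaFactor p q - 1‖ ≤ u p := by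
  obtain ⟨R, hR, C, hC, hKR, hev⟩ := eventually_latticePoint_bound hK hKU
  refine ⟨fun p => 2 * R ^ 3 * C ^ 3 * (‖(p : ℤ × ℤ)‖ ^ 3)⁻¹, summable_norm_idx.mul_left _, ?_⟩
  filter_upwards [hev] with p hp q hq
  obtain ⟨h0, h1, h2⟩ := hp q hq
  have hw : 0 < ‖latticePoint 1 q.2 p‖ := by
    by_contra hw
    nlinarith [not_lt.1 hw]
  have hs : ‖q.1 / latticePoint 1 q.2 p‖ ≤ 1 / 2 := by
    rw [norm_div, div_le_iff₀ hw]; linarith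
  have key := norm_primary_factor_sub_one_le hs
  have e : q.1 / latticePoint 1 q.2 p + (q.1 / latticePoint 1 q.2 p) ^ 2 / 2
      = q.1 / latticePoint 1 q.2 p + q.1 ^ 2 / (2 * latticePoint 1 q.2 p ^ 2) := by
    rw [div_pow, div_div, mul_comm (latticePoint 1 q.2 p ^ 2)]
  rw [e] at key
  refine key.trans ?_
  rw [norm_div, div_pow, div_eq_mul_inv]
  have h3 := inv_norm_latticePoint_pow_le h0 h1 hC
  have h4 : ‖q.1‖ ^ 3 ≤ R ^ 3 := pow_le_pow_left₀ (norm_nonneg _) (hKR q hq) 3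
  calc 2 * (‖q.1‖ ^ 3 * (‖latticePoint 1 q.2 p‖ ^ 3)⁻¹)
      ≤ 2 * (R ^ 3 * (C ^ 3 * (‖(p : ℤ × ℤ)‖ ^ 3)⁻¹)) := by gcongr
    _ = _ := by ring

theorem contDiffOn_sigmaFactor (p : Idx) : ContDiffOn ℂ ∞ (sigmaFactor p) wDomain := by
  have h1 : ContDiffOn ℂ ∞ (fun q : ℂ × ℂ => latticePoint 1 q.2 p) wDomain := by
    unfold latticePoint; fun_prop
  have h0 : ∀ q ∈ wDomain, latticePoint 1 q.2 p ≠ 0 := fun q hq => latticePoint_ne_zero hq p.2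
  have h2 : ContDiffOn ℂ ∞ (fun q : ℂ × ℂ => q.1 / latticePoint 1 q.2 p) wDomain :=
    contDiffOn_fst.div h1 h0
  have h3 : ContDiffOn ℂ ∞ (fun q : ℂ × ℂ => q.1 ^ 2 / (2 * latticePoint 1 q.2 p ^ 2)) wDomain :=
    (contDiffOn_fst.pow 2).div (contDiffOn_const.mul (h1.pow 2))
      fun q hq => mul_ne_zero two_ne_zero (pow_ne_zero 2 (h0 q hq))
  exact (contDiffOn_const.sub h2).mul (h2.add h3).cexp

theorem hasProdLocallyUniformlyOn_sigmaFactor :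
    HasProdLocallyUniformlyOn sigmaFactor (fun q => sigmaReg q.2 q.1) wDomain := by
  refine hasProdLocallyUniformlyOn_of_forall_compact isOpen_wDomain fun K hKU hK => ?_
  obtain ⟨u, hu, hev⟩ := sigmaFactor_bound hK hKU
  have := hu.hasProdUniformlyOn_one_add hK hev
    fun p => ((contDiffOn_sigmaFactor p).continuousOn.mono hKU).sub continuousOn_const
  simpa [sigmaReg] using this

/-- Smoothness is joint in the point and the period because the period moves with time; it is
inherited from the finite products by locally uniform convergence in both variables. -/
theorem contDiffOn_sigmaReg : ContDiffOn ℂ ∞ (fun q : ℂ × ℂ => sigmaReg q.2 q.1) wDomain := by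
  refine contDiffOn_of_tendstoLocallyUniformlyOn isOpen_wDomain (fun s => ?_)
    hasProdLocallyUniformlyOn_sigmaFactor
  exact contDiffOn_prod fun p _ => contDiffOn_sigmaFactor p

theorem contDiffAt_sigmaReg {τ : ℂ} (hτ : 0 < τ.im) (z : ℂ) :
    ContDiffAt ℂ ∞ (fun q : ℂ × ℂ => sigmaReg q.2 q.1) (z, τ) :=
  contDiffOn_sigmaReg.contDiffAt (isOpen_wDomain.mem_nhds hτ)

theorem sigmaReg_zero (τ : ℂ) : sigmaReg τ 0 = 1 := by
  simp [sigmaReg, sigmaFactor]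

theorem sigmaFactor_ne_zero_iff {τ : ℂ} (hτ : 0 < τ.im) {z : ℂ} {p : Idx} :
    sigmaFactor p (z, τ) ≠ 0 ↔ z ≠ latticePoint 1 τ p := by
  have h := latticePoint_ne_zero hτ p.2
  simp only [sigmaFactor, ne_eq, mul_eq_zero, Complex.exp_ne_zero, or_false, sub_eq_zero,
    eq_comm (a := (1 : ℂ)), div_eq_one_iff_eq h]

theorem summable_sigmaFactor_sub_one {τ : ℂ} (hτ : 0 < τ.im) (z : ℂ) :
    Summable fun p : Idx => sigmaFactor p (z, τ) - 1 := by
  obtain ⟨u, hu, hev⟩ := sigmaFactor_bound (isCompact_singleton (x := (z, τ)))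
    (singleton_subset_iff.2 hτ)
  exact hu.of_norm_bounded_eventually (hev.mono fun p hp => hp _ rfl)

/-- A product of nonzero factors with summable logarithms is the exponential of their sum. -/
theorem sigmaReg_ne_zero {τ : ℂ} (hτ : 0 < τ.im) {z : ℂ}
    (hz : ∀ p : Idx, z ≠ latticePoint 1 τ p) : sigmaReg τ z ≠ 0 := by
  have h := Complex.summable_log_one_add_of_summable (summable_sigmaFactor_sub_one hτ z)
  simp only [add_sub_cancel] at h
  rw [sigmaReg, ← Complex.cexp_tsum_eq_tprod (fun p => (sigmaFactor_ne_zero_iff hτ).2 (hz p)) h]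
  exact Complex.exp_ne_zero _

theorem sigmaReg_eq_zero {τ : ℂ} (hτ : 0 < τ.im) (p : Idx) :
    sigmaReg τ (latticePoint 1 τ p) = 0 := by
  refine tprod_of_exists_eq_zero ⟨p, ?_⟩
  by_contra h
  exact (sigmaFactor_ne_zero_iff hτ).1 h rfl

/-- The lattice generated by `1` and `τ`. -/
def Lat (τ : ℂ) : Set ℂ := range (latticePoint 1 τ)

theorem sigma_eq_zero_iff {τ : ℂ} (hτ : 0 < τ.im) {z : ℂ} : sigma 1 τ z = 0 ↔ z ∈ Lat τ := by
  rw [sigma_eq, mul_eq_zero]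
  constructor
  · rintro (rfl | h)
    · exact ⟨0, by simp [latticePoint]⟩
    · by_contra hz
      exact sigmaReg_ne_zero hτ (fun p hp => hz ⟨p, hp.symm⟩) h
  · rintro ⟨p, rfl⟩
    by_cases hp : p = 0
    · left; simp [hp, latticePoint]
    · right; exact sigmaReg_eq_zero hτ ⟨p, hp⟩

theorem contDiffAt_sigma {τ : ℂ} (hτ : 0 < τ.im) (z : ℂ) :
    ContDiffAt ℂ ∞ (fun q : ℂ × ℂ => sigma 1 q.2 q.1) (z, τ) := by
  simp only [sigma_eq]
  exact contDiffAt_fst.mul (contDiffAt_sigmaReg hτ z)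

theorem differentiable_sigmaReg {τ : ℂ} (hτ : 0 < τ.im) : Differentiable ℂ (sigmaReg τ) :=
  fun z => DifferentiableAt.comp (g := fun q : ℂ × ℂ => sigmaReg q.2 q.1) (f := fun z => (z, τ)) z
    ((contDiffAt_sigmaReg hτ z).differentiableAt (by simp))
    (differentiableAt_id.prodMk (differentiableAt_const τ))

theorem differentiable_sigma {τ : ℂ} (hτ : 0 < τ.im) : Differentiable ℂ (sigma 1 τ) :=
  differentiable_id.mul (differentiable_sigmaReg hτ)

/-! ### The series for `ζ` and the relations between `σ`, `ζ` and `𝔓` -/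

/-- The terms of the series for `ζ(z) - 1 / z`. -/
def zetaTerm (p : Idx) (q : ℂ × ℂ) : ℂ :=
  1 / (q.1 - latticePoint 1 q.2 p) + 1 / latticePoint 1 q.2 p + q.1 / latticePoint 1 q.2 p ^ 2

theorem zetaTerm_bound {K : Set (ℂ × ℂ)} (hK : IsCompact K) (hKU : K ⊆ wDomain) :
    ∃ u : Idx → ℝ, Summable u ∧ ∀ᶠ p : Idx in cofinite, ∀ q ∈ K, ‖zetaTerm p q‖ ≤ u p := by
  obtain ⟨R, hR, C, hC, hKR, hev⟩ := eventually_latticePoint_bound hK hKU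
  refine ⟨fun p => 2 * R ^ 2 * C ^ 3 * (‖(p : ℤ × ℤ)‖ ^ 3)⁻¹, summable_norm_idx.mul_left _, ?_⟩
  filter_upwards [hev] with p hp q hq
  obtain ⟨h0, h1, h2⟩ := hp q hq
  unfold zetaTerm
  set w := latticePoint 1 q.2 p with hw'
  have hw : 0 < ‖w‖ := by
    by_contra hw
    nlinarith [not_lt.1 hw]
  have hw0 : w ≠ 0 := norm_pos_iff.1 hw
  have h5 : ‖w‖ / 2 ≤ ‖q.1 - w‖ := by
    have := norm_sub_norm_le w q.1
    rw [norm_sub_rev] at this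
    linarith
  have hqw : q.1 - w ≠ 0 := norm_pos_iff.1 (by linarith)
  have e : 1 / (q.1 - w) + 1 / w + q.1 / w ^ 2 = q.1 ^ 2 * ((w ^ 2)⁻¹ * (q.1 - w)⁻¹) := by
    field_simp; ring
  rw [e, norm_mul, norm_mul, norm_inv, norm_inv, norm_pow, norm_pow]
  have h3 := inv_norm_latticePoint_pow_le h0 h1 hC
  have h4 : ‖q.1‖ ^ 2 ≤ R ^ 2 := pow_le_pow_left₀ (norm_nonneg _) (hKR q hq) 2
  have h6 : (‖q.1 - w‖)⁻¹ ≤ 2 * ‖w‖⁻¹ := by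
    rw [show 2 * ‖w‖⁻¹ = (‖w‖ / 2)⁻¹ by rw [inv_div]; rfl]
    exact inv_anti₀ (by positivity) h5
  calc ‖q.1‖ ^ 2 * ((‖w‖ ^ 2)⁻¹ * ‖q.1 - w‖⁻¹)
      ≤ R ^ 2 * ((‖w‖ ^ 2)⁻¹ * (2 * ‖w‖⁻¹)) := by gcongr
    _ = 2 * R ^ 2 * (‖w‖ ^ 3)⁻¹ := by rw [pow_succ ‖w‖ 2, mul_inv]; ring
    _ ≤ 2 * R ^ 2 * (C ^ 3 * (‖(p : ℤ × ℤ)‖ ^ 3)⁻¹) := by gcongr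
    _ = _ := by ring

theorem summable_zetaTerm {τ : ℂ} (hτ : 0 < τ.im) (z : ℂ) :
    Summable fun p : Idx => zetaTerm p (z, τ) := by
  obtain ⟨u, hu, hev⟩ := zetaTerm_bound (isCompact_singleton (x := (z, τ)))
    (singleton_subset_iff.2 hτ)
  exact hu.of_norm_bounded_eventually (hev.mono fun p hp => hp _ rfl)

theorem ne_latticePoint_of_sigmaReg_ne_zero {τ : ℂ} (hτ : 0 < τ.im) {z : ℂ}
    (hz : sigmaReg τ z ≠ 0) (p : Idx) : z ≠ latticePoint 1 τ p :=
  fun h => hz (h ▸ sigmaReg_eq_zero hτ p)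

theorem isOpen_sigmaReg_ne_zero {τ : ℂ} (hτ : 0 < τ.im) : IsOpen {z | sigmaReg τ z ≠ 0} :=
  isOpen_ne_fun (differentiable_sigmaReg hτ).continuous continuous_const

theorem logDeriv_sigmaFactor {τ z : ℂ} (p : Idx) (hp : latticePoint 1 τ p ≠ 0)
    (hz : z ≠ latticePoint 1 τ p) :
    logDeriv (fun z => sigmaFactor p (z, τ)) z = zetaTerm p (z, τ) := by
  unfold sigmaFactor zetaTerm
  simp only
  set w := latticePoint 1 τ p
  have h1 : HasDerivAt (fun z => 1 - z / w) (-(1 / w)) z :=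
    (((hasDerivAt_id z).div_const w).const_sub 1)
  have h2 : HasDerivAt (fun z => z / w + z ^ 2 / (2 * w ^ 2)) (1 / w + 2 * z / (2 * w ^ 2)) z := by
    simpa using ((hasDerivAt_id z).div_const w).fun_add (((hasDerivAt_id z).fun_pow 2).div_const
      (2 * w ^ 2))
  have h3 := h1.fun_mul h2.cexp
  rw [logDeriv_apply, h3.deriv]
  have hzw : z - w ≠ 0 := sub_ne_zero.2 hz
  have hE := Complex.exp_ne_zero (z / w + z ^ 2 / (2 * w ^ 2))
  have h4 : 1 - z / w ≠ 0 := by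
    rw [sub_ne_zero, ne_comm, ne_eq, div_eq_one_iff_eq hp]; exact hz
  set X := Complex.exp (z / w + z ^ 2 / (2 * w ^ 2))
  have hwz : w - z ≠ 0 := sub_ne_zero.2 hz.symm
  have e : (-(1 / w) * X + (1 - z / w) * (X * (1 / w + 2 * z / (2 * w ^ 2)))) / ((1 - z / w) * X)
      = -(1 / w) / (1 - z / w) + (1 / w + 2 * z / (2 * w ^ 2)) := by
    field_simp
  have e2 : 1 - z / w = (w - z) / w := by field_simp
  rw [e, e2, ← neg_sub w z]
  field_simp
  ring

theorem multipliableLocallyUniformlyOn_sigmaFactor {τ : ℂ} (hτ : 0 < τ.im) (s : Set ℂ) :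
    MultipliableLocallyUniformlyOn (fun p z => sigmaFactor p (z, τ)) s :=
  (hasProdLocallyUniformlyOn_sigmaFactor.comp (fun z => (z, τ))
    (fun _ _ => hτ) (by fun_prop)).multipliableLocallyUniformlyOn

/-- Locally uniform convergence of the product permits termwise logarithmic differentiation, and the
factors contribute the terms of the `ζ` series. -/
theorem hasDerivAt_sigmaReg {τ : ℂ} (hτ : 0 < τ.im) {z : ℂ} (hz : sigmaReg τ z ≠ 0) :
    HasDerivAt (sigmaReg τ) (sigmaReg τ z * zetaReg τ z) z := by
  have hne := ne_latticePoint_of_sigmaReg_ne_zero hτ hz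
  have hl : ∀ p : Idx, logDeriv (fun z => sigmaFactor p (z, τ)) z = zetaTerm p (z, τ) :=
    fun p => logDeriv_sigmaFactor p (latticePoint_ne_zero hτ p.2) (hne p)
  have key := logDeriv_tprod_eq_tsum (isOpen_univ (X := ℂ)) (mem_univ z)
    (f := fun p z => sigmaFactor p (z, τ)) (fun p => (sigmaFactor_ne_zero_iff hτ).2 (hne p))
    (fun p => fun w _ => (((contDiffOn_sigmaFactor p).contDiffAt
      (isOpen_wDomain.mem_nhds (show (w, τ) ∈ wDomain from hτ))).differentiableAt (by simp)
      |>.comp w (f := fun z => (z, τ))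
        (differentiableAt_id.prodMk (differentiableAt_const τ))).differentiableWithinAt)
    (by simpa only [hl] using summable_zetaTerm hτ z)
    (multipliableLocallyUniformlyOn_sigmaFactor hτ univ) hz
  simp only [hl] at key
  change logDeriv (sigmaReg τ) z = zetaReg τ z at key
  rw [logDeriv_apply, div_eq_iff hz] at key
  rw [mul_comm, ← key]
  exact (differentiable_sigmaReg hτ z).hasDerivAt

/-- Near the point, `zetaReg` is the `z`-derivative of `sigmaReg` divided by `sigmaReg`, so joint
smoothness passes over from the product. -/
theorem contDiffAt_zetaReg {τ : ℂ} (hτ : 0 < τ.im) {z : ℂ} (hz : sigmaReg τ z ≠ 0) :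
    ContDiffAt ℂ ∞ (fun q : ℂ × ℂ => zetaReg q.2 q.1) (z, τ) := by
  have h1 := contDiffAt_sigmaReg hτ z
  have h2 : ContDiffAt ℂ ∞ (fun q : ℂ × ℂ =>
      fderiv ℂ (fun q : ℂ × ℂ => sigmaReg q.2 q.1) q (1, 0) / sigmaReg q.2 q.1) (z, τ) :=
    (((h1.fderiv_right (m := ∞) (by simp)).clm_apply contDiffAt_const).div h1 hz)
  refine h2.congr_of_eventuallyEq ?_
  filter_upwards [h1.continuousAt.eventually_ne hz,
    isOpen_wDomain.mem_nhds (show (z, τ) ∈ wDomain from hτ)] with q hq hqτ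
  have h3 := ((contDiffAt_sigmaReg hqτ q.1).differentiableAt (by simp)).hasFDerivAt
  have h4 : HasDerivAt (fun z => (z, q.2)) ((1 : ℂ), (0 : ℂ)) q.1 :=
    (hasDerivAt_id q.1).prodMk (hasDerivAt_const q.1 q.2)
  have h5 : HasDerivAt (sigmaReg q.2) _ q.1 :=
    HasFDerivAt.comp_hasDerivAt (f := fun z => (z, q.2)) q.1 h3 h4
  rw [eq_div_iff hq, mul_comm]
  exact (hasDerivAt_sigmaReg hqτ hq).unique h5

theorem sigmaReg_ne_zero_of_sigma {τ z : ℂ} (h : sigma 1 τ z ≠ 0) : sigmaReg τ z ≠ 0 := by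
  rw [sigma_eq] at h
  exact right_ne_zero_of_mul h

theorem ne_zero_of_sigma_ne_zero {τ z : ℂ} (h : sigma 1 τ z ≠ 0) : z ≠ 0 := by
  rw [sigma_eq] at h
  exact left_ne_zero_of_mul h

theorem hasDerivAt_sigma {τ : ℂ} (hτ : 0 < τ.im) {z : ℂ} (hz : sigma 1 τ z ≠ 0) :
    HasDerivAt (sigma 1 τ) (sigma 1 τ z * zeta 1 τ z) z := by
  have h0 := ne_zero_of_sigma_ne_zero hz
  have := (hasDerivAt_id z).fun_mul (hasDerivAt_sigmaReg hτ (sigmaReg_ne_zero_of_sigma hz))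
  refine this.congr_deriv ?_
  rw [sigma_eq, zeta_eq]
  simp only [id]
  field_simp

theorem contDiffAt_zeta {τ : ℂ} (hτ : 0 < τ.im) {z : ℂ} (hz : sigma 1 τ z ≠ 0) :
    ContDiffAt ℂ ∞ (fun q : ℂ × ℂ => zeta 1 q.2 q.1) (z, τ) := by
  simp only [zeta_eq]
  exact (contDiffAt_const.div contDiffAt_fst (ne_zero_of_sigma_ne_zero hz)).add
    (contDiffAt_zetaReg hτ (sigmaReg_ne_zero_of_sigma hz))

theorem hasDerivAt_zetaTerm {τ z : ℂ} (p : Idx) (hz : z ≠ latticePoint 1 τ p) :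
    HasDerivAt (fun z => zetaTerm p (z, τ))
      (-(1 / (z - latticePoint 1 τ p) ^ 2 - 1 / latticePoint 1 τ p ^ 2)) z := by
  have h0 : z - latticePoint 1 τ p ≠ 0 := sub_ne_zero.2 hz
  have h1 := (((hasDerivAt_id z).sub_const (latticePoint 1 τ p)).fun_inv h0)
  have h2 := (h1.add_const (1 / latticePoint 1 τ p)).fun_add
    ((hasDerivAt_id z).div_const (latticePoint 1 τ p ^ 2))
  simp only [zetaTerm, one_div]
  simp only [one_div, id] at h2
  refine h2.congr_deriv ?_
  simp only [div_eq_mul_inv]; ring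

theorem hasDerivAt_zetaReg {τ : ℂ} (hτ : 0 < τ.im) {z : ℂ} (hz : sigmaReg τ z ≠ 0) :
    HasDerivAt (zetaReg τ) (-∑' p : Idx,
      (1 / (z - latticePoint 1 τ p) ^ 2 - 1 / latticePoint 1 τ p ^ 2)) z := by
  set U := {z | sigmaReg τ z ≠ 0} with hU
  have hUo : IsOpen U := isOpen_sigmaReg_ne_zero hτ
  have ht : TendstoLocallyUniformlyOn (fun (s : Finset Idx) z => ∑ p ∈ s, zetaTerm p (z, τ))
      (zetaReg τ) atTop U := by
    rw [tendstoLocallyUniformlyOn_iff_forall_isCompact hUo]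
    intro K _ hK
    obtain ⟨u, hu, hev⟩ := zetaTerm_bound (hK.image (f := fun z => (z, τ)) (by fun_prop))
      (by rintro _ ⟨w, -, rfl⟩; exact hτ)
    refine tendstoUniformlyOn_tsum_of_cofinite_eventually hu ?_
    filter_upwards [hev] with p hp w hw using hp _ ⟨w, hw, rfl⟩
  have hd : ∀ s : Finset Idx, ∀ w ∈ U, HasDerivAt (fun z => ∑ p ∈ s, zetaTerm p (z, τ))
      (∑ p ∈ s, -(1 / (w - latticePoint 1 τ p) ^ 2 - 1 / latticePoint 1 τ p ^ 2)) w :=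
    fun s w hw => HasDerivAt.fun_sum fun p _ =>
      hasDerivAt_zetaTerm p (ne_latticePoint_of_sigmaReg_ne_zero hτ hw p)
  have hF : ∀ᶠ s : Finset Idx in atTop,
      DifferentiableOn ℂ (fun z => ∑ p ∈ s, zetaTerm p (z, τ)) U :=
    Eventually.of_forall fun s w hw => (hd s w hw).differentiableAt.differentiableWithinAt
  have h1 := (ht.deriv hF hUo).tendsto_at hz
  have h2 : HasSum (fun p : Idx => -(1 / (z - latticePoint 1 τ p) ^ 2 - 1 / latticePoint 1 τ p ^ 2))
      (deriv (zetaReg τ) z) := by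
    refine h1.congr fun s => ?_
    exact (hd s z hz).deriv
  rw [← tsum_neg, h2.tsum_eq]
  exact ((ht.differentiableOn hF hUo).differentiableAt (hUo.mem_nhds hz)).hasDerivAt

theorem hasDerivAt_zeta {τ : ℂ} (hτ : 0 < τ.im) {z : ℂ} (hz : sigma 1 τ z ≠ 0) :
    HasDerivAt (zeta 1 τ) (-wp 1 τ z) z := by
  have h := ((hasDerivAt_id z).fun_inv (ne_zero_of_sigma_ne_zero hz)).fun_add
    (hasDerivAt_zetaReg hτ (sigmaReg_ne_zero_of_sigma hz))
  have e : zeta 1 τ = fun z => (id z)⁻¹ + zetaReg τ z := by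
    funext w; rw [zeta_eq, one_div, id]
  rw [e]
  refine h.congr_deriv ?_
  simp [wp]; ring

/-- The chain rule for `ζ(z(t); 1, τ(t))`. -/
theorem hasDerivAt_zeta_comp {z τ : ℝ → ℂ} {z' τ' : ℂ} {t : ℝ} (hτ : 0 < (τ t).im)
    (hz : sigma 1 (τ t) (z t) ≠ 0) (hz' : HasDerivAt z z' t) (hτ' : HasDerivAt τ τ' t) :
    HasDerivAt (fun t => zeta 1 (τ t) (z t))
      (-wp 1 (τ t) (z t) * z' + zetaDerivPeriod 1 (τ t) (z t) * τ') t := by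
  have h := ((contDiffAt_zeta hτ hz).differentiableAt (by simp)).hasFDerivAt
  set L := fderiv ℂ (fun q : ℂ × ℂ => zeta 1 q.2 q.1) (z t, τ t)
  have h1 : L (1, 0) = -wp 1 (τ t) (z t) := by
    have h4 : HasDerivAt (fun w => (w, τ t)) ((1 : ℂ), (0 : ℂ)) (z t) :=
      (hasDerivAt_id (z t)).prodMk (hasDerivAt_const (z t) (τ t))
    have h5 : HasDerivAt (zeta 1 (τ t)) _ (z t) :=
      HasFDerivAt.comp_hasDerivAt (f := fun w => (w, τ t)) (z t) h h4
    exact h5.unique (hasDerivAt_zeta hτ hz)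
  have h2 : L (0, 1) = zetaDerivPeriod 1 (τ t) (z t) := by
    have h4 : HasDerivAt (fun w => (z t, w)) ((0 : ℂ), (1 : ℂ)) (τ t) :=
      (hasDerivAt_const (τ t) (z t)).prodMk (hasDerivAt_id (τ t))
    have h5 : HasDerivAt (fun w => zeta 1 w (z t)) _ (τ t) :=
      HasFDerivAt.comp_hasDerivAt (f := fun w => (z t, w)) (τ t) h h4
    exact h5.deriv.symm
  have h3 := HasFDerivAt.comp_hasDerivAt (f := fun t => (z t, τ t)) t
    (h.restrictScalars ℝ) (hz'.prodMk hτ')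
  refine h3.congr_deriv ?_
  have e : ((z', τ') : ℂ × ℂ) = z' • ((1 : ℂ), (0 : ℂ)) + τ' • ((0 : ℂ), (1 : ℂ)) := by simp
  change L (z', τ') = _
  rw [e, map_add, map_smul, map_smul, h1, h2, smul_eq_mul, smul_eq_mul]
  ring

/-! ### Quasi-periodicity -/

theorem countable_Lat (τ : ℂ) : (Lat τ).Countable := countable_range _

theorem isOpen_compl_Lat {τ : ℂ} (hτ : 0 < τ.im) : IsOpen (Lat τ)ᶜ := by
  have : (Lat τ)ᶜ = {z | sigma 1 τ z ≠ 0} := by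
    ext z; rw [mem_compl_iff, ← sigma_eq_zero_iff hτ]; rfl
  rw [this]
  exact isOpen_ne_fun (differentiable_sigma hτ).continuous continuous_const

theorem isConnected_compl_countable {s : Set ℂ} (hs : s.Countable) : IsConnected sᶜ :=
  hs.isConnected_compl_of_one_lt_rank (by rw [Complex.rank_real_complex]; norm_num)

theorem add_mem_Lat {τ z w : ℂ} (hz : z ∈ Lat τ) (hw : w ∈ Lat τ) : z + w ∈ Lat τ := by
  obtain ⟨p, rfl⟩ := hz
  obtain ⟨q, rfl⟩ := hw
  exact ⟨p + q, latticePoint_add τ p q⟩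

theorem neg_mem_Lat {τ z : ℂ} (hz : z ∈ Lat τ) : -z ∈ Lat τ := by
  obtain ⟨p, rfl⟩ := hz
  exact ⟨-p, latticePoint_neg τ p⟩

theorem one_mem_Lat (τ : ℂ) : 1 ∈ Lat τ := ⟨(1, 0), by simp [latticePoint]⟩

theorem tau_mem_Lat (τ : ℂ) : τ ∈ Lat τ := ⟨(0, 1), by simp [latticePoint]⟩

theorem add_mem_Lat_iff {τ z w : ℂ} (hw : w ∈ Lat τ) : z + w ∈ Lat τ ↔ z ∈ Lat τ :=
  ⟨fun h => by simpa using add_mem_Lat h (neg_mem_Lat hw), fun h => add_mem_Lat h hw⟩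

theorem wp_add {τ : ℂ} (hτ : 0 < τ.im) (z : ℂ) {w : ℂ} (hw : w ∈ Lat τ) :
    wp 1 τ (z + w) = wp 1 τ z := by
  have hind : LinearIndependent ℝ ![(1 : ℂ), τ] := by
    rw [LinearIndependent.pair_iff' one_ne_zero]
    intro a ha
    rw [← ha] at hτ
    simp at hτ
  set L : PeriodPair := ⟨1, τ, hind⟩ with hL
  obtain ⟨p, rfl⟩ := hw
  have h := L.weierstrassP_add_coe z (L.latticeEquivProd.symm p)
  rw [weierstrassP_eq_wp, weierstrassP_eq_wp, L.latticeEquiv_symm_apply p] at h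
  exact h

/-- The difference of `ζ` at `z + w` and at `z` has zero derivative because `𝔓` is periodic, and the
plane minus a countable set is connected. -/
theorem exists_zeta_add {τ : ℂ} (hτ : 0 < τ.im) {w : ℂ} (hw : w ∈ Lat τ) :
    ∃ η, ∀ z ∉ Lat τ, zeta 1 τ (z + w) = zeta 1 τ z + η := by
  have hd : ∀ z ∈ (Lat τ)ᶜ, HasDerivAt (fun z => zeta 1 τ (z + w) - zeta 1 τ z) 0 z := by
    intro z hz
    have h1 : sigma 1 τ z ≠ 0 := fun h => hz ((sigma_eq_zero_iff hτ).1 h)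
    have h2 : sigma 1 τ (z + w) ≠ 0 := fun h =>
      hz ((add_mem_Lat_iff hw).1 ((sigma_eq_zero_iff hτ).1 h))
    refine (((hasDerivAt_zeta hτ h2).comp_add_const z w).fun_sub
      (hasDerivAt_zeta hτ h1)).congr_deriv ?_
    rw [wp_add hτ z hw]; ring
  obtain ⟨η, hη⟩ := (isOpen_compl_Lat hτ).exists_is_const_of_deriv_eq_zero
    (isConnected_compl_countable (countable_Lat τ)).isPreconnected
    (fun z hz => (hd z hz).differentiableAt.differentiableWithinAt) (fun z hz => (hd z hz).deriv)
  exact ⟨η, fun z hz => by rw [← hη z hz]; ring⟩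

theorem zeta_neg (τ z : ℂ) : zeta 1 τ (-z) = -zeta 1 τ z := by
  unfold zeta
  rw [neg_add, ← tsum_neg, ← (Equiv.subtypeEquiv (Equiv.neg (ℤ × ℤ))
    (fun p => by simp) : Idx ≃ Idx).tsum_eq]
  congr 1
  · rw [div_neg]
  · refine tsum_congr fun p => ?_
    simp only [Equiv.subtypeEquiv_apply, Equiv.neg_apply, latticePoint_neg]
    rw [show -z - -latticePoint 1 τ p = -(z - latticePoint 1 τ p) by ring, neg_sq]
    simp only [div_neg, neg_div]
    ring

theorem half_notMem_Lat {τ : ℂ} (hτ : 0 < τ.im) : (1 / 2 : ℂ) ∉ Lat τ := by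
  rintro ⟨p, hp⟩
  have h2 : p.2 = 0 := by
    have := latticePoint_im τ p
    rw [hp] at this
    simpa [hτ.ne'] using this.symm
  have h1 : ((2 * p.1 : ℤ) : ℂ) = ((1 : ℤ) : ℂ) := by
    simp [latticePoint, h2] at hp
    push_cast
    rw [hp]; norm_num
  have := Int.cast_injective h1
  lia

theorem zeta_add_one {τ : ℂ} (hτ : 0 < τ.im) {z : ℂ} (hz : z ∉ Lat τ) :
    zeta 1 τ (z + 1) = zeta 1 τ z + 2 * zeta 1 τ (1 / 2) := by
  obtain ⟨η, hη⟩ := exists_zeta_add hτ (one_mem_Lat τ)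
  -- At `-1/2` the shift by `1` leads to `1/2`; oddness of `ζ` then evaluates the increment.
  have h := hη (-(1 / 2)) fun h => half_notMem_Lat hτ (by simpa using neg_mem_Lat h)
  rw [zeta_neg, show -(1 / 2) + 1 = (1 / 2 : ℂ) by norm_num] at h
  rw [hη z hz]
  linear_combination -h

/-- With `η` the increment of `ζ`, the quotient `σ(z + w) exp(-η z) / σ(z)` has logarithmic
derivative zero, so it is constant off the lattice. -/
theorem exists_sigma_add {τ : ℂ} (hτ : 0 < τ.im) {w : ℂ} (hw : w ∈ Lat τ) :
    ∃ C η, C ≠ 0 ∧ ∀ z, sigma 1 τ (z + w) = C * Complex.exp (η * z) * sigma 1 τ z := by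
  obtain ⟨η, hη⟩ := exists_zeta_add hτ hw
  have hd : ∀ z ∈ (Lat τ)ᶜ, HasDerivAt
      (fun z => sigma 1 τ (z + w) * Complex.exp (-(η * z)) / sigma 1 τ z) 0 z := by
    intro z hz
    have h1 : sigma 1 τ z ≠ 0 := fun h => hz ((sigma_eq_zero_iff hτ).1 h)
    have h2 : sigma 1 τ (z + w) ≠ 0 := fun h =>
      hz ((add_mem_Lat_iff hw).1 ((sigma_eq_zero_iff hτ).1 h))
    refine ((((hasDerivAt_sigma hτ h2).comp_add_const z w).fun_mul
      ((hasDerivAt_id z).const_mul η).fun_neg.cexp).fun_div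
      (hasDerivAt_sigma hτ h1) h1).congr_deriv ?_
    rw [hη z hz]
    simp only [id]
    field_simp
    ring
  obtain ⟨C, hC⟩ := (isOpen_compl_Lat hτ).exists_is_const_of_deriv_eq_zero
    (isConnected_compl_countable (countable_Lat τ)).isPreconnected
    (fun z hz => (hd z hz).differentiableAt.differentiableWithinAt) (fun z hz => (hd z hz).deriv)
  refine ⟨C, η, ?_, fun z => ?_⟩
  · have h0 := half_notMem_Lat hτ
    rw [← hC _ h0]
    refine div_ne_zero (mul_ne_zero (fun h => ?_) (Complex.exp_ne_zero _))
      fun h => h0 ((sigma_eq_zero_iff hτ).1 h)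
    exact h0 ((add_mem_Lat_iff hw).1 ((sigma_eq_zero_iff hτ).1 h))
  · by_cases hz : z ∈ Lat τ
    · rw [(sigma_eq_zero_iff hτ).2 hz, (sigma_eq_zero_iff hτ).2 (add_mem_Lat hz hw), mul_zero]
    · have h1 : sigma 1 τ z ≠ 0 := fun h => hz ((sigma_eq_zero_iff hτ).1 h)
      rw [← hC z hz, Complex.exp_neg]
      have := Complex.exp_ne_zero (η * z)
      field_simp

/-! ### Symmetry for rectangular lattices -/

/-- The reflection `(p₁, p₂) ↦ (p₁, -p₂)` of the nonzero lattice indices. -/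
def idxConj : Idx ≃ Idx :=
  Equiv.subtypeEquiv ((Equiv.refl ℤ).prodCongr (Equiv.neg ℤ))
    (fun p => by simp [Prod.ext_iff])

theorem latticePoint_idxConj {τ : ℂ} (hτ : conj τ = -τ) (p : Idx) :
    latticePoint 1 τ (idxConj p) = conj (latticePoint 1 τ p) := by
  simp [idxConj, latticePoint, hτ]

/-- A purely imaginary second period makes the lattice invariant under conjugation, which therefore
only permutes the terms. -/
theorem conj_zeta {τ : ℂ} (hτ : conj τ = -τ) (z : ℂ) :
    conj (zeta 1 τ z) = zeta 1 τ (conj z) := by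
  unfold zeta
  rw [map_add, Complex.conj_tsum, ← idxConj.tsum_eq]
  simp only [latticePoint_idxConj hτ, map_add, map_div₀, map_sub, map_one, map_pow,
    Complex.conj_conj]

theorem conj_sigma {τ : ℂ} (hτ' : 0 < τ.im) (hτ : conj τ = -τ) (z : ℂ) :
    conj (sigma 1 τ z) = sigma 1 τ (conj z) := by
  have hm : Multipliable fun p : Idx => sigmaFactor p (z, τ) := by
    simpa using multipliable_one_add_of_summable (summable_sigmaFactor_sub_one hτ' z).norm
  rw [sigma_eq, sigma_eq, map_mul, sigmaReg, hm.map_tprod (starRingEnd ℂ) Complex.continuous_conj,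
    sigmaReg]
  conv_rhs => rw [← idxConj.tprod_eq]
  congr 1
  refine tprod_congr fun p => ?_
  simp only [sigmaFactor, latticePoint_idxConj hτ, map_mul, map_sub, map_one, map_div₀,
    ← Complex.exp_conj, map_add, map_pow, Complex.conj_ofNat]

/-! ### Smooth functions of a point and of parameters that depend on time -/

section TimeDerivative

variable {V : Type*} [NormedAddCommGroup V] [NormedSpace ℂ V]

/-- The derivative of `t ↦ Ψ (z, π t)`. -/
def timeDeriv (Ψ : ℂ × V → ℂ) (π : ℝ → V) (z : ℂ) (t : ℝ) : ℂ :=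
  fderiv ℂ Ψ (z, π t) (0, deriv π t)

variable {Ψ : ℂ × V → ℂ} {π : ℝ → V} {z : ℂ} {t : ℝ}

/-- Splits the total derivative along a path into the motion of the point and the motion of the
parameters, using linearity of the Fréchet derivative. -/
theorem hasDerivAt_comp_path {w : ℝ → ℂ} {w' : ℂ} (h : ContDiffAt ℂ 2 Ψ (w t, π t))
    (hw : HasDerivAt w w' t) (hπ : DifferentiableAt ℝ π t) :
    HasDerivAt (fun s => Ψ (w s, π s))
      (deriv (fun z => Ψ (z, π t)) (w t) * w' + timeDeriv Ψ π (w t) t) t := by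
  have h1 := (h.differentiableAt (by simp)).hasFDerivAt
  set L := fderiv ℂ Ψ (w t, π t) with hL
  have h2 : L (1, 0) = deriv (fun z => Ψ (z, π t)) (w t) := by
    have h4 : HasDerivAt (fun z => (z, π t)) ((1 : ℂ), (0 : V)) (w t) :=
      (hasDerivAt_id (w t)).prodMk (hasDerivAt_const (w t) (π t))
    exact (HasFDerivAt.comp_hasDerivAt (f := fun z => (z, π t)) (w t) h1 h4).deriv.symm
  have h3 := HasFDerivAt.comp_hasDerivAt (f := fun s => (w s, π s)) t
    (h1.restrictScalars ℝ) (hw.prodMk hπ.hasDerivAt)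
  refine h3.congr_deriv ?_
  have e : ((w', deriv π t) : ℂ × V) = w' • ((1 : ℂ), (0 : V)) + (0, deriv π t) := by simp
  change L (w', deriv π t) = _
  rw [e, map_add, map_smul, h2, smul_eq_mul, mul_comm, timeDeriv, hL]

theorem hasDerivAt_timeDeriv (h : ContDiffAt ℂ 2 Ψ (z, π t)) (hπ : DifferentiableAt ℝ π t) :
    HasDerivAt (fun s => Ψ (z, π s)) (timeDeriv Ψ π z t) t := by
  simpa using hasDerivAt_comp_path h (hasDerivAt_const t z) hπ

theorem differentiableAt_left (h : ContDiffAt ℂ 2 Ψ (z, π t)) :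
    DifferentiableAt ℂ (fun z => Ψ (z, π t)) z :=
  (h.differentiableAt (by simp)).comp z (f := fun z => (z, π t))
    (differentiableAt_id.prodMk (differentiableAt_const (π t)))

theorem differentiableAt_timeDeriv (h : ContDiffAt ℂ 2 Ψ (z, π t)) :
    DifferentiableAt ℂ (fun z => timeDeriv Ψ π z t) z := by
  have h1 : DifferentiableAt ℂ (fun z => fderiv ℂ Ψ (z, π t)) z :=
    ((h.fderiv_right (m := 1) (by norm_num)).differentiableAt (by simp)).comp z
      (f := fun z => (z, π t)) (differentiableAt_id.prodMk (differentiableAt_const (π t)))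
  exact h1.clm_apply (differentiableAt_const _)

theorem continuousAt_comp_time (h : ContDiffAt ℂ 2 Ψ (z, π t)) (hπ : ContinuousAt π t) :
    ContinuousAt (fun q : ℂ × ℝ => Ψ (q.1, π q.2)) (z, t) := by
  have h1 : ContinuousAt (fun q : ℂ × ℝ => (q.1, π q.2)) (z, t) :=
    continuousAt_fst.prodMk (ContinuousAt.comp (f := Prod.snd) hπ continuousAt_snd)
  exact ContinuousAt.comp (f := fun q : ℂ × ℝ => (q.1, π q.2)) h.continuousAt h1

theorem continuousAt_timeDeriv (h : ContDiffAt ℂ 2 Ψ (z, π t)) (hπ : ContinuousAt π t)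
    (hπ' : ContinuousAt (deriv π) t) :
    ContinuousAt (fun q : ℂ × ℝ => timeDeriv Ψ π q.1 q.2) (z, t) := by
  have h1 : ContinuousAt (fun q : ℂ × ℝ => (q.1, π q.2)) (z, t) :=
    continuousAt_fst.prodMk (ContinuousAt.comp (f := Prod.snd) hπ continuousAt_snd)
  have h2 : ContinuousAt (fun q : ℂ × ℝ => fderiv ℂ Ψ (q.1, π q.2)) (z, t) :=
    ContinuousAt.comp (f := fun q : ℂ × ℝ => (q.1, π q.2))
      (h.fderiv_right (m := 1) (by norm_num)).continuousAt h1
  have h3 : ContinuousAt (fun q : ℂ × ℝ => ((0 : ℂ), deriv π q.2)) (z, t) :=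
    continuousAt_const.prodMk (ContinuousAt.comp (g := deriv π) (f := Prod.snd) (x := (z, t))
      hπ' continuousAt_snd)
  exact h2.clm_apply h3

end TimeDerivative

/-! ### The integrand as a function of the point and of the parameters -/

/-- The space of the parameters `(c, ω₂, (z_k), a, b)`. -/
abbrev ParamSpace : Type := ℂ × ℂ × (Fin 4 → ℂ) × ℂ × ℂ

/-- The expression for the integrand in which `σ` is replaced by arbitrary functions of the
second period and of the point. -/
def kernel (β : ℝ) (s : Fin 4 → ℂ → ℂ → ℂ) (sa sb : ℂ → ℂ → ℂ) (q : ℂ × ParamSpace) : ℂ :=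
  q.2.1 * Complex.exp (((β / Real.pi : ℝ) : ℂ) * (2 * zeta 1 q.2.2.1 (1 / 2)) * q.1) *
    (∏ k, s k q.2.2.1 (q.1 - q.2.2.2.1 k)) /
      (sa q.2.2.1 (q.1 - q.2.2.2.2.1) ^ 2 * sb q.2.2.1 (q.1 - q.2.2.2.2.2) ^ 2)

/-- Smoothness of a function of the second period and of the point. -/
def IsSmoothFactor (s : ℂ → ℂ → ℂ) : Prop :=
  ∀ τ z : ℂ, 0 < τ.im → ContDiffAt ℂ ∞ (fun q : ℂ × ℂ => s q.2 q.1) (z, τ)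

theorem isSmoothFactor_sigma : IsSmoothFactor (sigma 1) := fun _ z hτ => contDiffAt_sigma hτ z

theorem isSmoothFactor_sigmaReg : IsSmoothFactor sigmaReg := fun _ z hτ => contDiffAt_sigmaReg hτ z

theorem sigma_half_ne_zero {τ : ℂ} (hτ : 0 < τ.im) : sigma 1 τ (1 / 2) ≠ 0 := fun h =>
  half_notMem_Lat hτ ((sigma_eq_zero_iff hτ).1 h)

theorem IsSmoothFactor.contDiffAt_comp {s : ℂ → ℂ → ℂ} (hs : IsSmoothFactor s) {E : Type*}
    [NormedAddCommGroup E] [NormedSpace ℂ E] {g h : E → ℂ} {x : E} (hg : ContDiffAt ℂ ∞ g x)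
    (hh : ContDiffAt ℂ ∞ h x) (hτ : 0 < (g x).im) : ContDiffAt ℂ ∞ (fun y => s (g y) (h y)) x :=
  ContDiffAt.comp (g := fun q : ℂ × ℂ => s q.2 q.1) (f := fun y => (h y, g y)) x
    (hs (g x) (h x) hτ) (hh.prodMk hg)

theorem contDiffAt_kernel {β : ℝ} {s : Fin 4 → ℂ → ℂ → ℂ} {sa sb : ℂ → ℂ → ℂ}
    (hs : ∀ k, IsSmoothFactor (s k)) (hsa : IsSmoothFactor sa) (hsb : IsSmoothFactor sb)
    {z c τ a b : ℂ} {w : Fin 4 → ℂ} (hτ : 0 < τ.im) (ha : sa τ (z - a) ≠ 0)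
    (hb : sb τ (z - b) ≠ 0) : ContDiffAt ℂ ∞ (kernel β s sa sb) (z, c, τ, w, a, b) := by
  unfold kernel
  have hτ' : ContDiffAt ℂ ∞ (fun q : ℂ × ParamSpace => q.2.2.1) (z, c, τ, w, a, b) := by fun_prop
  have h1 : ContDiffAt ℂ ∞ (fun q : ℂ × ParamSpace => zeta 1 q.2.2.1 (1 / 2)) (z, c, τ, w, a, b) :=
    ContDiffAt.comp (g := fun q : ℂ × ℂ => zeta 1 q.2 q.1)
      (f := fun q : ℂ × ParamSpace => ((1 / 2 : ℂ), q.2.2.1)) (z, c, τ, w, a, b)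
      (contDiffAt_zeta hτ (sigma_half_ne_zero hτ)) (contDiffAt_const.prodMk hτ')
  have h2 : ContDiffAt ℂ ∞ (fun q : ℂ × ParamSpace => ∏ k, s k q.2.2.1 (q.1 - q.2.2.2.1 k))
      (z, c, τ, w, a, b) := contDiffAt_prod fun k _ =>
    (hs k).contDiffAt_comp hτ' (by fun_prop) hτ
  have h3 : ContDiffAt ℂ ∞ (fun q : ℂ × ParamSpace => sa q.2.2.1 (q.1 - q.2.2.2.2.1))
      (z, c, τ, w, a, b) := hsa.contDiffAt_comp hτ' (by fun_prop) hτ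
  have h4 : ContDiffAt ℂ ∞ (fun q : ℂ × ParamSpace => sb q.2.2.1 (q.1 - q.2.2.2.2.2))
      (z, c, τ, w, a, b) := hsb.contDiffAt_comp hτ' (by fun_prop) hτ
  have h5 : ContDiffAt ℂ ∞ (fun q : ℂ × ParamSpace =>
      Complex.exp (((β / Real.pi : ℝ) : ℂ) * (2 * zeta 1 q.2.2.1 (1 / 2)) * q.1))
      (z, c, τ, w, a, b) :=
    ((contDiffAt_const.mul (contDiffAt_const.mul h1)).mul contDiffAt_fst).cexp
  refine ContDiffAt.div ((ContDiffAt.mul (by fun_prop) h5).mul h2) ((h3.pow 2).mul (h4.pow 2)) ?_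
  exact mul_ne_zero (pow_ne_zero 2 ha) (pow_ne_zero 2 hb)

/-- Logarithmic differentiation with the logarithmic derivatives of the factors left abstract, so
that one formula serves both for a removed zero and for a removed double pole. -/
theorem hasDerivAt_kernel {β : ℝ} {s : Fin 4 → ℂ → ℂ → ℂ} {sa sb : ℂ → ℂ → ℂ}
    {z c τ a b : ℂ} {w : Fin 4 → ℂ} {l : Fin 4 → ℂ} {la lb : ℂ}
    (hs : ∀ k, HasDerivAt (s k τ) (s k τ (z - w k) * l k) (z - w k))
    (hsa : HasDerivAt (sa τ) (sa τ (z - a) * la) (z - a))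
    (hsb : HasDerivAt (sb τ) (sb τ (z - b) * lb) (z - b))
    (ha : sa τ (z - a) ≠ 0) (hb : sb τ (z - b) ≠ 0) :
    HasDerivAt (fun z => kernel β s sa sb (z, c, τ, w, a, b))
      (kernel β s sa sb (z, c, τ, w, a, b) *
        (((β / Real.pi : ℝ) : ℂ) * (2 * zeta 1 τ (1 / 2)) + ∑ k, l k - 2 * la - 2 * lb)) z := by
  unfold kernel
  simp only
  set g : ℂ := ((β / Real.pi : ℝ) : ℂ) * (2 * zeta 1 τ (1 / 2))
  have h1 : HasDerivAt (fun z => c * Complex.exp (g * z)) (c * (Complex.exp (g * z) * (g * 1))) z :=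
    ((hasDerivAt_id z).const_mul g).cexp.const_mul c
  have h2 : HasDerivAt (fun z => ∏ k, s k τ (z - w k))
      ((∏ k, s k τ (z - w k)) * ∑ k, l k) z := by
    refine (HasDerivAt.fun_finsetProd (u := Finset.univ) fun k _ =>
      (hs k).comp_sub_const z (w k)).congr_deriv ?_
    rw [Finset.mul_sum]
    refine Finset.sum_congr rfl fun k hk => ?_
    rw [smul_eq_mul, ← mul_assoc, Finset.prod_erase_mul _ _ hk]
  have h3 := ((hsa.comp_sub_const z a).fun_pow 2).fun_mul ((hsb.comp_sub_const z b).fun_pow 2)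
  refine ((h1.fun_mul h2).fun_div h3
    (mul_ne_zero (pow_ne_zero 2 ha) (pow_ne_zero 2 hb))).congr_deriv ?_
  field_simp
  push_cast
  ring

/-- The integrand is `z - a` in the power `-2` times a factor that is regular at `a`. -/
theorem kernel_eq_div_sq_left (β : ℝ) (z c τ a b : ℂ) (w : Fin 4 → ℂ) :
    kernel β (fun _ => sigma 1) (sigma 1) (sigma 1) (z, c, τ, w, a, b) =
      kernel β (fun _ => sigma 1) sigmaReg (sigma 1) (z, c, τ, w, a, b) / (z - a) ^ 2 := by
  simp only [kernel]
  rw [sigma_eq τ (z - a), mul_pow, div_div]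
  congr 1
  ring

theorem kernel_eq_div_sq_right (β : ℝ) (z c τ a b : ℂ) (w : Fin 4 → ℂ) :
    kernel β (fun _ => sigma 1) (sigma 1) (sigma 1) (z, c, τ, w, a, b) =
      kernel β (fun _ => sigma 1) (sigma 1) sigmaReg (z, c, τ, w, a, b) / (z - b) ^ 2 := by
  simp only [kernel]
  rw [sigma_eq τ (z - b), mul_pow, div_div]
  congr 1
  ring

/-- `σ` with the simple zero at the `k`-th point removed. -/
def regAt (k : Fin 4) : Fin 4 → ℂ → ℂ → ℂ := Function.update (fun _ => sigma 1) k sigmaReg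

theorem regAt_same (k : Fin 4) : regAt k k = sigmaReg := Function.update_self ..

theorem regAt_of_ne {j k : Fin 4} (h : j ≠ k) : regAt k j = sigma 1 := Function.update_of_ne h ..

theorem isSmoothFactor_regAt (k j : Fin 4) : IsSmoothFactor (regAt k j) := by
  by_cases h : j = k
  · rw [h, regAt_same]; exact isSmoothFactor_sigmaReg
  · rw [regAt_of_ne h]; exact isSmoothFactor_sigma

theorem prod_regAt (k : Fin 4) (τ : ℂ) (u : Fin 4 → ℂ) :
    ∏ j, regAt k j τ (u j) = sigmaReg τ (u k) * ∏ j ∈ Finset.univ.erase k, sigma 1 τ (u j) := by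
  rw [← Finset.mul_prod_erase _ _ (Finset.mem_univ k), regAt_same]
  congr 1
  exact Finset.prod_congr rfl fun j hj => by rw [regAt_of_ne (Finset.ne_of_mem_erase hj)]

theorem kernel_eq_mul (β : ℝ) (k : Fin 4) (z c τ a b : ℂ) (w : Fin 4 → ℂ) :
    kernel β (fun _ => sigma 1) (sigma 1) (sigma 1) (z, c, τ, w, a, b) =
      (z - w k) * kernel β (regAt k) (sigma 1) (sigma 1) (z, c, τ, w, a, b) := by
  simp only [kernel]
  rw [prod_regAt, ← Finset.mul_prod_erase _ _ (Finset.mem_univ k), sigma_eq τ (z - w k)]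
  ring

/-! ### Basic properties of a slit family -/

namespace AccessoryParameters

variable (F : AccessoryParameters)

/-- The parameters of the integrand at the time `t`. -/
def params (t : ℝ) : ParamSpace := (F.c t, F.ω₂ t, fun k => F.z k t, F.z₀ t, conj (F.z₀ t))

/-- The integrand as a function of the point and of the parameters. -/
def Φ : ℂ × ParamSpace → ℂ := kernel F.β (fun _ => sigma 1) (sigma 1) (sigma 1)

/-- The integrand without its zero at `z_k`. -/
def Φz (k : Fin 4) : ℂ × ParamSpace → ℂ := kernel F.β (regAt k) (sigma 1) (sigma 1)

/-- The integrand without its pole at `z₀`. -/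
def Φa : ℂ × ParamSpace → ℂ := kernel F.β (fun _ => sigma 1) sigmaReg (sigma 1)

/-- The integrand without its pole at `conj z₀`. -/
def Φb : ℂ × ParamSpace → ℂ := kernel F.β (fun _ => sigma 1) (sigma 1) sigmaReg

theorem integrand_eq (t : ℝ) (u : ℂ) : F.integrand t u = F.Φ (u, F.params t) := rfl

theorem Φ_eq_mul (k : Fin 4) (u : ℂ) (t : ℝ) :
    F.Φ (u, F.params t) = (u - F.z k t) * F.Φz k (u, F.params t) := kernel_eq_mul ..

theorem Φ_eq_div_left (u : ℂ) (t : ℝ) :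
    F.Φ (u, F.params t) = F.Φa (u, F.params t) / (u - F.z₀ t) ^ 2 := kernel_eq_div_sq_left ..

theorem Φ_eq_div_right (u : ℂ) (t : ℝ) :
    F.Φ (u, F.params t) = F.Φb (u, F.params t) / (u - conj (F.z₀ t)) ^ 2 :=
  kernel_eq_div_sq_right ..

theorem D_eq (k : Fin 4) (t : ℝ) : F.D k t = F.Φz k (F.z k t, F.params t) := by
  simp only [D, Φz, kernel, params]
  rw [prod_regAt, sub_self, sigmaReg_zero, one_mul]
  rfl

theorem residue_eq (t : ℝ) : F.residue t = -F.Φa (F.z₀ t, F.params t) := by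
  simp only [residue, Φa, kernel, params]
  rw [sub_self, sigmaReg_zero, one_pow, one_mul, neg_mul, neg_mul, neg_div]
  rfl

theorem isPole_iff (t : ℝ) (u : ℂ) :
    F.IsPole t u ↔ u - F.z₀ t ∈ Lat (F.ω₂ t) ∨ u - conj (F.z₀ t) ∈ Lat (F.ω₂ t) := by
  unfold IsPole Lat
  rw [exists_or]
  refine or_congr ⟨fun ⟨p, hp⟩ => ⟨p, by rw [hp]; ring⟩, fun ⟨p, hp⟩ => ⟨p, by rw [hp]; ring⟩⟩
    ⟨fun ⟨p, hp⟩ => ⟨p, by rw [hp]; ring⟩, fun ⟨p, hp⟩ => ⟨p, by rw [hp]; ring⟩⟩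

theorem ω₂_im (t : ℝ) : (F.ω₂ t).im = 2 * F.m t := by simp [ω₂]

theorem conj_ω₂ (t : ℝ) : conj (F.ω₂ t) = -F.ω₂ t := by
  simp [ω₂, Complex.conj_ofNat]

theorem conj_z₀ (t : ℝ) : conj (F.z₀ t) = -F.z₀ t := by simp [z₀]

theorem z₀_im (t : ℝ) : (F.z₀ t).im = F.y₀ t := by simp [z₀]

theorem conj_γ (t : ℝ) : conj (F.γ t) = F.γ t := by
  simp only [γ, η₁, ζ, map_mul, Complex.conj_ofReal]
  rw [conj_zeta (F.conj_ω₂ t)]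
  simp [Complex.conj_ofNat]

theorem isPole_add {t : ℝ} {u w : ℂ} (hw : w ∈ Lat (F.ω₂ t)) :
    F.IsPole t (u + w) ↔ F.IsPole t u := by
  rw [isPole_iff, isPole_iff, add_sub_right_comm, add_sub_right_comm, add_mem_Lat_iff hw,
    add_mem_Lat_iff hw]

theorem conj_mem_Lat {t : ℝ} {u : ℂ} (hu : u ∈ Lat (F.ω₂ t)) : conj u ∈ Lat (F.ω₂ t) := by
  obtain ⟨p, rfl⟩ := hu
  refine ⟨(p.1, -p.2), ?_⟩
  simp [latticePoint, F.conj_ω₂ t]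

theorem isPole_conj {t : ℝ} {u : ℂ} : F.IsPole t (conj u) ↔ F.IsPole t u := by
  have h : ∀ u, F.IsPole t u → F.IsPole t (conj u) := by
    intro u hu
    rw [isPole_iff] at *
    rcases hu with h | h
    · right; simpa using F.conj_mem_Lat h
    · left; simpa using F.conj_mem_Lat h
  exact ⟨fun hu => by simpa using h _ hu, h u⟩

theorem countable_isPole (t : ℝ) : {u | F.IsPole t u}.Countable := by
  have : {u | F.IsPole t u} = (fun u => u + F.z₀ t) '' Lat (F.ω₂ t) ∪
      (fun u => u + conj (F.z₀ t)) '' Lat (F.ω₂ t) := by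
    ext u
    simp only [mem_ofPred_eq, isPole_iff, mem_union, mem_image, ← eq_sub_iff_add_eq,
      exists_eq_right]
  rw [this]
  exact ((countable_Lat _).image _).union ((countable_Lat _).image _)

theorem isConnected_nonpoles (t : ℝ) : IsConnected {u | ¬ F.IsPole t u} :=
  isConnected_compl_countable (F.countable_isPole t)

end AccessoryParameters

namespace IsSlitFamily

variable {F : AccessoryParameters} {f : ℝ → ℂ → ℂ} {I : Set ℝ} (hf : IsSlitFamily F f I)
  {t : ℝ} (ht : t ∈ I)

include hf ht

theorem m_pos : 0 < F.m t := (hf.y₀_pos t ht).trans (hf.y₀_lt t ht)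

theorem ω₂_im_pos : 0 < (F.ω₂ t).im := by
  rw [F.ω₂_im]; linarith [hf.m_pos ht]

theorem mem_Lat_iff_sigma {u : ℂ} : u ∈ Lat (F.ω₂ t) ↔ sigma 1 (F.ω₂ t) u = 0 :=
  (sigma_eq_zero_iff (hf.ω₂_im_pos ht)).symm

theorem notMem_Lat_of_im {u : ℂ} (h1 : -(2 * F.m t) < u.im) (h2 : u.im < 2 * F.m t)
    (h3 : u.im ≠ 0) : u ∉ Lat (F.ω₂ t) := by
  rintro ⟨p, rfl⟩
  rw [latticePoint_im, F.ω₂_im] at *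
  have hm := hf.m_pos ht
  have h4 : (p.2 : ℝ) < 1 := by nlinarith
  have h5 : (-1 : ℝ) < p.2 := by nlinarith
  have h6 : p.2 = 0 := by
    have a1 : p.2 < 1 := by exact_mod_cast h4
    have a2 : -1 < p.2 := by exact_mod_cast h5
    lia
  simp [h6] at h3

omit hf ht in
theorem notMem_Lat_of_re {F : AccessoryParameters} {t : ℝ} {u : ℂ} (h1 : 0 < u.re) (h2 : u.re < 1) : u ∉ Lat (F.ω₂ t) := by
  rintro ⟨p, rfl⟩
  have h : (latticePoint 1 (F.ω₂ t) p).re = p.1 := by simp [latticePoint, AccessoryParameters.ω₂]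
  rw [h] at h1 h2
  have a1 : p.1 < 1 := by exact_mod_cast h2
  have a2 : 0 < p.1 := by exact_mod_cast h1
  lia

theorem not_isPole_of_im {u : ℂ} (h : u.im = 0 ∨ u.im = F.m t ∨ u.im = -F.m t) :
    ¬ F.IsPole t u := by
  have h1 := hf.y₀_pos t ht
  have h2 := hf.y₀_lt t ht
  rw [F.isPole_iff, not_or]
  constructor
  · apply hf.notMem_Lat_of_im ht <;> rw [Complex.sub_im, F.z₀_im] <;>
      rcases h with h | h | h <;> rw [h] <;> linarith
  · apply hf.notMem_Lat_of_im ht <;> rw [Complex.sub_im, Complex.conj_im, F.z₀_im] <;>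
      rcases h with h | h | h <;> rw [h] <;> linarith

omit hf ht in
theorem z_im (F : AccessoryParameters) (k : Fin 4) (t : ℝ) :
    (F.z k t).im = (![0, 0, 1, -1] : Fin 4 → ℝ) k * F.m t := by
  fin_cases k <;> simp [AccessoryParameters.z]

omit hf ht in
theorem z_re (F : AccessoryParameters) (k : Fin 4) (t : ℝ) : (F.z k t).re = F.x k t := by
  fin_cases k <;> simp [AccessoryParameters.z]

theorem not_isPole_z (k : Fin 4) : ¬ F.IsPole t (F.z k t) := by
  apply hf.not_isPole_of_im ht
  rw [z_im]
  fin_cases k <;> simp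

theorem not_isPole_ofReal (x : ℝ) : ¬ F.IsPole t x := hf.not_isPole_of_im ht (by simp)

theorem z_sub_z_notMem {j k : Fin 4} (hjk : j < k) : F.z k t - F.z j t ∉ Lat (F.ω₂ t) := by
  have hm := hf.m_pos ht
  obtain ⟨h1, h2, h3, h4⟩ := hf.x_lt t ht
  have him : (F.z k t - F.z j t).im =
      (![0, 0, 1, -1] : Fin 4 → ℝ) k * F.m t - (![0, 0, 1, -1] : Fin 4 → ℝ) j * F.m t := by
    rw [Complex.sub_im, z_im, z_im]
  have hre : (F.z k t - F.z j t).re = F.x k t - F.x j t := by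
    rw [Complex.sub_re, z_re, z_re]
  fin_cases j <;> fin_cases k <;> first | exact absurd hjk (by decide) | skip
  · exact notMem_Lat_of_re (by rw [hre]; simpa using h1) (by rw [hre]; simp; linarith)
  all_goals first
    | exact notMem_Lat_of_re (by rw [hre]; simpa using h3) (by rw [hre]; simp; linarith)
    | (apply hf.notMem_Lat_of_im ht <;> rw [him] <;> simp <;> linarith)

theorem z_sub_z_notMem' {j k : Fin 4} (hjk : j ≠ k) : F.z k t - F.z j t ∉ Lat (F.ω₂ t) := by
  rcases lt_or_gt_of_ne hjk with h | h
  · exact hf.z_sub_z_notMem ht h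
  · intro h'
    exact hf.z_sub_z_notMem ht h (by simpa using neg_mem_Lat h')

theorem sigma_ne_zero {u : ℂ} (hu : u ∉ Lat (F.ω₂ t)) : sigma 1 (F.ω₂ t) u ≠ 0 :=
  fun h => hu ((hf.mem_Lat_iff_sigma ht).2 h)

theorem not_isPole_iff_sigma {u : ℂ} : ¬ F.IsPole t u ↔
    sigma 1 (F.ω₂ t) (u - F.z₀ t) ≠ 0 ∧ sigma 1 (F.ω₂ t) (u - conj (F.z₀ t)) ≠ 0 := by
  rw [F.isPole_iff, not_or, hf.mem_Lat_iff_sigma ht, hf.mem_Lat_iff_sigma ht]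

theorem z₀_sub_conj_notMem : F.z₀ t - conj (F.z₀ t) ∉ Lat (F.ω₂ t) := by
  have h1 := hf.y₀_pos t ht
  have h2 := hf.y₀_lt t ht
  have h : (F.z₀ t - conj (F.z₀ t)).im = 2 * F.y₀ t := by
    rw [Complex.sub_im, Complex.conj_im, F.z₀_im]; ring
  apply hf.notMem_Lat_of_im ht <;> rw [h]
  · linarith
  · linarith
  · positivity

theorem z₀_sub_z_notMem (k : Fin 4) : F.z₀ t - F.z k t ∉ Lat (F.ω₂ t) := by
  intro h
  refine hf.not_isPole_z ht k ((F.isPole_iff t _).2 (Or.inl ?_))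
  simpa using neg_mem_Lat h

theorem conj_z₀_sub_z_notMem (k : Fin 4) : conj (F.z₀ t) - F.z k t ∉ Lat (F.ω₂ t) := by
  intro h
  refine hf.not_isPole_z ht k ((F.isPole_iff t _).2 (Or.inr ?_))
  simpa using neg_mem_Lat h

omit hf ht in
theorem kernel_ne_zero {β : ℝ} {s : Fin 4 → ℂ → ℂ → ℂ} {sa sb : ℂ → ℂ → ℂ} {z c τ a b : ℂ}
    {w : Fin 4 → ℂ} (hc : c ≠ 0) (hs : ∀ k, s k τ (z - w k) ≠ 0) (ha : sa τ (z - a) ≠ 0)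
    (hb : sb τ (z - b) ≠ 0) : kernel β s sa sb (z, c, τ, w, a, b) ≠ 0 :=
  div_ne_zero (mul_ne_zero (mul_ne_zero hc (Complex.exp_ne_zero _))
    (Finset.prod_ne_zero_iff.2 fun k _ => hs k)) (mul_ne_zero (pow_ne_zero 2 ha) (pow_ne_zero 2 hb))

theorem integrand_ne_zero {u : ℂ} (hu : ¬ F.IsPole t u) (hz : ∀ k, u - F.z k t ∉ Lat (F.ω₂ t)) :
    F.integrand t u ≠ 0 := by
  have h := (hf.not_isPole_iff_sigma ht).1 hu
  exact kernel_ne_zero (hf.c_ne_zero t ht) (fun k => hf.sigma_ne_zero ht (hz k)) h.1 h.2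

theorem D_ne_zero (k : Fin 4) : F.D k t ≠ 0 := by
  rw [F.D_eq]
  have h := (hf.not_isPole_iff_sigma ht).1 (hf.not_isPole_z ht k)
  refine kernel_ne_zero (hf.c_ne_zero t ht) (fun j => ?_) h.1 h.2
  by_cases hj : j = k
  · subst hj
    rw [regAt_same, sub_self, sigmaReg_zero]
    exact one_ne_zero
  · rw [regAt_of_ne hj]
    exact hf.sigma_ne_zero ht (hf.z_sub_z_notMem' ht hj)

theorem Φa_ne_zero : F.Φa (F.z₀ t, F.params t) ≠ 0 := by
  refine kernel_ne_zero (hf.c_ne_zero t ht)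
    (fun j => hf.sigma_ne_zero ht (hf.z₀_sub_z_notMem ht j)) ?_
    (hf.sigma_ne_zero ht (hf.z₀_sub_conj_notMem ht))
  rw [sub_self, sigmaReg_zero]; exact one_ne_zero

theorem Φb_ne_zero : F.Φb (conj (F.z₀ t), F.params t) ≠ 0 := by
  refine kernel_ne_zero (hf.c_ne_zero t ht)
    (fun j => hf.sigma_ne_zero ht (hf.conj_z₀_sub_z_notMem ht j))
    (hf.sigma_ne_zero ht fun h => hf.z₀_sub_conj_notMem ht (by simpa using neg_mem_Lat h)) ?_
  rw [sub_self, sigmaReg_zero]; exact one_ne_zero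

/-! #### Smoothness -/

theorem contDiffAt_Φ {u : ℂ} (hu : ¬ F.IsPole t u) : ContDiffAt ℂ 2 F.Φ (u, F.params t) :=
  have h := (hf.not_isPole_iff_sigma ht).1 hu
  .of_le (contDiffAt_kernel (fun _ => isSmoothFactor_sigma) isSmoothFactor_sigma isSmoothFactor_sigma
    (hf.ω₂_im_pos ht) h.1 h.2) (WithTop.coe_le_coe.2 le_top)

theorem contDiffAt_Φz (k : Fin 4) {u : ℂ} (hu : ¬ F.IsPole t u) :
    ContDiffAt ℂ 2 (F.Φz k) (u, F.params t) :=
  have h := (hf.not_isPole_iff_sigma ht).1 hu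
  .of_le (contDiffAt_kernel (isSmoothFactor_regAt k) isSmoothFactor_sigma isSmoothFactor_sigma
    (hf.ω₂_im_pos ht) h.1 h.2) (WithTop.coe_le_coe.2 le_top)

theorem contDiffAt_Φa : ContDiffAt ℂ 2 F.Φa (F.z₀ t, F.params t) :=
  .of_le (contDiffAt_kernel (fun _ => isSmoothFactor_sigma) isSmoothFactor_sigmaReg isSmoothFactor_sigma
    (hf.ω₂_im_pos ht) (by rw [sub_self, sigmaReg_zero]; exact one_ne_zero)
    (hf.sigma_ne_zero ht (hf.z₀_sub_conj_notMem ht))) (WithTop.coe_le_coe.2 le_top)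

theorem contDiffAt_Φb : ContDiffAt ℂ 2 F.Φb (conj (F.z₀ t), F.params t) :=
  .of_le (contDiffAt_kernel (fun _ => isSmoothFactor_sigma) isSmoothFactor_sigma isSmoothFactor_sigmaReg
    (hf.ω₂_im_pos ht)
    (hf.sigma_ne_zero ht fun h => hf.z₀_sub_conj_notMem ht (by simpa using neg_mem_Lat h))
    (by rw [sub_self, sigmaReg_zero]; exact one_ne_zero)) (WithTop.coe_le_coe.2 le_top)

omit ht in
theorem contDiffOn_params : ContDiffOn ℝ 1 F.params I := by
  have hof : ∀ {g : ℝ → ℝ}, ContDiffOn ℝ 1 g I → ContDiffOn ℝ 1 (fun t => (g t : ℂ)) I :=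
    fun hg => Complex.ofRealCLM.contDiff.comp_contDiffOn hg
  have h0 : ContDiffOn ℝ 1 F.z₀ I := (hof hf.smooth_y₀).mul contDiffOn_const
  have h1 : ContDiffOn ℝ 1 F.ω₂ I := (contDiffOn_const.mul (hof hf.smooth_m)).mul contDiffOn_const
  have h2 : ContDiffOn ℝ 1 (fun t => fun k => F.z k t) I := contDiffOn_pi.2 fun k =>
    (hof (hf.smooth_x k)).add ((contDiffOn_const.mul (hof hf.smooth_m)).mul contDiffOn_const)
  have h3 : ContDiffOn ℝ 1 (fun t => conj (F.z₀ t)) I :=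
    Complex.conjCLE.contDiff.comp_contDiffOn h0
  exact hf.smooth_c.prodMk (h1.prodMk (h2.prodMk (h0.prodMk h3)))

theorem contDiffAt_params (hI : IsOpen I) : ContDiffAt ℝ 1 F.params t :=
  hf.contDiffOn_params.contDiffAt (hI.mem_nhds ht)

theorem differentiableAt_params (hI : IsOpen I) : DifferentiableAt ℝ F.params t :=
  (hf.contDiffAt_params ht hI).differentiableAt one_ne_zero

theorem continuousAt_deriv_params (hI : IsOpen I) : ContinuousAt (deriv F.params) t :=
  (hf.contDiffOn_params.continuousOn_deriv_of_isOpen hI le_rfl).continuousAt (hI.mem_nhds ht)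

theorem hasDerivAt_ω₂ (hI : IsOpen I) : HasDerivAt F.ω₂ (deriv F.ω₂ t) t :=
  ((hf.differentiableAt_params ht hI).snd.fst).hasDerivAt

theorem hasDerivAt_z (hI : IsOpen I) (k : Fin 4) : HasDerivAt (F.z k) (deriv (F.z k) t) t :=
  (differentiableAt_pi.1 (hf.differentiableAt_params ht hI).snd.snd.fst k).hasDerivAt

theorem hasDerivAt_z₀ (hI : IsOpen I) : HasDerivAt F.z₀ (deriv F.z₀ t) t :=
  ((hf.differentiableAt_params ht hI).snd.snd.snd.fst).hasDerivAt

theorem isOpen_nonpoles : IsOpen {u | ¬ F.IsPole t u} := by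
  have h : {u | ¬ F.IsPole t u} = {u | sigma 1 (F.ω₂ t) (u - F.z₀ t) ≠ 0} ∩
      {u | sigma 1 (F.ω₂ t) (u - conj (F.z₀ t)) ≠ 0} := by
    ext u; exact hf.not_isPole_iff_sigma ht
  have hc := (differentiable_sigma (hf.ω₂_im_pos ht)).continuous
  rw [h]
  exact (isOpen_ne_fun (by fun_prop) continuous_const).inter
    (isOpen_ne_fun (by fun_prop) continuous_const)

/-- The poles are zeros of `σ` factors, which are jointly continuous in the point and in time. -/
theorem eventually_not_isPole (hI : IsOpen I) {u : ℂ} (hu : ¬ F.IsPole t u) :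
    ∀ᶠ q : ℂ × ℝ in 𝓝 (u, t), q.2 ∈ I ∧ ¬ F.IsPole q.2 q.1 := by
  have hI' : ∀ᶠ q : ℂ × ℝ in 𝓝 (u, t), q.2 ∈ I := continuousAt_snd (hI.mem_nhds ht)
  have hπ := (hf.differentiableAt_params ht hI).continuousAt
  have hτ : ContinuousAt (fun q : ℂ × ℝ => F.ω₂ q.2) (u, t) :=
    ContinuousAt.comp (g := F.ω₂) (f := Prod.snd) (x := (u, t)) hπ.snd.fst continuousAt_snd
  have ha : ContinuousAt (fun q : ℂ × ℝ => F.z₀ q.2) (u, t) :=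
    ContinuousAt.comp (g := F.z₀) (f := Prod.snd) (x := (u, t)) hπ.snd.snd.snd.fst
      continuousAt_snd
  have hs : ∀ {g : ℂ × ℝ → ℂ}, ContinuousAt g (u, t) →
      ContinuousAt (fun q => sigma 1 (F.ω₂ q.2) (q.1 - g q)) (u, t) := by
    intro g hg
    exact ContinuousAt.comp (g := fun q : ℂ × ℂ => sigma 1 q.2 q.1)
      (f := fun q : ℂ × ℝ => (q.1 - g q, F.ω₂ q.2)) (x := (u, t))
      (contDiffAt_sigma (hf.ω₂_im_pos ht) _).continuousAt
      ((continuousAt_fst.sub hg).prodMk hτ)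
  have h := (hf.not_isPole_iff_sigma ht).1 hu
  have hac : ContinuousAt (fun q : ℂ × ℝ => conj (F.z₀ q.2)) (u, t) :=
    Complex.continuous_conj.continuousAt.comp ha
  filter_upwards [hI', (hs ha).eventually_ne h.1, (hs hac).eventually_ne h.2] with q h1 h2 h3
  exact ⟨h1, (hf.not_isPole_iff_sigma h1).2 ⟨h2, h3⟩⟩

/-! #### The time derivative of the mapping -/

/-- Time differentiability is known at the base point `0`, where `f` equals `c₁`. It spreads over
the connected complement of the poles because the `z`-derivative is smooth in time. -/
theorem hasDerivAt_deriv_time (hI : IsOpen I) {u : ℂ} (hu : ¬ F.IsPole t u) :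
    HasDerivAt (fun s => f s u) (deriv (fun s => f s u) t) t ∧
      HasDerivAt (fun u => deriv (fun s => f s u) t) (timeDeriv F.Φ F.params u t) u := by
  have key := hasDerivAt_parameter_deriv (f := f) (φ := fun u s => F.integrand s u)
    (φ' := fun u s => timeDeriv F.Φ F.params u s) (t₀ := t) (z := u) (o := 0)
    (F.isConnected_nonpoles t).isPreconnected (fun a ha => ?_) (fun a ha => ?_)
    (by simpa using hf.not_isPole_ofReal ht 0) ?_ hu
  · exact ⟨key.1.hasDerivAt, key.2⟩
  · filter_upwards [hf.eventually_not_isPole ht hI ha] with q hq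
    have hΦ := hf.contDiffAt_Φ hq.1 hq.2
    have hd := hf.differentiableAt_params hq.1 hI
    exact ⟨hf.hasDerivAt q.2 hq.1 q.1 hq.2, hasDerivAt_timeDeriv hΦ hd,
      continuousAt_timeDeriv hΦ hd.continuousAt (hf.continuousAt_deriv_params hq.1 hI)⟩
  · filter_upwards [(hf.isOpen_nonpoles ht).mem_nhds ha] with z hz
    exact differentiableAt_timeDeriv (hf.contDiffAt_Φ ht hz)
  · have : (fun s => f s 0) =ᶠ[𝓝 t] F.c₁ := by
      filter_upwards [hI.mem_nhds ht] with s hs using hf.map_zero s hs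
    exact ((hf.smooth_c₁.contDiffAt (hI.mem_nhds ht)).differentiableAt
      one_ne_zero).congr_of_eventuallyEq this

theorem hasDerivAt_comp_time (hI : IsOpen I) {w : ℝ → ℂ} {w' : ℂ} (hw : HasDerivAt w w' t)
    (hu : ¬ F.IsPole t (w t)) :
    HasDerivAt (fun s => f s (w s))
      (F.integrand t (w t) * w' + deriv (fun s => f s (w t)) t) t := by
  refine hasDerivAt_parameter_comp (f := f) (φ := fun u s => F.integrand s u) hw ?_ ?_
    (hf.hasDerivAt_deriv_time ht hI hu).1
  · filter_upwards [hf.eventually_not_isPole ht hI hu] with q hq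
    exact hf.hasDerivAt q.2 hq.1 q.1 hq.2
  · exact continuousAt_comp_time (hf.contDiffAt_Φ ht hu)
      (hf.differentiableAt_params ht hI).continuousAt

omit hf ht in
theorem integrand_z (F : AccessoryParameters) (t : ℝ) (k : Fin 4) : F.integrand t (F.z k t) = 0 := by
  rw [F.integrand_eq, F.Φ_eq_mul k, sub_self, zero_mul]

/-- The motion of `z_k` does not contribute, since the `z`-derivative of the mapping vanishes there.
-/
theorem hasDerivAt_A (hI : IsOpen I) (k : Fin 4) :
    HasDerivAt (F.A f k) (deriv (fun s => f s (F.z k t)) t) t := by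
  have := hf.hasDerivAt_comp_time ht hI (hf.hasDerivAt_z ht hI k) (hf.not_isPole_z ht k)
  rw [integrand_z, zero_mul, zero_add] at this
  exact this

end IsSlitFamily

/-! ### Functional equations of the mapping -/

namespace IsSlitFamily

variable {F : AccessoryParameters} {f : ℝ → ℂ → ℂ} {I : Set ℝ} (hf : IsSlitFamily F f I)
  {t : ℝ} (ht : t ∈ I)

include hf ht

/-- Conjugation fixes the first two prevertices, exchanges `z₀` with its conjugate, and moves the
other two prevertices by opposite periods. The multipliers of `σ` then combine to a factor
independent of `u`. -/
theorem exists_integrand_conj :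
    ∃ M, ∀ u, F.integrand t (conj u) = M * conj (F.integrand t u) := by
  have hτ := hf.ω₂_im_pos ht
  obtain ⟨C, η, hC, hσ⟩ := exists_sigma_add hτ (tau_mem_Lat (F.ω₂ t))
  have hcs := fun u => conj_sigma hτ (F.conj_ω₂ t) u
  have hc : conj (F.c t) ≠ 0 := (map_ne_zero _).2 (hf.c_ne_zero t ht)
  refine ⟨F.c t / conj (F.c t) * Complex.exp (-(η * (F.z 3 t + F.ω₂ t - F.z 2 t))), fun u => ?_⟩
  have z0 : conj (F.z 0 t) = F.z 0 t := by simp [AccessoryParameters.z]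
  have z1 : conj (F.z 1 t) = F.z 1 t := by simp [AccessoryParameters.z]
  have z2 : conj (F.z 2 t) = F.z 2 t - F.ω₂ t := by
    simp [AccessoryParameters.z, AccessoryParameters.ω₂]; ring
  have z3 : conj (F.z 3 t) = F.z 3 t + F.ω₂ t := by
    simp [AccessoryParameters.z, AccessoryParameters.ω₂]; ring
  simp only [AccessoryParameters.integrand, AccessoryParameters.σ, Fin.prod_univ_four, map_div₀,
    map_mul, map_pow, hcs, map_sub, ← Complex.exp_conj, F.conj_γ, Complex.conj_conj, z0, z1, z2, z3]
  set v := conj u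
  have s2 : sigma 1 (F.ω₂ t) (v - (F.z 2 t - F.ω₂ t)) =
      C * Complex.exp (η * (v - F.z 2 t)) * sigma 1 (F.ω₂ t) (v - F.z 2 t) := by
    rw [← hσ]; congr 1; ring
  have s3 : sigma 1 (F.ω₂ t) (v - F.z 3 t) =
      C * Complex.exp (η * (v - (F.z 3 t + F.ω₂ t))) *
        sigma 1 (F.ω₂ t) (v - (F.z 3 t + F.ω₂ t)) := by
    rw [← hσ]; congr 1; ring
  rw [s2, s3]
  have e : Complex.exp (η * (v - (F.z 3 t + F.ω₂ t))) =
      Complex.exp (-(η * (F.z 3 t + F.ω₂ t - F.z 2 t))) * Complex.exp (η * (v - F.z 2 t)) := by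
    rw [← Complex.exp_add]; congr 1; ring
  rw [e, mul_comm (sigma 1 (F.ω₂ t) (v - F.z₀ t) ^ 2)]
  field_simp

/-- Numerator and denominator both have `σ`-degree four, so the powers of `C` and the dependence of
the multipliers on `u` cancel. The poles add nothing to the exponent because `z₀ + conj z₀ = 0`. -/
theorem exists_integrand_add :
    ∃ E, E ≠ 0 ∧ ∀ u, F.integrand t (u + F.ω₂ t) = E * F.integrand t u := by
  have hτ := hf.ω₂_im_pos ht
  obtain ⟨C, η, hC, hσ⟩ := exists_sigma_add hτ (tau_mem_Lat (F.ω₂ t))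
  refine ⟨Complex.exp (F.γ t * F.ω₂ t - η * ∑ k, F.z k t), Complex.exp_ne_zero _, fun u => ?_⟩
  have hs : ∀ a, sigma 1 (F.ω₂ t) (u + F.ω₂ t - a) =
      C * Complex.exp (η * (u - a)) * sigma 1 (F.ω₂ t) (u - a) := by
    intro a
    rw [← hσ]; congr 1; ring
  simp only [AccessoryParameters.integrand, AccessoryParameters.σ, hs, Fin.prod_univ_four,
    Fin.sum_univ_four]
  have e1 : Complex.exp (F.γ t * (u + F.ω₂ t)) * (Complex.exp (η * (u - F.z 0 t)) *
      Complex.exp (η * (u - F.z 1 t)) * Complex.exp (η * (u - F.z 2 t)) *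
      Complex.exp (η * (u - F.z 3 t))) =
      Complex.exp (F.γ t * F.ω₂ t - η * (F.z 0 t + F.z 1 t + F.z 2 t + F.z 3 t)) *
      Complex.exp (F.γ t * u) *
      (Complex.exp (η * (u - F.z₀ t)) ^ 2 * Complex.exp (η * (u - conj (F.z₀ t))) ^ 2) := by
    simp only [← Complex.exp_add, ← Complex.exp_nat_mul, F.conj_z₀]
    congr 1
    push_cast
    ring
  have h1 := Complex.exp_ne_zero (η * (u - F.z₀ t))
  have h2 := Complex.exp_ne_zero (η * (u - conj (F.z₀ t)))
  have rearrange : ∀ a b X Y Z T c₀ Ex S₁ S₂ S₃ S₄ A B : ℂ, c₀ * Ex *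
      (C * X * S₁ * (C * Y * S₂) * (C * Z * S₃) * (C * T * S₄)) /
        ((C * a * A) ^ 2 * (C * b * B) ^ 2) =
      c₀ * (Ex * (X * Y * Z * T)) * (S₁ * S₂ * S₃ * S₄) * C ^ 4 /
        (C ^ 4 * (a ^ 2 * b ^ 2) * (A ^ 2 * B ^ 2)) := by
    intros; ring
  rw [rearrange, e1]
  field_simp

/-- The function `conj (f (conj u))` is again holomorphic; its derivative is a constant multiple of
`f'`, and the complement of the poles is connected. -/
theorem exists_map_conj : ∃ M N, (∀ u, F.integrand t (conj u) = M * conj (F.integrand t u)) ∧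
    ∀ u, ¬ F.IsPole t u → f t (conj u) = M * conj (f t u) + N := by
  obtain ⟨M, hM⟩ := hf.exists_integrand_conj ht
  have hd : ∀ u ∈ {u | ¬ F.IsPole t u},
      HasDerivAt (fun u => conj (f t (conj u)) - conj M * f t u) 0 u := by
    intro u hu
    have h1 := hf.hasDerivAt t ht (conj u) (fun h => hu (F.isPole_conj.1 h))
    have h2 : HasDerivAt (fun u => conj (f t (conj u))) (conj (F.integrand t (conj u))) u := by
      have := h1.conj_conj
      rwa [Complex.conj_conj] at this
    refine (h2.fun_sub ((hf.hasDerivAt t ht u hu).const_mul (conj M))).congr_deriv ?_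
    rw [hM u, map_mul, Complex.conj_conj, sub_self]
  obtain ⟨N, hN⟩ := (hf.isOpen_nonpoles ht).exists_is_const_of_deriv_eq_zero
    (F.isConnected_nonpoles t).isPreconnected
    (fun z hz => (hd z hz).differentiableAt.differentiableWithinAt) (fun z hz => (hd z hz).deriv)
  refine ⟨M, conj N, hM, fun u hu => ?_⟩
  rw [← hN u hu, map_sub, map_mul, Complex.conj_conj, Complex.conj_conj]
  ring

theorem exists_map_add : ∃ E B, E ≠ 0 ∧ (∀ u, F.integrand t (u + F.ω₂ t) = E * F.integrand t u) ∧
    ∀ u, ¬ F.IsPole t u → f t (u + F.ω₂ t) = E * f t u + B := by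
  obtain ⟨E, hE0, hE⟩ := hf.exists_integrand_add ht
  have hd : ∀ u ∈ {u | ¬ F.IsPole t u},
      HasDerivAt (fun u => f t (u + F.ω₂ t) - E * f t u) 0 u := by
    intro u hu
    have h1 := hf.hasDerivAt t ht (u + F.ω₂ t) (fun h => hu ((F.isPole_add (tau_mem_Lat _)).1 h))
    refine ((h1.comp_add_const u _).fun_sub
      ((hf.hasDerivAt t ht u hu).const_mul E)).congr_deriv ?_
    rw [hE, sub_self]
  obtain ⟨B, hB⟩ := (hf.isOpen_nonpoles ht).exists_is_const_of_deriv_eq_zero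
    (F.isConnected_nonpoles t).isPreconnected
    (fun z hz => (hd z hz).differentiableAt.differentiableWithinAt) (fun z hz => (hd z hz).deriv)
  refine ⟨E, B, hE0, hE, fun u hu => ?_⟩
  rw [← hB u hu]
  ring

/-- Periodicity is given only in the strip. The poles are countable, so the strip contains a regular
point, from which the identity theorem extends the relation. -/
theorem map_add_one {u : ℂ} (hu : ¬ F.IsPole t u) : f t (u + 1) = f t u := by
  have hsub : ∀ u, ¬ F.IsPole t u → ¬ F.IsPole t (u + 1) := fun u hu h =>
    hu ((F.isPole_add (one_mem_Lat _)).1 h)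
  have hopen := hf.isOpen_nonpoles ht
  have hd : DifferentiableOn ℂ (fun u => f t (u + 1) - f t u) {u | ¬ F.IsPole t u} := by
    intro u hu
    exact ((((hf.hasDerivAt t ht _ (hsub u hu)).comp_add_const u 1).fun_sub
      (hf.hasDerivAt t ht u hu)).differentiableAt).differentiableWithinAt
  have hm := hf.m_pos ht
  have hstrip : IsOpen {u : ℂ | -F.m t < u.im ∧ u.im < 0} :=
    (isOpen_lt continuous_const Complex.continuous_im).inter
      (isOpen_lt Complex.continuous_im continuous_const)
  obtain ⟨a, ha, ha'⟩ : ({u : ℂ | -F.m t < u.im ∧ u.im < 0} ∩ {u | ¬ F.IsPole t u}).Nonempty := by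
    have hdense : Dense {u | F.IsPole t u}ᶜ :=
      (F.countable_isPole t).dense_compl ℝ
    exact hdense.inter_open_nonempty _ hstrip ⟨-(F.m t / 2 : ℝ) * Complex.I, by
      constructor <;> simp <;> linarith⟩
  have hev : (fun u => f t (u + 1) - f t u) =ᶠ[𝓝 a] 0 := by
    filter_upwards [hstrip.mem_nhds ha, hopen.mem_nhds ha'] with v hv hv'
    simp only [Pi.zero_apply]
    rw [hf.periodic t ht v ⟨hv.1, hv.2, hv'⟩, sub_self]
  have := (hd.analyticOnNhd hopen).eqOn_zero_of_preconnected_of_eventuallyEq_zero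
    (F.isConnected_nonpoles t).isPreconnected ha' hev hu
  exact sub_eq_zero.1 this

/-- On a boundary line only the prevertices at the same height modulo `2m` can be zeros, and these
are separated by their real parts. -/
theorem integrand_ne_zero_of_re {u : ℂ} (hu : u.im = 0 ∨ u.im = -F.m t)
    (hx : ∀ k, (F.z k t).im = u.im ∨ (F.z k t).im = u.im + 2 * F.m t →
      ∀ n : ℤ, u.re ≠ F.x k t + n) : F.integrand t u ≠ 0 := by
  have hm := hf.m_pos ht
  have hp : ¬ F.IsPole t u := hf.not_isPole_of_im ht (by tauto)
  refine hf.integrand_ne_zero ht hp fun k hk => ?_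
  by_cases hk' : (F.z k t).im = u.im ∨ (F.z k t).im = u.im + 2 * F.m t
  · obtain ⟨p, hp⟩ := hk
    refine hx k hk' p.1 ?_
    have := congrArg Complex.re hp
    rw [Complex.sub_re, z_re] at this
    simp [latticePoint, AccessoryParameters.ω₂] at this
    linarith
  · rw [not_or] at hk'
    have hz : (F.z k t).im = 0 ∨ (F.z k t).im = F.m t ∨ (F.z k t).im = -F.m t := by
      rw [z_im]; fin_cases k <;> simp
    refine hf.notMem_Lat_of_im ht ?_ ?_ ?_ hk <;> rw [Complex.sub_im]
    · rcases hu with hu | hu <;> rcases hz with hz | hz | hz <;>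
        first | linarith | exact absurd (by linarith) hk'.2
    · rcases hu with hu | hu <;> rcases hz with hz | hz | hz <;> linarith
    · exact sub_ne_zero.2 (Ne.symm hk'.1)

/-- The slit is nondegenerate, which is needed for its endpoints to determine the reflection. On the
side between the prevertices `f'` does not vanish and keeps its direction up to sign. -/
theorem A_zero_ne_A_one : F.A f 0 t ≠ F.A f 1 t := by
  obtain ⟨M, N, hM, -⟩ := hf.exists_map_conj ht
  obtain ⟨h1, h2, -, -⟩ := hf.x_lt t ht
  have hm := hf.m_pos ht
  have key := ne_of_reflected_deriv (g := fun x : ℝ => f t x) (g' := fun x : ℝ => F.integrand t x)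
    (M := M) h1 (fun x _ => ?_) (fun x _ => ?_) (fun x hx => ?_)
  · simpa [AccessoryParameters.A, AccessoryParameters.z] using key
  · exact (hf.hasDerivAt t ht x (hf.not_isPole_ofReal ht x)).comp_ofReal
  · conv_lhs => rw [← Complex.conj_ofReal x]
    exact hM x
  · refine hf.integrand_ne_zero_of_re ht (by simp) fun k hk n hn => ?_
    rw [Complex.ofReal_re] at hn
    obtain ⟨hx1, hx2⟩ := hx
    rw [z_im, Complex.ofReal_im] at hk
    fin_cases k
    · have a1 : (0 : ℝ) < n := by simp at hn; linarith
      have a2 : (n : ℝ) < 1 := by simp at hn; linarith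
      norm_cast at a1 a2
      lia
    · have a1 : (-1 : ℝ) < n := by simp at hn; linarith
      have a2 : (n : ℝ) < 0 := by simp at hn; linarith
      norm_cast at a1 a2
      lia
    · simp at hk; rcases hk with hk | hk <;> linarith
    · simp at hk; rcases hk with hk | hk <;> linarith

theorem endpoint₃_ne_A_three : F.endpoint₃ f t ≠ F.A f 3 t := by
  obtain ⟨M, N, hM, -⟩ := hf.exists_map_conj ht
  obtain ⟨E, B, hE0, hE, -⟩ := hf.exists_map_add ht
  obtain ⟨-, -, h1, h2⟩ := hf.x_lt t ht
  have hm := hf.m_pos ht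
  -- On the lower line `conj u = u + ω₂`, so the reflection factor `M` is divided by the multiplier
  -- `E` of the second period.
  have key := ne_of_reflected_deriv (g := fun x : ℝ => f t (x + -(F.m t * Complex.I)))
    (g' := fun x : ℝ => F.integrand t (x + -(F.m t * Complex.I)))
    (M := E⁻¹ * M) h1 (fun x _ => ?_) (fun x _ => ?_) (fun x hx => ?_)
  · have e1 : F.endpoint₃ f t = f t (F.x 2 t + -(F.m t * Complex.I)) := by
      simp only [AccessoryParameters.endpoint₃]
      congr 1
      simp [AccessoryParameters.z, AccessoryParameters.ω₂]; ring
    have e2 : F.A f 3 t = f t (F.x 3 t + -(F.m t * Complex.I)) := by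
      simp only [AccessoryParameters.A]
      congr 1
      simp [AccessoryParameters.z]
    rw [e1, e2]
    exact key
  · exact ((hf.hasDerivAt t ht _ (hf.not_isPole_of_im ht (by simp))).comp_add_const
      (x : ℂ) _).comp_ofReal
  · have h3 := hM (x + -(F.m t * Complex.I))
    have e : conj ((x : ℂ) + -(F.m t * Complex.I)) = (x + -(F.m t * Complex.I)) + F.ω₂ t := by
      simp [AccessoryParameters.ω₂]; ring
    rw [e, hE] at h3
    rw [mul_assoc, ← h3, inv_mul_cancel_left₀ hE0]
  · refine hf.integrand_ne_zero_of_re ht (by simp) fun k hk n hn => ?_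
    obtain ⟨hx1, hx2⟩ := hx
    have hre : ((x : ℂ) + -(F.m t * Complex.I)).re = x := by simp
    have him : ((x : ℂ) + -(F.m t * Complex.I)).im = -F.m t := by simp
    rw [hre] at hn
    rw [z_im, him] at hk
    fin_cases k
    · simp at hk; rcases hk with hk | hk <;> linarith
    · simp at hk; rcases hk with hk | hk <;> linarith
    · have a1 : (0 : ℝ) < n := by simp at hn; linarith
      have a2 : (n : ℝ) < 1 := by simp at hn; linarith
      norm_cast at a1 a2
      lia
    · have a1 : (-1 : ℝ) < n := by simp at hn; linarith
      have a2 : (n : ℝ) < 0 := by simp at hn; linarith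
      norm_cast at a1 a2
      lia

omit ht in
/-- The effect of the second period does not depend on time, since it is the composition of the
reflections in the two fixed lines. -/
theorem exists_map_add_fixed : ∃ E B, E ≠ 0 ∧ ∀ t ∈ I, ∀ u, ¬ F.IsPole t u →
    f t (u + F.ω₂ t) = E * f t u + B := by
  obtain ⟨p, q, θ, hl⟩ := hf.lines
  set M₁ := Complex.exp (2 * ((θ + F.β : ℝ) : ℂ) * Complex.I) with hM₁
  set M₂ := Complex.exp (2 * (θ : ℂ) * Complex.I) with hM₂
  set N₁ := p - M₁ * conj p with hN₁
  set N₂ := q - M₂ * conj q with hN₂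
  have h10 : conj M₁ ≠ 0 := (map_ne_zero _).2 (Complex.exp_ne_zero _)
  have h20 : M₂ ≠ 0 := Complex.exp_ne_zero _
  -- These constants solve `f(u) = R₂(R₁(f(u + ω₂)))` for `f(u + ω₂)`, where `R₁` and `R₂` are the
  -- reflections in the two slit lines.
  refine ⟨(M₂ * conj M₁)⁻¹, -((M₂ * conj M₁)⁻¹ * (M₂ * conj N₁ + N₂)),
    inv_ne_zero (mul_ne_zero h20 h10), fun t ht u hu => ?_⟩
  obtain ⟨⟨r₀, e0⟩, ⟨r₁, e1⟩, ⟨r₂, e2⟩, ⟨r₃, e3⟩⟩ := hl t ht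
  obtain ⟨M, N, -, hMN⟩ := hf.exists_map_conj ht
  obtain ⟨E, B, hE0, -, hEB⟩ := hf.exists_map_add ht
  -- The map `u ↦ conj u - ω₂` is the reflection in the lower line `Im u = -m`.
  have hrefl2 : ∀ u, ¬ F.IsPole t u →
      f t (conj u - F.ω₂ t) = E⁻¹ * M * conj (f t u) + E⁻¹ * (N - B) := by
    intro u hu
    have h1 : ¬ F.IsPole t (conj u - F.ω₂ t) := by
      rw [sub_eq_add_neg, F.isPole_add (neg_mem_Lat (tau_mem_Lat _)), F.isPole_conj]
      exact hu
    have h2 := hEB _ h1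
    rw [sub_add_cancel, hMN u hu] at h2
    have h3 : f t (conj u - F.ω₂ t) = E⁻¹ * (E * f t (conj u - F.ω₂ t)) := by
      rw [inv_mul_cancel_left₀ hE0]
    rw [h3]
    linear_combination -E⁻¹ * h2
  have hz : ∀ k, conj (F.z k t) = F.z k t → F.A f k t = M * conj (F.A f k t) + N := by
    intro k hk
    have := hMN _ (hf.not_isPole_z ht k)
    rwa [hk] at this
  have R1 := reflection_of_fixed_points (p := p) (α := θ + F.β)
    (hz 0 (by simp [AccessoryParameters.z])) (hz 1 (by simp [AccessoryParameters.z]))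
    (hf.A_zero_ne_A_one ht) (by rw [e0]; push_cast; rfl) (by rw [e1]; push_cast; rfl)
  have h5 : ¬ F.IsPole t (F.z 2 t - F.ω₂ t) := by
    rw [sub_eq_add_neg, F.isPole_add (neg_mem_Lat (tau_mem_Lat _))]
    exact hf.not_isPole_z ht 2
  have f2 := hrefl2 _ h5
  have c2 : conj (F.z 2 t - F.ω₂ t) - F.ω₂ t = F.z 2 t - F.ω₂ t := by
    simp [AccessoryParameters.z, AccessoryParameters.ω₂, Complex.conj_ofNat]; ring
  rw [c2] at f2
  have f3 := hrefl2 _ (hf.not_isPole_z ht 3)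
  have c3 : conj (F.z 3 t) - F.ω₂ t = F.z 3 t := by
    simp [AccessoryParameters.z, AccessoryParameters.ω₂]; ring
  rw [c3] at f3
  -- Both endpoints of the second slit come from points fixed by the reflection in the lower line,
  -- so they are fixed points on the image side.
  have R2 := reflection_of_fixed_points (p := q) (α := θ) f2 f3 (hf.endpoint₃_ne_A_three ht) e2 e3
  have h6 : ¬ F.IsPole t (u + F.ω₂ t) := by rwa [F.isPole_add (tau_mem_Lat _)]
  have g1 := hMN _ h6
  have g2 := hrefl2 (conj (u + F.ω₂ t)) (by rwa [F.isPole_conj])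
  rw [Complex.conj_conj, add_sub_cancel_right, g1, R2.1, R2.2, R1.2, R1.1] at g2
  simp only [map_add, map_mul, Complex.conj_conj] at g2
  have g3 : f t u = M₂ * conj M₁ * f t (u + F.ω₂ t) + (M₂ * conj N₁ + N₂) := by
    rw [g2]
    ring
  rw [g3]
  field_simp
  ring

theorem integrand_add_one {u : ℂ} (hu : ¬ F.IsPole t u) :
    F.integrand t (u + 1) = F.integrand t u := by
  have hu1 : ¬ F.IsPole t (u + 1) := by rwa [F.isPole_add (one_mem_Lat _)]
  have h1 := (hf.hasDerivAt t ht _ hu1).comp_add_const u 1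
  have h2 : (fun u => f t (u + 1)) =ᶠ[𝓝 u] f t := by
    filter_upwards [(hf.isOpen_nonpoles ht).mem_nhds hu] with v hv using hf.map_add_one ht hv
  exact (h1.congr_of_eventuallyEq h2.symm).unique (hf.hasDerivAt t ht u hu)

theorem deriv_time_add_one (hI : IsOpen I) {u : ℂ} (hu : ¬ F.IsPole t u) :
    deriv (fun s => f s (u + 1)) t = deriv (fun s => f s u) t := by
  refine Filter.EventuallyEq.deriv_eq ?_
  have hc : ContinuousAt (fun s : ℝ => (u, s)) t := by fun_prop
  filter_upwards [hc.eventually (hf.eventually_not_isPole ht hI hu)] with s hs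
  exact hf.map_add_one hs.1 hs.2

omit ht in
-- Both identities are derivatives, in `u` and in `t`, of `f(u + ω₂) = E f(u) + B` with constant `E`
-- and `B`; the extra term in the second comes from the moving period.
theorem exists_functional_equation (hI : IsOpen I) : ∃ E, E ≠ 0 ∧ ∀ t ∈ I, ∀ u, ¬ F.IsPole t u →
    F.integrand t (u + F.ω₂ t) = E * F.integrand t u ∧
    F.integrand t (u + F.ω₂ t) * deriv F.ω₂ t + deriv (fun s => f s (u + F.ω₂ t)) t =
      E * deriv (fun s => f s u) t := by
  obtain ⟨E, B, hE0, hEB⟩ := hf.exists_map_add_fixed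
  refine ⟨E, hE0, fun t ht u hu => ?_⟩
  have hu1 : ¬ F.IsPole t (u + F.ω₂ t) := by rwa [F.isPole_add (tau_mem_Lat _)]
  constructor
  · have h1 := (hf.hasDerivAt t ht _ hu1).comp_add_const u (F.ω₂ t)
    have h2 : (fun v => f t (v + F.ω₂ t)) =ᶠ[𝓝 u] fun v => E * f t v + B := by
      filter_upwards [(hf.isOpen_nonpoles ht).mem_nhds hu] with v hv using hEB t ht v hv
    exact (h1.congr_of_eventuallyEq h2.symm).unique
      (((hf.hasDerivAt t ht u hu).const_mul E).add_const B)
  · have h1 := hf.hasDerivAt_comp_time ht hI ((hf.hasDerivAt_ω₂ ht hI).const_add u) hu1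
    have hc : ContinuousAt (fun s : ℝ => (u, s)) t := by fun_prop
    have h2 : (fun s => f s (u + F.ω₂ s)) =ᶠ[𝓝 t] fun s => E * f s u + B := by
      filter_upwards [hc.eventually (hf.eventually_not_isPole ht hI hu)] with s hs
      exact hEB s hs.1 u hs.2
    exact (h1.congr_of_eventuallyEq h2.symm).unique
      (((hf.hasDerivAt_deriv_time ht hI hu).1.const_mul E).add_const B)

end IsSlitFamily

/-! ### The quotient of the time derivative and of the derivative of the mapping -/

/-- The lattice is discrete: the zero of `σ` at the origin is isolated because `sigmaReg` equals `1`
there. -/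
theorem eventually_notMem_Lat {τ : ℂ} (hτ : 0 < τ.im) (s a : ℂ) :
    ∀ᶠ z in 𝓝[≠] s, z - a ∉ Lat τ := by
  by_cases hs : s - a ∈ Lat τ
  · have h1 : ∀ᶠ z in 𝓝 s, sigmaReg τ (z - s) ≠ 0 := by
      have hc : ContinuousAt (fun z => sigmaReg τ (z - s)) s :=
        ((differentiable_sigmaReg hτ).continuous.comp (continuous_id.sub continuous_const)).continuousAt
      refine hc.eventually_ne ?_
      rw [sub_self, sigmaReg_zero]; exact one_ne_zero
    filter_upwards [mem_nhdsWithin_of_mem_nhds h1, self_mem_nhdsWithin] with z hz hzs h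
    have h2 : z - s ∈ Lat τ := by
      have := add_mem_Lat h (neg_mem_Lat hs)
      rwa [show z - a + -(s - a) = z - s by ring] at this
    have h3 := (sigma_eq_zero_iff hτ).2 h2
    rw [sigma_eq, mul_eq_zero] at h3
    exact h3.elim (fun h => hzs (sub_eq_zero.1 h)) hz
  · refine mem_nhdsWithin_of_mem_nhds ?_
    have hc : ContinuousAt (fun z : ℂ => z - a) s := by fun_prop
    exact hc ((isOpen_compl_Lat hτ).mem_nhds hs)

/-- Quasi-periodicity with respect to the generators implies quasi-periodicity with respect to the
lattice. -/
theorem exists_add_lattice {K : ℂ → ℂ} {S : Set ℂ} {τ C : ℂ} (hS1 : ∀ z, z + 1 ∈ S ↔ z ∈ S)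
    (hSτ : ∀ z, z + τ ∈ S ↔ z ∈ S) (h1 : ∀ z ∉ S, K (z + 1) = K z)
    (h2 : ∀ z ∉ S, K (z + τ) = K z + C) {w : ℂ} (hw : w ∈ Lat τ) :
    ∃ c, ∀ z ∉ S, K (z + w) = K z + c := by
  -- The shifts that preserve `S` and change `K` by a constant form a subgroup, so it suffices that
  -- it contains both generators.
  let G : AddSubgroup ℂ :=
    { carrier := {w | (∀ z, z + w ∈ S ↔ z ∈ S) ∧ ∃ c, ∀ z ∉ S, K (z + w) = K z + c}
      zero_mem' := ⟨by simp, 0, by simp⟩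
      add_mem' := by
        rintro v w ⟨hv, c, hc⟩ ⟨hw, d, hd⟩
        refine ⟨fun z => by rw [← add_assoc, hw, hv], c + d, fun z hz => ?_⟩
        rw [← add_assoc, hd _ (fun h => hz ((hv z).1 h)), hc z hz]; ring
      neg_mem' := by
        rintro v ⟨hv, c, hc⟩
        have h3 : ∀ z, z + -v ∈ S ↔ z ∈ S := fun z => by
          rw [← hv (z + -v), neg_add_cancel_right]
        refine ⟨h3, -c, fun z hz => ?_⟩
        have := hc _ (fun h => hz ((h3 z).1 h))
        rw [neg_add_cancel_right] at this
        rw [this]; ring }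
  obtain ⟨p, rfl⟩ := hw
  have m1 : (1 : ℂ) ∈ G := ⟨hS1, 0, fun z hz => by rw [h1 z hz, add_zero]⟩
  have m2 : τ ∈ G := ⟨hSτ, C, h2⟩
  have : latticePoint 1 τ p ∈ G := by
    have := add_mem (zsmul_mem m1 p.1) (zsmul_mem m2 p.2)
    simpa [latticePoint] using this
  exact this.2

/-- The time derivative of the mapping. -/
def mapDot (f : ℝ → ℂ → ℂ) (t : ℝ) (u : ℂ) : ℂ := deriv (fun s => f s u) t

/-- The expression of the quotient of the time derivative of the mapping and of its derivative
in terms of the function `ζ`. -/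
def velocity (F : AccessoryParameters) (f : ℝ → ℂ → ℂ) (t : ℝ) (u : ℂ) : ℂ :=
  -deriv F.z₀ t + ∑ j, F.γk f j t *
    (F.ζ t (u - F.z j t) - F.ζ t (F.z₀ t - F.z j t) - F.η₁ t * (u - F.z₀ t))

/-- The points congruent to the zeros and to the poles of the integrand. -/
def singularSet (F : AccessoryParameters) (t : ℝ) : Set ℂ :=
  {u | F.IsPole t u ∨ ∃ k, u - F.z k t ∈ Lat (F.ω₂ t)}

namespace IsSlitFamily

variable {F : AccessoryParameters} {f : ℝ → ℂ → ℂ} {I : Set ℝ} (hf : IsSlitFamily F f I)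
  {t : ℝ} (ht : t ∈ I)

include hf ht

omit hf ht in
theorem singularSet_add {F : AccessoryParameters} {t : ℝ} {w : ℂ} (hw : w ∈ Lat (F.ω₂ t)) (z : ℂ) :
    z + w ∈ singularSet F t ↔ z ∈ singularSet F t := by
  simp only [singularSet, mem_ofPred_eq, F.isPole_add hw]
  refine or_congr Iff.rfl (exists_congr fun k => ?_)
  rw [add_sub_right_comm, add_mem_Lat_iff hw]

theorem eventually_not_isPole_punctured (s : ℂ) : ∀ᶠ z in 𝓝[≠] s, ¬ F.IsPole t z := by
  filter_upwards [eventually_notMem_Lat (hf.ω₂_im_pos ht) s (F.z₀ t),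
    eventually_notMem_Lat (hf.ω₂_im_pos ht) s (conj (F.z₀ t))] with z h1 h2
  rw [F.isPole_iff, not_or]
  exact ⟨h1, h2⟩

theorem eventually_notMem_singularSet (s : ℂ) : ∀ᶠ z in 𝓝[≠] s, z ∉ singularSet F t := by
  filter_upwards [hf.eventually_not_isPole_punctured ht s, eventually_all.2 fun k =>
    eventually_notMem_Lat (hf.ω₂_im_pos ht) s (F.z k t)] with z h1 h2
  rintro (h | ⟨k, hk⟩)
  exacts [h1 h, h2 k hk]

/-- The expansion of the time derivative of the mapping at a moving double pole of the
integrand. -/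
theorem mapDot_expansion (hI : IsOpen I) {Ψ : ℂ × ParamSpace → ℂ} {a : ℝ → ℂ} {a' : ℂ}
    (hΨ : ContDiffAt ℂ 2 Ψ (a t, F.params t))
    (heq : ∀ u s, F.Φ (u, F.params s) = Ψ (u, F.params s) / (u - a s) ^ 2)
    (ha : HasDerivAt a a' t) :
    deriv (fun z => Ψ (z, F.params t)) (a t) = 0 ∧ ∃ Q : ℂ → ℂ, AnalyticAt ℂ Q (a t) ∧
      ∀ᶠ z in 𝓝[≠] (a t), (z - a t) ^ 2 * mapDot f t z = -a' * Ψ (a t, F.params t) -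
        timeDeriv Ψ F.params (a t) t * (z - a t) + (z - a t) ^ 2 * Q z := by
  have hd := hf.differentiableAt_params ht hI
  have hev : ∀ᶠ z in 𝓝 (a t), ContDiffAt ℂ 2 Ψ (z, F.params t) := by
    have hc : ContinuousAt (fun z => (z, F.params t)) (a t) := by fun_prop
    exact hc.eventually (hΨ.eventually (by simp))
  have he : AnalyticAt ℂ (fun z => Ψ (z, F.params t)) (a t) :=
    Complex.analyticAt_iff_eventually_differentiableAt.2
      (hev.mono fun z hz => differentiableAt_left hz)
  have he' : AnalyticAt ℂ (fun z => timeDeriv Ψ F.params z t) (a t) :=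
    Complex.analyticAt_iff_eventually_differentiableAt.2
      (hev.mono fun z hz => differentiableAt_timeDeriv hz)
  have hpole := hf.eventually_not_isPole_punctured ht (a t)
  have h0 : deriv (fun z => Ψ (z, F.params t)) (a t) = 0 := by
    refine deriv_eq_zero_of_primitive_div_sq (f := f t) he ?_
    filter_upwards [hpole] with z hz
    rw [← heq]
    exact hf.hasDerivAt t ht z hz
  refine ⟨h0, ?_⟩
  -- Numerator of the time derivative of `Ψ / (z - a)²` over the denominator `(z - a)³`; the second
  -- term comes from the motion of the pole.
  set N : ℂ → ℂ := fun z => (z - a t) * timeDeriv Ψ F.params z t + 2 * a' * Ψ (z, F.params t)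
    with hN
  have hNa : AnalyticAt ℂ N (a t) :=
    ((analyticAt_id.sub analyticAt_const).mul he').add (analyticAt_const.mul he)
  have hN0 : N (a t) = 2 * a' * Ψ (a t, F.params t) := by simp [hN]
  -- The contribution `2 a' Ψ'` drops out because `f'` has no residue at the pole.
  have hN1 : deriv N (a t) = timeDeriv Ψ F.params (a t) t := by
    have h1 := (((hasDerivAt_id (a t)).sub_const (a t)).fun_mul
      he'.differentiableAt.hasDerivAt).fun_add (he.differentiableAt.hasDerivAt.const_mul (2 * a'))
    have h2 := h1.deriv
    rw [h0] at h2
    simpa using h2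
  obtain ⟨Q, hQ, hQ'⟩ := exists_eq_of_deriv_eq_div_cube (ψ := mapDot f t) hNa (by
    filter_upwards [hpole, mem_nhdsWithin_of_mem_nhds hev, self_mem_nhdsWithin] with z hz hz' hza
    have hza0 : z - a t ≠ 0 := sub_ne_zero.2 hza
    refine (hf.hasDerivAt_deriv_time ht hI hz).2.congr_deriv ?_
    have h1 := hasDerivAt_timeDeriv (hf.contDiffAt_Φ ht hz) hd
    have h2 := (hasDerivAt_timeDeriv hz' hd).fun_div ((ha.const_sub z).fun_pow 2)
      (pow_ne_zero 2 hza0)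
    simp only [← heq] at h2
    rw [h1.unique h2, hN]
    field_simp
    push_cast
    ring)
  refine ⟨Q, hQ, hQ'.mono fun z hz => ?_⟩
  rw [hz, hN0, hN1]
  ring

theorem hasDerivAt_ζ {u : ℂ} (hu : u ∉ Lat (F.ω₂ t)) : HasDerivAt (F.ζ t) (-F.P t u) u :=
  hasDerivAt_zeta (hf.ω₂_im_pos ht) (hf.sigma_ne_zero ht hu)

theorem hasDerivAt_velocity {u : ℂ} (hu : ∀ k, u - F.z k t ∉ Lat (F.ω₂ t)) :
    HasDerivAt (velocity F f t)
      (∑ j, F.γk f j t * (-F.P t (u - F.z j t) - F.η₁ t)) u := by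
  refine HasDerivAt.const_add _ (HasDerivAt.fun_sum fun j _ => HasDerivAt.const_mul _ ?_)
  refine ((((hf.hasDerivAt_ζ ht (hu j)).comp_sub_const u (F.z j t)).sub_const _).fun_sub
    (((hasDerivAt_id u).sub_const _).const_mul _)).congr_deriv ?_
  rw [mul_one]

omit hf ht in
theorem velocity_z₀ (F : AccessoryParameters) (f : ℝ → ℂ → ℂ) (t : ℝ) :
    velocity F f t (F.z₀ t) = -deriv F.z₀ t := by
  simp [velocity]

/-- The part of `velocity` that is regular at `z_l`. -/
def velocityReg (F : AccessoryParameters) (f : ℝ → ℂ → ℂ) (t : ℝ) (l : Fin 4) (u : ℂ) : ℂ :=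
  -deriv F.z₀ t + ∑ j ∈ Finset.univ.erase l, F.γk f j t *
    (F.ζ t (u - F.z j t) - F.ζ t (F.z₀ t - F.z j t) - F.η₁ t * (u - F.z₀ t)) +
  F.γk f l t * (zetaReg (F.ω₂ t) (u - F.z l t) - F.ζ t (F.z₀ t - F.z l t) -
    F.η₁ t * (u - F.z₀ t))

omit hf ht in
theorem velocity_eq (F : AccessoryParameters) (f : ℝ → ℂ → ℂ) (t : ℝ) (l : Fin 4) (u : ℂ) :
    velocity F f t u = F.γk f l t * (1 / (u - F.z l t)) + velocityReg F f t l u := by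
  unfold velocity velocityReg
  rw [← Finset.add_sum_erase _ _ (Finset.mem_univ l)]
  rw [show F.ζ t (u - F.z l t) = 1 / (u - F.z l t) + zetaReg (F.ω₂ t) (u - F.z l t) from rfl]
  ring

theorem differentiableAt_velocityReg (l : Fin 4) :
    DifferentiableAt ℂ (velocityReg F f t l) (F.z l t) := by
  have h1 : ∀ j ∈ Finset.univ.erase l, DifferentiableAt ℂ (fun u => F.ζ t (u - F.z j t))
      (F.z l t) := fun j hj =>
    ((hf.hasDerivAt_ζ ht (hf.z_sub_z_notMem' ht (Finset.ne_of_mem_erase hj))).comp_sub_const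
      (F.z l t) (F.z j t)).differentiableAt
  have h2 : DifferentiableAt ℂ (fun u => zetaReg (F.ω₂ t) (u - F.z l t)) (F.z l t) := by
    have h3 := hasDerivAt_zetaReg (z := F.z l t - F.z l t) (hf.ω₂_im_pos ht)
      (by rw [sub_self, sigmaReg_zero]; exact one_ne_zero)
    exact (h3.comp_sub_const (F.z l t) (F.z l t)).differentiableAt
  unfold velocityReg
  refine DifferentiableAt.add (DifferentiableAt.add (by fun_prop)
    (DifferentiableAt.fun_sum fun j hj => ?_)) ?_
  · exact (((h1 j hj).sub_const _).sub (by fun_prop)).const_mul _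
  · exact ((h2.sub_const _).sub (by fun_prop)).const_mul _

theorem γk_eq (hI : IsOpen I) (k : Fin 4) :
    F.γk f k t = mapDot f t (F.z k t) / F.D k t := by
  rw [AccessoryParameters.γk, (hf.hasDerivAt_A ht hI k).deriv, mapDot]

theorem continuousAt_mapDot (hI : IsOpen I) {u : ℂ} (hu : ¬ F.IsPole t u) :
    ContinuousAt (mapDot f t) u := (hf.hasDerivAt_deriv_time ht hI hu).2.continuousAt

/-- The difference that vanishes identically. -/
def defect (F : AccessoryParameters) (f : ℝ → ℂ → ℂ) (t : ℝ) (u : ℂ) : ℂ :=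
  mapDot f t u / F.integrand t u - velocity F f t u

/-- Dividing by the simple zero of `f'` gives the quotient the residue `mapDot / D`, which is `γ_l`,
the same as that of `velocity`. -/
theorem tendsto_defect_z (hI : IsOpen I) (l : Fin 4) :
    Tendsto (fun u => (u - F.z l t) * defect F f t u) (𝓝[≠] (F.z l t)) (𝓝 0) := by
  have hD : F.Φz l (F.z l t, F.params t) ≠ 0 := by rw [← F.D_eq]; exact hf.D_ne_zero ht l
  have hΦ := hf.contDiffAt_Φz ht l (hf.not_isPole_z ht l)
  have hc1 : ContinuousAt (fun u => mapDot f t u / F.Φz l (u, F.params t) -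
      (F.γk f l t + (u - F.z l t) * velocityReg F f t l u)) (F.z l t) :=
    ((hf.continuousAt_mapDot ht hI (hf.not_isPole_z ht l)).div
      (differentiableAt_left hΦ).continuousAt hD).sub
      (continuousAt_const.add ((continuousAt_id.sub continuousAt_const).mul
        (hf.differentiableAt_velocityReg ht l).continuousAt))
  have h1 := hc1.tendsto.mono_left (nhdsWithin_le_nhds (s := {F.z l t}ᶜ))
  rw [hf.γk_eq ht hI, F.D_eq, sub_self, zero_mul, add_zero, sub_self] at h1
  refine h1.congr' ?_
  filter_upwards [self_mem_nhdsWithin] with u hu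
  have hu0 : u - F.z l t ≠ 0 := sub_ne_zero.2 hu
  rw [defect, velocity_eq F f t l, F.integrand_eq, F.Φ_eq_mul l, hf.γk_eq ht hI, F.D_eq]
  rw [mul_sub, mul_add, mul_div_assoc', mul_div_mul_left _ _ hu0]
  field_simp

/-- To leading order `f` is `-Ψ(a) / (z - a)`, so moving the pole contributes `-a' Ψ(a) / (z - a)²`,
while `f'` is `Ψ / (z - a)²`. -/
theorem tendsto_quotient_pole (hI : IsOpen I) {Ψ : ℂ × ParamSpace → ℂ} {a : ℝ → ℂ} {a' : ℂ}
    (hΨ : ContDiffAt ℂ 2 Ψ (a t, F.params t)) (hΨ0 : Ψ (a t, F.params t) ≠ 0)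
    (heq : ∀ u s, F.Φ (u, F.params s) = Ψ (u, F.params s) / (u - a s) ^ 2)
    (ha : HasDerivAt a a' t) :
    Tendsto (fun u => mapDot f t u / F.integrand t u) (𝓝[≠] (a t)) (𝓝 (-a')) := by
  obtain ⟨-, Q, hQ, hQ'⟩ := hf.mapDot_expansion ht hI hΨ heq ha
  have hc : ContinuousAt (fun z => (-a' * Ψ (a t, F.params t) -
      timeDeriv Ψ F.params (a t) t * (z - a t) + (z - a t) ^ 2 * Q z) / Ψ (z, F.params t)) (a t) := by
    have := hQ.continuousAt
    exact ContinuousAt.div (by fun_prop) (differentiableAt_left hΨ).continuousAt hΨ0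
  have h1 := hc.tendsto.mono_left (nhdsWithin_le_nhds (s := {a t}ᶜ))
  simp only [sub_self, mul_zero, sub_zero, ne_eq, OfNat.ofNat_ne_zero, not_false_eq_true,
    zero_pow, zero_mul, add_zero, mul_div_assoc, div_self hΨ0, mul_one] at h1
  refine h1.congr' ?_
  filter_upwards [hQ', self_mem_nhdsWithin] with z hz hza
  have hza0 : z - a t ≠ 0 := sub_ne_zero.2 hza
  rw [← hz, F.integrand_eq, heq, div_div_eq_mul_div, mul_comm (mapDot f t z)]

theorem tendsto_defect_z₀ (hI : IsOpen I) :
    Tendsto (defect F f t) (𝓝[≠] (F.z₀ t)) (𝓝 0) := by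
  have h1 := hf.tendsto_quotient_pole ht hI (hf.contDiffAt_Φa ht) (hf.Φa_ne_zero ht)
    F.Φ_eq_div_left (hf.hasDerivAt_z₀ ht hI)
  have h2 := (hf.hasDerivAt_velocity (f := f) ht
    (fun k => hf.z₀_sub_z_notMem ht k)).continuousAt.tendsto.mono_left
    (nhdsWithin_le_nhds (s := {F.z₀ t}ᶜ))
  rw [velocity_z₀] at h2
  have h3 := h1.sub h2
  rwa [sub_self] at h3

/-- Only the existence of the limit matters: `velocity` is normalised at `z₀`, so agreement at the
conjugate pole is not visible beforehand. -/
theorem exists_tendsto_defect_conj_z₀ (hI : IsOpen I) :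
    ∃ y, Tendsto (defect F f t) (𝓝[≠] (conj (F.z₀ t))) (𝓝 y) := by
  have hd : HasDerivAt (fun s => conj (F.z₀ s)) (conj (deriv F.z₀ t)) t :=
    (Complex.conjCLE.toContinuousLinearMap.hasFDerivAt).comp_hasDerivAt t (hf.hasDerivAt_z₀ ht hI)
  have h1 := hf.tendsto_quotient_pole ht hI (a := fun s => conj (F.z₀ s)) (hf.contDiffAt_Φb ht)
    (hf.Φb_ne_zero ht) F.Φ_eq_div_right hd
  have h2 := (hf.hasDerivAt_velocity (f := f) ht
    (fun k => hf.conj_z₀_sub_z_notMem ht k)).continuousAt.tendsto.mono_left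
    (nhdsWithin_le_nhds (s := {conj (F.z₀ t)}ᶜ))
  exact ⟨_, h1.sub h2⟩

/-- The linear terms with `η₁` are there to cancel the increments of `ζ`. -/
theorem velocity_add_one {u : ℂ} (hu : ∀ k, u - F.z k t ∉ Lat (F.ω₂ t)) :
    velocity F f t (u + 1) = velocity F f t u := by
  unfold velocity
  congr 1
  refine Finset.sum_congr rfl fun j _ => ?_
  have h := zeta_add_one (hf.ω₂_im_pos ht) (hu j)
  rw [add_sub_right_comm]
  change _ * (zeta 1 (F.ω₂ t) _ - _ - _) = _
  rw [h]
  simp only [AccessoryParameters.η₁, AccessoryParameters.ζ]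
  ring

theorem exists_velocity_add : ∃ C, ∀ u, (∀ k, u - F.z k t ∉ Lat (F.ω₂ t)) →
    velocity F f t (u + F.ω₂ t) = velocity F f t u + C := by
  obtain ⟨η, hη⟩ := exists_zeta_add (hf.ω₂_im_pos ht) (tau_mem_Lat (F.ω₂ t))
  refine ⟨∑ j, F.γk f j t * (η - F.η₁ t * F.ω₂ t), fun u hu => ?_⟩
  unfold velocity
  rw [add_assoc, ← Finset.sum_add_distrib]
  congr 1
  refine Finset.sum_congr rfl fun j _ => ?_
  rw [add_sub_right_comm]
  change _ * (zeta 1 (F.ω₂ t) _ - _ - _) = _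
  rw [hη _ (hu j)]
  simp only [AccessoryParameters.ζ]
  ring

omit hf ht in
theorem notMem_singularSet {F : AccessoryParameters} {t : ℝ} {u : ℂ} (hu : u ∉ singularSet F t) :
    ¬ F.IsPole t u ∧ ∀ k, u - F.z k t ∉ Lat (F.ω₂ t) := by
  simp only [singularSet, mem_ofPred_eq, not_or, not_exists] at hu
  exact hu

theorem differentiableAt_integrand {u : ℂ} (hu : ¬ F.IsPole t u) :
    DifferentiableAt ℂ (F.integrand t) u := by
  have h := differentiableAt_left (hf.contDiffAt_Φ ht hu)
  simp only [← F.integrand_eq] at h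
  exact h

/-- The defect has only removable singularities, period `1` and a constant increment under `ω₂`. It
is therefore constant, and its limit at `z₀` makes the constant zero. -/
theorem mapDot_eq (hI : IsOpen I) {u : ℂ} (hu : u ∉ singularSet F t) :
    mapDot f t u = F.integrand t u * velocity F f t u := by
  have hτ := hf.ω₂_im_pos ht
  obtain ⟨E, hE0, hE⟩ := hf.exists_functional_equation hI
  obtain ⟨C, hC⟩ := hf.exists_velocity_add (f := f) ht
  have hint : ∀ u ∉ singularSet F t, F.integrand t u ≠ 0 := fun u hu =>
    hf.integrand_ne_zero ht (notMem_singularSet hu).1 (notMem_singularSet hu).2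
  have hd : ∀ z ∉ singularSet F t, DifferentiableAt ℂ (defect F f t) z := by
    intro z hz
    obtain ⟨h1, h2⟩ := notMem_singularSet hz
    have hm : DifferentiableAt ℂ (mapDot f t) z :=
      (hf.hasDerivAt_deriv_time ht hI h1).2.differentiableAt
    have hi : DifferentiableAt ℂ (F.integrand t) z := hf.differentiableAt_integrand ht h1
    unfold defect
    exact (hm.fun_div hi (hint z hz)).fun_sub (hf.hasDerivAt_velocity ht h2).differentiableAt
  have h1 : ∀ z ∉ singularSet F t, defect F f t (z + 1) = defect F f t z := by
    intro z hz
    obtain ⟨h1, h2⟩ := notMem_singularSet hz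
    rw [defect, defect, hf.velocity_add_one ht h2, hf.integrand_add_one ht h1, mapDot, mapDot,
      hf.deriv_time_add_one ht hI h1]
  have h2 : ∀ z ∉ singularSet F t,
      defect F f t (z + F.ω₂ t) = defect F f t z + (-deriv F.ω₂ t - C) := by
    intro z hz
    obtain ⟨h1, h2⟩ := notMem_singularSet hz
    obtain ⟨e1, e2⟩ := hE t ht z h1
    have h0 := hint z hz
    rw [defect, defect, hC z h2, mapDot, mapDot, e1]
    rw [e1] at e2
    rw [eq_sub_of_add_eq' e2]
    field_simp
    ring
  have hlim : ∀ s ∈ singularSet F t,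
      Tendsto (fun z => (z - s) * defect F f t z) (𝓝[≠] s) (𝓝 0) := by
    -- Lattice translations change the defect by constants, so only one representative of each class
    -- of singularities has to be examined.
    have shift : ∀ a w, w ∈ Lat (F.ω₂ t) →
        Tendsto (fun z => (z - a) * defect F f t z) (𝓝[≠] a) (𝓝 0) →
        Tendsto (fun z => (z - (a + w)) * defect F f t z) (𝓝[≠] (a + w)) (𝓝 0) := by
      intro a w hw h
      obtain ⟨c, hc⟩ := exists_add_lattice (fun z => singularSet_add (one_mem_Lat _) z)
        (fun z => singularSet_add (tau_mem_Lat _) z) h1 h2 hw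
      have h3 : Tendsto (fun z => (z - a) * (defect F f t z + c)) (𝓝[≠] a) (𝓝 0) := by
        have h4 : ContinuousAt (fun z => (z - a) * c) a := by fun_prop
        have h5 := h.add (h4.tendsto.mono_left (nhdsWithin_le_nhds (s := {a}ᶜ)))
        simpa [mul_add] using h5
      have ht' : Tendsto (fun z => z - w) (𝓝[≠] (a + w)) (𝓝[≠] a) := by
        refine tendsto_nhdsWithin_of_tendsto_nhds_of_eventually_within _ ?_ ?_
        · have : ContinuousAt (fun z : ℂ => z - w) (a + w) := by fun_prop
          have h6 := this.tendsto.mono_left (nhdsWithin_le_nhds (s := {a + w}ᶜ))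
          rwa [add_sub_cancel_right] at h6
        · filter_upwards [self_mem_nhdsWithin] with z hz h
          exact hz (sub_eq_iff_eq_add.1 h)
      refine (h3.comp ht').congr' ?_
      filter_upwards [ht'.eventually (hf.eventually_notMem_singularSet ht a)] with z hz
      have := hc _ hz
      rw [sub_add_cancel] at this
      simp only [Function.comp_apply]
      rw [this]; ring
    have bdd : ∀ a y, Tendsto (defect F f t) (𝓝[≠] a) (𝓝 y) →
        Tendsto (fun z => (z - a) * defect F f t z) (𝓝[≠] a) (𝓝 0) := by
      intro a y h
      have h4 : ContinuousAt (fun z : ℂ => z - a) a := by fun_prop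
      simpa using (h4.tendsto.mono_left (nhdsWithin_le_nhds (s := {a}ᶜ))).mul h
    rintro s (hs | ⟨k, hk⟩)
    · rcases (F.isPole_iff t s).1 hs with h | h
      · have := shift _ _ h (bdd _ _ (hf.tendsto_defect_z₀ ht hI))
        rwa [add_sub_cancel] at this
      · obtain ⟨y, hy⟩ := hf.exists_tendsto_defect_conj_z₀ ht hI
        have := shift _ _ h (bdd _ _ hy)
        rwa [add_sub_cancel] at this
    · have := shift _ _ hk (hf.tendsto_defect_z ht hI k)
      rwa [add_sub_cancel] at this
  obtain ⟨c, hc⟩ := const_of_quasiperiodic hτ hd (hf.eventually_notMem_singularSet ht) hlim h1 h2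
  have hc0 : c = 0 := by
    refine tendsto_nhds_unique (f := defect F f t) (l := 𝓝[≠] (F.z₀ t)) ?_
      (hf.tendsto_defect_z₀ ht hI)
    refine tendsto_const_nhds.congr' ?_
    filter_upwards [hf.eventually_notMem_singularSet ht (F.z₀ t)] with z hz using (hc z hz).symm
  have := hc u hu
  rw [hc0, defect, sub_eq_zero, div_eq_iff (hint u hu)] at this
  rw [this, mul_comm]

end IsSlitFamily

/-! ### Continuous branches of the logarithm along an interval -/

/-- Integrating `r' / r` from a base point gives the branch: `r exp(-a)` has zero derivative and
equals `1` at the base point. -/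
theorem exists_continuousOn_log {r : ℝ → ℂ} {I : Set ℝ} (hI : IsOpen I) (hI' : I.OrdConnected)
    (hr : ContDiffOn ℝ 1 r I) (h0 : ∀ t ∈ I, r t ≠ 0) :
    ∃ a : ℝ → ℂ, ContinuousOn a I ∧ ∀ t ∈ I, Complex.exp (a t) = r t := by
  rcases I.eq_empty_or_nonempty with rfl | ⟨t₀, ht₀⟩
  · exact ⟨0, by simp, by simp⟩
  set g : ℝ → ℂ := fun s => deriv r s / r s
  have hg : ContinuousOn g I := (hr.continuousOn_deriv_of_isOpen hI le_rfl).div hr.continuousOn h0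
  set a : ℝ → ℂ := fun t => Complex.log (r t₀) + ∫ s in t₀..t, g s with ha
  have hd : ∀ t ∈ I, HasDerivAt a (g t) t := fun t ht =>
    (intervalIntegral.integral_hasDerivAt_right
      (hg.mono (hI'.uIcc_subset ht₀ ht)).intervalIntegrable
      (hg.stronglyMeasurableAtFilter hI t ht) (hg.continuousAt (hI.mem_nhds ht))).const_add _
  refine ⟨a, fun t ht => (hd t ht).continuousAt.continuousWithinAt, fun t ht => ?_⟩
  have hq : ∀ t ∈ I, HasDerivAt (fun s => r s * Complex.exp (-a s)) 0 t := by
    intro t ht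
    have h1 := ((hr.contDiffAt (hI.mem_nhds ht)).differentiableAt one_ne_zero).hasDerivAt
    refine (h1.fun_mul (hd t ht).fun_neg.cexp).congr_deriv ?_
    have := h0 t ht
    simp only [g]
    field_simp
    ring
  obtain ⟨c, hc⟩ := hI.exists_is_const_of_deriv_eq_zero hI'.isPreconnected
    (fun t ht => (hq t ht).differentiableAt.differentiableWithinAt) (fun t ht => (hq t ht).deriv)
  have h1 : c = 1 := by
    rw [← hc t₀ ht₀]
    simp only [ha, intervalIntegral.integral_same, add_zero]
    rw [Complex.exp_neg, Complex.exp_log (h0 t₀ ht₀), mul_inv_cancel₀ (h0 t₀ ht₀)]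
  have h2 := hc t ht
  simp only [h1, Complex.exp_neg] at h2
  exact ((mul_inv_eq_one₀ (Complex.exp_ne_zero _)).1 h2).symm

/-- Near `t` the branch is `a t` plus the principal logarithm of `r s * exp(-a t)`, a quantity close
to `1`; continuity of `a` keeps the imaginary part within `(-π, π)`. -/
theorem hasDerivAt_of_exp_eq {a r : ℝ → ℂ} {r' : ℂ} {t : ℝ} (ha : ContinuousAt a t)
    (hr : HasDerivAt r r' t) (h : ∀ᶠ s in 𝓝 t, Complex.exp (a s) = r s) :
    HasDerivAt a (r' / r t) t := by
  have h0 : Complex.exp (a t) = r t := h.self_of_nhds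
  have h1 : r t * Complex.exp (-a t) = 1 := by
    rw [← h0, ← Complex.exp_add, add_neg_cancel, Complex.exp_zero]
  have h2 : HasDerivAt (fun s => a t + Complex.log (r s * Complex.exp (-a t)))
      (r' * Complex.exp (-a t) / (r t * Complex.exp (-a t))) t :=
    ((hr.mul_const _).clog_real (by rw [h1]; exact Complex.one_mem_slitPlane)).const_add _
  rw [mul_div_mul_right _ _ (Complex.exp_ne_zero _)] at h2
  refine h2.congr_of_eventuallyEq ?_
  have h3 : ContinuousAt (fun s => (a s - a t).im) t :=
    Complex.continuous_im.continuousAt.comp (ha.sub continuousAt_const)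
  have h4 : ∀ᶠ s in 𝓝 t, (a s - a t).im ∈ Ioo (-Real.pi) Real.pi := by
    refine h3 (Ioo_mem_nhds ?_ ?_) <;> simp [Real.pi_pos]
  filter_upwards [h, h4] with s hs hs'
  rw [← hs, ← Complex.exp_add, ← sub_eq_add_neg, Complex.log_exp hs'.1 hs'.2.le]
  ring

namespace IsSlitFamily

variable {F : AccessoryParameters} {f : ℝ → ℂ → ℂ} {I : Set ℝ} (hf : IsSlitFamily F f I)
  {t : ℝ} (ht : t ∈ I)

include hf ht

/-! ### The motion of the prevertices -/

theorem hasDerivAt_Φz (l : Fin 4) :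
    HasDerivAt (fun u => F.Φz l (u, F.params t))
      (F.D l t * (F.γ t + ∑ s ∈ Finset.univ.erase l, F.ζ t (F.z l t - F.z s t) -
        2 * F.ζ t (F.z l t - F.z₀ t) - 2 * F.ζ t (F.z l t - conj (F.z₀ t)))) (F.z l t) := by
  have hτ := hf.ω₂_im_pos ht
  obtain ⟨h1, h2⟩ := (hf.not_isPole_iff_sigma ht).1 (hf.not_isPole_z ht l)
  rw [F.D_eq]
  -- The factor whose zero was removed has logarithmic derivative `zetaReg` at `0`, which vanishes.
  have hs : ∀ k, HasDerivAt (regAt l k (F.ω₂ t)) (regAt l k (F.ω₂ t) (F.z l t - F.z k t) *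
      if k = l then 0 else F.ζ t (F.z l t - F.z k t)) (F.z l t - F.z k t) := by
    intro k
    by_cases hk : k = l
    · subst hk
      rw [regAt_same, if_pos rfl, sub_self]
      have := hasDerivAt_sigmaReg (z := 0) hτ (by rw [sigmaReg_zero]; exact one_ne_zero)
      rwa [zetaReg_zero] at this
    · rw [regAt_of_ne hk, if_neg hk]
      exact hasDerivAt_sigma hτ (hf.sigma_ne_zero ht (hf.z_sub_z_notMem' ht hk))
  have key := hasDerivAt_kernel (β := F.β) (s := regAt l) (c := F.c t) (w := fun k => F.z k t) hs
    (hasDerivAt_sigma hτ h1) (hasDerivAt_sigma hτ h2) h1 h2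
  refine key.congr_deriv ?_
  have hsum : (∑ k, if k = l then 0 else F.ζ t (F.z l t - F.z k t)) =
      ∑ s ∈ Finset.univ.erase l, F.ζ t (F.z l t - F.z s t) := by
    rw [← Finset.add_sum_erase _ _ (Finset.mem_univ l), if_pos rfl, zero_add]
    exact Finset.sum_congr rfl fun k hk => if_neg (Finset.ne_of_mem_erase hk)
  rw [hsum]
  rfl

/-- Along the moving prevertex the integrand is identically zero, so its explicit time derivative
balances the contribution of the motion. -/
theorem timeDeriv_Φ_z (hI : IsOpen I) (l : Fin 4) :
    timeDeriv F.Φ F.params (F.z l t) t = -(F.D l t * deriv (F.z l) t) := by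
  have h1 := hasDerivAt_comp_path (hf.contDiffAt_Φ ht (hf.not_isPole_z ht l))
    (hf.hasDerivAt_z ht hI l) (hf.differentiableAt_params ht hI)
  have h2 : (fun s => F.Φ (F.z l s, F.params s)) = fun _ => 0 := by
    funext s; rw [F.Φ_eq_mul l, sub_self, zero_mul]
  have h3 : deriv (fun u => F.Φ (u, F.params t)) (F.z l t) = F.D l t := by
    have h4 := ((hasDerivAt_id (F.z l t)).sub_const (F.z l t)).fun_mul (hf.hasDerivAt_Φz ht l)
    simp only [F.Φ_eq_mul l]
    refine h4.deriv.trans ?_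
    rw [F.D_eq]
    simp
  rw [h2, h3] at h1
  exact eq_neg_of_add_eq_zero_right (h1.unique (hasDerivAt_const t 0))

theorem mapDot_eq_near_z (hI : IsOpen I) (l : Fin 4) :
    mapDot f t =ᶠ[𝓝 (F.z l t)] fun u => F.Φz l (u, F.params t) *
      (F.γk f l t + (u - F.z l t) * velocityReg F f t l u) := by
  have h : ∀ᶠ u in 𝓝[≠] (F.z l t), mapDot f t u = F.Φz l (u, F.params t) *
      (F.γk f l t + (u - F.z l t) * velocityReg F f t l u) := by
    filter_upwards [hf.eventually_notMem_singularSet ht (F.z l t), self_mem_nhdsWithin] with u hu hne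
    have hu0 : u - F.z l t ≠ 0 := sub_ne_zero.2 hne
    rw [hf.mapDot_eq ht hI hu, velocity_eq F f t l, F.integrand_eq, F.Φ_eq_mul l]
    field_simp
  rw [eventually_nhdsWithin_iff] at h
  filter_upwards [h] with u hu
  rcases eq_or_ne u (F.z l t) with rfl | hne
  · rw [hf.γk_eq ht hI, ← F.D_eq, sub_self, zero_mul, add_zero,
      mul_div_cancel₀ _ (hf.D_ne_zero ht l)]
  · exact hu hne

/-- The `u`-derivative of `mapDot` at `z_l` is computed twice: by interchanging it with the time
derivative, which brings in the motion of `z_l`, and from the product with `velocity`. -/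
theorem deriv_z (hI : IsOpen I) (l : Fin 4) :
    deriv (F.z l) t = -velocityReg F f t l (F.z l t) - F.γk f l t *
      (F.γ t + ∑ s ∈ Finset.univ.erase l, F.ζ t (F.z l t - F.z s t) -
        2 * F.ζ t (F.z l t - F.z₀ t) - 2 * F.ζ t (F.z l t - conj (F.z₀ t))) := by
  have h1 : HasDerivAt (mapDot f t) (timeDeriv F.Φ F.params (F.z l t) t) (F.z l t) :=
    (hf.hasDerivAt_deriv_time ht hI (hf.not_isPole_z ht l)).2
  have h2 := (hf.hasDerivAt_Φz ht l).fun_mul ((((hasDerivAt_id (F.z l t)).sub_const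
    (F.z l t)).fun_mul (hf.differentiableAt_velocityReg (f := f) ht l).hasDerivAt).const_add
      (F.γk f l t))
  have h3 := h1.unique (h2.congr_of_eventuallyEq (hf.mapDot_eq_near_z ht hI l))
  rw [hf.timeDeriv_Φ_z ht hI, ← F.D_eq] at h3
  simp only [id, sub_self, one_mul, zero_mul, add_zero] at h3
  refine mul_left_cancel₀ (hf.D_ne_zero ht l) ?_
  linear_combination -h3

theorem hasDerivAt_prevertex (hI : IsOpen I) (l : Fin 4) :
    HasDerivAt (F.z l)
      (deriv F.z₀ t
        - ∑ j ∈ Finset.univ.erase l, F.γk f j t *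
            (F.ζ t (F.z l t - F.z j t) - F.ζ t (F.z₀ t - F.z j t)
              - F.η₁ t * (F.z l t - F.z₀ t))
        - F.γk f l t *
            ((∑ s ∈ Finset.univ.erase l, F.ζ t (F.z l t - F.z s t)) + F.γ t
              - F.η₁ t * (F.z l t - F.z₀ t) - F.ζ t (F.z l t - F.z₀ t)
              - 2 * F.ζ t (F.z l t - conj (F.z₀ t)))) t := by
  refine (hf.hasDerivAt_z ht hI l).congr_deriv ?_
  -- Oddness merges the normalising term of index `l` with `-2 ζ(z_l - z₀)`, leaving coefficient
  -- `-1`.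
  have h : F.ζ t (F.z₀ t - F.z l t) = -F.ζ t (F.z l t - F.z₀ t) := by
    rw [← neg_sub (F.z l t)]
    exact zeta_neg _ _
  rw [hf.deriv_z ht hI, velocityReg, sub_self, zetaReg_zero, h]
  ring

/-! ### The residue -/

theorem deriv_Φa (hI : IsOpen I) : deriv (fun z => F.Φa (z, F.params t)) (F.z₀ t) = 0 :=
  (hf.mapDot_expansion ht hI (hf.contDiffAt_Φa ht) F.Φ_eq_div_left (hf.hasDerivAt_z₀ ht hI)).1

/-- First-order coefficients of `(z - z₀)² mapDot` at `z₀` are compared: one expansion comes from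
the moving double pole, the other from `velocity`. The factor `Φa` has zero derivative at `z₀`, so
only the derivative of `velocity` enters. -/
theorem timeDeriv_Φa (hI : IsOpen I) :
    timeDeriv F.Φa F.params (F.z₀ t) t = F.Φa (F.z₀ t, F.params t) *
      ∑ j, F.γk f j t * (F.P t (F.z₀ t - F.z j t) + F.η₁ t) := by
  obtain ⟨h0, Q, hQ, hQ'⟩ := hf.mapDot_expansion ht hI (hf.contDiffAt_Φa ht) F.Φ_eq_div_left
    (hf.hasDerivAt_z₀ ht hI)
  set Ψ : ℂ → ℂ := fun z => F.Φa (z, F.params t) with hΨ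
  have hΨd : HasDerivAt Ψ 0 (F.z₀ t) := h0 ▸ (differentiableAt_left (hf.contDiffAt_Φa ht)).hasDerivAt
  have h1 := hΨd.fun_mul (hf.hasDerivAt_velocity (f := f) ht fun k => hf.z₀_sub_z_notMem ht k)
  have hid := (hasDerivAt_id (F.z₀ t)).sub_const (F.z₀ t)
  have h2 := ((hid.const_mul (timeDeriv F.Φa F.params (F.z₀ t) t)).const_sub
    (-deriv F.z₀ t * F.Φa (F.z₀ t, F.params t))).fun_add
      ((hid.fun_pow 2).fun_mul hQ.differentiableAt.hasDerivAt)
  have he : (fun z => Ψ z * velocity F f t z) =ᶠ[𝓝 (F.z₀ t)] fun z =>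
      -deriv F.z₀ t * F.Φa (F.z₀ t, F.params t) -
        timeDeriv F.Φa F.params (F.z₀ t) t * (id z - F.z₀ t) + (id z - F.z₀ t) ^ 2 * Q z := by
    have h : ∀ᶠ z in 𝓝[≠] (F.z₀ t), Ψ z * velocity F f t z =
      -deriv F.z₀ t * F.Φa (F.z₀ t, F.params t) -
        timeDeriv F.Φa F.params (F.z₀ t) t * (id z - F.z₀ t) + (id z - F.z₀ t) ^ 2 * Q z := by
      filter_upwards [hQ', hf.eventually_notMem_singularSet ht (F.z₀ t), self_mem_nhdsWithin]
        with z hz hzs hne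
      have hz0 : z - F.z₀ t ≠ 0 := sub_ne_zero.2 hne
      rw [id, ← hz, hf.mapDot_eq ht hI hzs, F.integrand_eq, F.Φ_eq_div_left]
      field_simp
      exact mul_comm _ _
    rw [eventually_nhdsWithin_iff] at h
    filter_upwards [h] with z hz
    rcases eq_or_ne z (F.z₀ t) with rfl | hne
    · simp [velocity_z₀, hΨ, mul_comm]
    · exact hz hne
  have h3 := h1.unique (h2.congr_of_eventuallyEq he)
  simp only [id, sub_self, zero_mul, zero_add, mul_one, ne_eq, OfNat.ofNat_ne_zero,
    not_false_eq_true, zero_pow, Nat.cast_ofNat, Nat.add_one_sub_one, pow_one, mul_zero,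
    add_zero] at h3
  rw [← neg_eq_iff_eq_neg] at h3
  rw [← h3, ← mul_neg, ← Finset.sum_neg_distrib]
  congr 1
  refine Finset.sum_congr rfl fun j _ => ?_
  ring

theorem hasDerivAt_residue (hI : IsOpen I) :
    HasDerivAt F.residue (F.residue t *
      ∑ j, F.γk f j t * (F.P t (F.z₀ t - F.z j t) + F.η₁ t)) t := by
  have h := (hasDerivAt_comp_path (hf.contDiffAt_Φa ht) (hf.hasDerivAt_z₀ ht hI)
    (hf.differentiableAt_params ht hI)).fun_neg
  -- The motion of `z₀` does not contribute, by the vanishing residue of `f'`.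
  rw [hf.deriv_Φa ht hI, hf.timeDeriv_Φa ht hI, zero_mul, zero_add] at h
  simp only [← F.residue_eq] at h
  rw [F.residue_eq, neg_mul]
  exact h

theorem residue_ne_zero : F.residue t ≠ 0 := by
  rw [F.residue_eq]; exact neg_ne_zero.2 (hf.Φa_ne_zero ht)

theorem contDiffAt_residue (hI : IsOpen I) : ContDiffAt ℝ 1 F.residue t := by
  have hp := hf.contDiffAt_params ht hI
  have h : ContDiffAt ℝ 1 (fun s => F.Φa (F.z₀ s, F.params s)) t :=
    ContDiffAt.comp (g := F.Φa) (f := fun s => (F.z₀ s, F.params s)) t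
      (((hf.contDiffAt_Φa ht).of_le one_le_two).restrict_scalars ℝ)
      (hp.snd.snd.snd.fst.prodMk hp)
  have e : F.residue = fun s => -F.Φa (F.z₀ s, F.params s) := funext F.residue_eq
  rw [e]
  exact h.neg

omit ht in
theorem exists_log_residue (hI : IsOpen I) (hI' : I.OrdConnected) :
    ∃ a : ℝ → ℂ, ContinuousOn a I ∧ ∀ t ∈ I, Complex.exp (a t) = F.residue t :=
  exists_continuousOn_log hI hI' (fun _ ht => (hf.contDiffAt_residue ht hI).contDiffWithinAt)
    fun _ ht => hf.residue_ne_zero ht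

theorem hasDerivAt_log_residue (hI : IsOpen I) {a : ℝ → ℂ} (ha : ContinuousOn a I)
    (h : ∀ t ∈ I, Complex.exp (a t) = F.residue t) :
    HasDerivAt a (∑ j, F.γk f j t * (F.P t (F.z₀ t - F.z j t) + F.η₁ t)) t := by
  have hI0 := hI.mem_nhds ht
  refine (hasDerivAt_of_exp_eq (ha.continuousAt hI0) (hf.hasDerivAt_residue ht hI)
    (by filter_upwards [hI0] with s hs using h s hs)).congr_deriv ?_
  rw [mul_div_cancel_left₀ _ (hf.residue_ne_zero ht)]

/-! ### The motion of the pole -/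

/-- The condition for the integrand to have no residue at `z₀`. -/
theorem residue_condition (hI : IsOpen I) :
    F.γ t + ∑ k, F.ζ t (F.z₀ t - F.z k t) - 2 * F.ζ t (F.z₀ t - conj (F.z₀ t)) = 0 := by
  have hτ := hf.ω₂_im_pos ht
  have hb := hf.sigma_ne_zero ht (hf.z₀_sub_conj_notMem ht)
  have ha : sigmaReg (F.ω₂ t) (F.z₀ t - F.z₀ t) ≠ 0 := by
    rw [sub_self, sigmaReg_zero]; exact one_ne_zero
  have key := hasDerivAt_kernel (β := F.β) (s := fun _ => sigma 1) (c := F.c t)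
    (w := fun k => F.z k t)
    (fun k => hasDerivAt_sigma hτ (hf.sigma_ne_zero ht (hf.z₀_sub_z_notMem ht k)))
    (hasDerivAt_sigmaReg hτ ha) (hasDerivAt_sigma hτ hb) ha hb
  rw [sub_self, zetaReg_zero, mul_zero, sub_zero] at key
  have h := key.deriv.symm.trans (hf.deriv_Φa ht hI)
  exact (mul_eq_zero.1 h).resolve_left (hf.Φa_ne_zero ht)

theorem hasDerivAt_ζ_comp (hI : IsOpen I) {w : ℝ → ℂ} {w' : ℂ} (hw : HasDerivAt w w' t)
    (h : w t ∉ Lat (F.ω₂ t)) :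
    HasDerivAt (fun s => F.ζ s (w s))
      (-F.P t (w t) * w' + F.dζ t (w t) * (2 * deriv F.m t * Complex.I)) t := by
  have hm : HasDerivAt F.ω₂ (2 * deriv F.m t * Complex.I) t :=
    ((((hf.smooth_m.contDiffAt (hI.mem_nhds ht)).differentiableAt
      one_ne_zero).hasDerivAt.ofReal_comp).const_mul 2).mul_const Complex.I
  exact hasDerivAt_zeta_comp (hf.ω₂_im_pos ht) (hf.sigma_ne_zero ht h) hw hm

/-- This is the time derivative of the residue condition. The two unpaired `𝔓` terms come from the
vertical motion of `z₃` and `z₄` with velocities of opposite sign. -/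
theorem pole_equation (hI : IsOpen I) :
    F.W t * deriv F.y₀ t = Complex.I * ∑ k, F.P t (F.z₀ t - F.z k t) * deriv (F.x k) t +
      (4 * F.dζ t (F.z₀ t - conj (F.z₀ t)) + (-(4 * F.β / Real.pi) * F.dζ t (1 / 2)
        - 2 * ∑ k, F.dζ t (F.z₀ t - F.z k t)
        - F.P t (F.z₀ t - F.z 2 t) + F.P t (F.z₀ t - F.z 3 t))) * deriv F.m t := by
  have hI0 := hI.mem_nhds ht
  have hd : ∀ {g : ℝ → ℝ}, ContDiffOn ℝ 1 g I → HasDerivAt (fun s => (g s : ℂ)) ((deriv g t : ℝ) : ℂ) t :=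
    fun hg => ((hg.contDiffAt hI0).differentiableAt one_ne_zero).hasDerivAt.ofReal_comp
  have hz0 : HasDerivAt F.z₀ ((deriv F.y₀ t : ℝ) * Complex.I) t := (hd hf.smooth_y₀).mul_const _
  have hz : ∀ k, HasDerivAt (F.z k)
      (deriv (F.x k) t + (![0, 0, 1, -1] : Fin 4 → ℂ) k * deriv F.m t * Complex.I) t := fun k =>
    (hd (hf.smooth_x k)).fun_add (((hd hf.smooth_m).const_mul _).mul_const _)
  have hc : HasDerivAt (fun s => conj (F.z₀ s)) (-(deriv F.y₀ t * Complex.I)) t := by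
    simp only [F.conj_z₀]; exact hz0.fun_neg
  have h1 : HasDerivAt F.γ (((F.β / Real.pi : ℝ) : ℂ) *
      (2 * (F.dζ t (1 / 2) * (2 * deriv F.m t * Complex.I)))) t := by
    have h := hf.hasDerivAt_ζ_comp ht hI (hasDerivAt_const t (1 / 2 : ℂ))
      (half_notMem_Lat (hf.ω₂_im_pos ht))
    rw [mul_zero, zero_add] at h
    exact (h.const_mul 2).const_mul _
  have h2 := fun k => hf.hasDerivAt_ζ_comp ht hI (hz0.fun_sub (hz k)) (hf.z₀_sub_z_notMem ht k)
  have h3 := hf.hasDerivAt_ζ_comp ht hI (hz0.fun_sub hc) (hf.z₀_sub_conj_notMem ht)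
  have h4 := (h1.fun_add (HasDerivAt.fun_sum fun k (_ : k ∈ Finset.univ) => h2 k)).fun_sub
    (h3.const_mul 2)
  have h5 := h4.unique ((hasDerivAt_const t (0 : ℂ)).congr_of_eventuallyEq (by
    filter_upwards [hI0] with s hs using hf.residue_condition hs hI))
  simp only [Fin.sum_univ_four, AccessoryParameters.W] at h5 ⊢
  simp only [Matrix.cons_val] at h5
  push_cast at h5 ⊢
  -- The differentiated condition carries the factor `i` from `z₀ = i y₀`, so the claim is
  -- multiplied by `i` before comparison.
  refine mul_left_cancel₀ Complex.I_ne_zero ?_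
  linear_combination h5 - (F.P t (F.z₀ t - F.z 0 t) * (deriv (F.x 0) t : ℝ) +
    F.P t (F.z₀ t - F.z 1 t) * (deriv (F.x 1) t : ℝ) + F.P t (F.z₀ t - F.z 2 t) * (deriv (F.x 2) t : ℝ) +
    F.P t (F.z₀ t - F.z 3 t) * (deriv (F.x 3) t : ℝ)) * Complex.I_sq

/-- All velocities are real, so after division by `W` the real part is taken; the factor `i` turns
it into minus the imaginary part in the sum. -/
theorem hasDerivAt_pole (hI : IsOpen I) (hW : F.W t ≠ 0) :
    HasDerivAt F.y₀
      (-(∑ k, (F.P t (F.z₀ t - F.z k t) / F.W t).im * deriv (F.x k) t)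
        + ((4 * F.dζ t (F.z₀ t - conj (F.z₀ t))) / F.W t
            + (-(4 * F.β / Real.pi) * F.dζ t (1 / 2)
                - 2 * ∑ k, F.dζ t (F.z₀ t - F.z k t)
                - F.P t (F.z₀ t - F.z 2 t) + F.P t (F.z₀ t - F.z 3 t)) / F.W t).re
          * deriv F.m t) t := by
  refine ((hf.smooth_y₀.contDiffAt (hI.mem_nhds ht)).differentiableAt
    one_ne_zero).hasDerivAt.congr_deriv ?_
  have h := hf.pole_equation ht hI
  rw [mul_comm, ← eq_div_iff hW, add_div, mul_div_assoc, Finset.sum_div, mul_div_right_comm,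
    add_div] at h
  have h' := congrArg Complex.re h
  rw [Complex.ofReal_re, Complex.add_re, Complex.I_mul_re, Complex.re_mul_ofReal,
    Complex.im_sum] at h'
  rw [h']
  congr 2
  refine Finset.sum_congr rfl fun k _ => ?_
  rw [mul_div_right_comm, Complex.im_mul_ofReal]

end IsSlitFamily

end SlitMap

end

/-! ### The system of differential equations -/

theorem theorem3 (F : SlitMap.AccessoryParameters) (f : ℝ → ℂ → ℂ) (I : Set ℝ)
    (hI : IsOpen I) (hI' : I.OrdConnected) (hf : SlitMap.IsSlitFamily F f I) :
    -- the quantities `γ_k` and `a = log d_{-1}` are well defined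
    (∀ k, ∀ t ∈ I, DifferentiableAt ℝ (F.A f k) t ∧ F.D k t ≠ 0) ∧
    (∃ a : ℝ → ℂ, ContinuousOn a I ∧ ∀ t ∈ I, Complex.exp (a t) = F.residue t) ∧
    -- the equations for the prevertices
    (∀ l, ∀ t ∈ I, HasDerivAt (F.z l)
      (deriv F.z₀ t
        - ∑ j ∈ Finset.univ.erase l, F.γk f j t *
            (F.ζ t (F.z l t - F.z j t) - F.ζ t (F.z₀ t - F.z j t)
              - F.η₁ t * (F.z l t - F.z₀ t))
        - F.γk f l t *
            ((∑ s ∈ Finset.univ.erase l, F.ζ t (F.z l t - F.z s t)) + F.γ t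
              - F.η₁ t * (F.z l t - F.z₀ t) - F.ζ t (F.z l t - F.z₀ t)
              - 2 * F.ζ t (F.z l t - (starRingEnd ℂ) (F.z₀ t)))) t) ∧
    -- the equation for every continuous branch `a` of `log d_{-1}`
    (∀ a : ℝ → ℂ, ContinuousOn a I → (∀ t ∈ I, Complex.exp (a t) = F.residue t) →
      ∀ t ∈ I, HasDerivAt a
        (∑ j, F.γk f j t * (F.P t (F.z₀ t - F.z j t) + F.η₁ t)) t) ∧
    -- the equation for the position of the pole
    (∀ t ∈ I, F.W t ≠ 0 → HasDerivAt F.y₀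
      (-(∑ k, (F.P t (F.z₀ t - F.z k t) / F.W t).im * deriv (F.x k) t)
        + ((4 * F.dζ t (F.z₀ t - (starRingEnd ℂ) (F.z₀ t))) / F.W t
            + (-(4 * F.β / Real.pi) * F.dζ t (1 / 2)
                - 2 * ∑ k, F.dζ t (F.z₀ t - F.z k t)
                - F.P t (F.z₀ t - F.z 2 t) + F.P t (F.z₀ t - F.z 3 t)) / F.W t).re
          * deriv F.m t) t) := by
  exact ⟨fun k t ht => ⟨(hf.hasDerivAt_A ht hI k).differentiableAt, hf.D_ne_zero ht k⟩,
    hf.exists_log_residue hI hI', fun l t ht => hf.hasDerivAt_prevertex ht hI l,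
    fun a ha h t ht => hf.hasDerivAt_log_residue ht hI ha h,
    fun t ht hW => hf.hasDerivAt_pole ht hI hW⟩
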